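/- **Setting.** Let $\mathcal M$ be an oriented matroid on a finite set $E$ with underlying matroid $M$ of rank $r$, assumed loopless, and fix one of its two chirotopes $\chi$. A matroid is *decomposable* if it is the direct sum of its restrictions to two nonempty complementary subsets of the ground set, and *connected* otherwise. For a flat $F$ let $M|_F$ be the restriction to $F$ and $M/F$ the contraction, with ground set $E\setminus F$. *Orlik–Solomon algebra.* $A^\bullet(M)$ is the quotient of the exterior algebra over $\mathbb Z$ on the generators $e\in E$ by the two-sided ideal generated by $\partial e_S$, $S$ dependent, where $\partial(e_1\wedge\cdots\wedge e_k)=\sum_i(-1)^{k-i}e_1\wedge\cdots\widehat{e_i}\cdots\wedge e_k$. For an atom (rank one flat) $c$ the residue map $\mathrm{Res}_c:A^\bullet(M)\to A^{\bullet-1}(M/c)$ is determined by $\mathrm{Res}_c(x\wedge e)=x$ for $e\in c$ and $\mathrm{Res}_c(x)=0$, if $x$ is a monomial without factors in $c$. For a saturated flag of flats $F_\bullet=(\emptyset=F_0\subset F_1\subset\cdots\subset F_r=E)$ let $\mathrm{Res}_{F_\bullet}:A^r(M)\to A^0(M/E)=\mathbb Z$ be the composition of the residue maps at $F_1$, $F_2\setminus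 F_1$, …, $F_r\setminus F_{r-1}$. *Topes and canonical forms.* A tope $P$ is a maximal signed covector. Its face lattice $L(P)$ is the set of the flats $\{e\in E: X(e)=0\}$, where $X$ is a covector obtained from $P$ by setting some entries to $0$; it has minimum $\emptyset$ and maximum $E$. For $F\in L(P)$, $P|_F$ is a tope of $\mathcal M|_F$ and $P|_{E\setminus F}$ is a tope of $\mathcal M/F$. The canonical form $\Omega_P=\Omega_P(\mathcal M)\in A^r(M)$ is the unique element such that $\Omega_P=\chi(\emptyset)$ if $r=0$ and, if $r>0$, for every atom $c$ and every $e\in c$: $\mathrm{Res}_c\,\Omega_P=P(e)\,\Omega_{P|_{E\setminus c}}(\mathcal M/c)$ if $c\in L(P)$, where $\mathcal M/c$ has the chirotope $\chi(\,\cdot\,,e)$, and $\mathrm{Res}_c\,\Omega_P=0$ if $c\notin L(P)$. *Amplitudes.* For $S\subseteq E$ put $a_S=\sum_{e\in S}a_e$. Let $R_0=\mathbb Z[a_e\mid e\in E]/(a_E)$ and $Q_0=\mathrm{Frac}(R_0)$. The amplitude of a tope $P$ is the value, taken modulo $a_E$, of the de Rham intersection form at $(\Omega_P,\Omega_P)$: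 $$\mathcal A(P)=\langle\Omega_P,\Omega_P\rangle^{dR}=\sum_{F_\bullet}\mathrm{Res}_{F_\bullet}(\Omega_P)\Big(\prod_{i=1}^{r-1}\frac1{a_{F_i}}\Big)\mathrm{Res}_{F_\bullet}(\Omega_P)\in Q_0,$$ the sum being over all saturated flags of flats of $M$. It does not depend on the choice of $\chi$. For $q\in Q_0$, the residue $\mathrm{res}_{a_F}q=(a_Fq)|_{a_F=0}\in\mathrm{Frac}(R_0/(a_F))$ is defined if $a_Fq$ is regular at the generic point of $\{a_F=0\}$. For $F\in L(P)$, $F\neq\emptyset,E$, the amplitudes $\mathcal A(P|_F)$ (of $\mathcal M|_F$) and $\mathcal A(P|_{E\setminus F})$ (of $\mathcal M/F$) are regarded as elements of $\mathrm{Frac}(R_0/(a_F))$ by the inclusion of the variables $a_e$, $e\in F$, resp. $e\in E\setminus F$; this is possible since $a_F=a_{E\setminus F}=0$ in $R_0/(a_F)$. **Theorem (locality and unitarity of matroid amplitudes).** 1. If $M$ is decomposable, then $\mathcal A(P)=0$ for every tope $P$ of $\mathcal M$. 2. If $M$ is connected and $P$ is a tope, then all poles of the rational function $\mathcal A(P)$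 are simple, and they can only be along $\{a_F=0\}$ for connected $F\in L(P)\setminus\{\emptyset,E\}$ (that is, $M|_F$ connected). More precisely, for every prime element $\pi$ of $R_0$ the function $\pi\,\mathcal A(P)$ has no pole along $\{\pi=0\}$, and if $\mathcal A(P)$ has a pole along $\{\pi=0\}$, then $\pi$ is associated to $a_F$ for such an $F$. 3. If $M$ is connected, $P$ is a tope and $F\in L(P)\setminus\{\emptyset,E\}$, then $\mathrm{res}_{a_F}\mathcal A(P)$ is defined, and $$\mathrm{res}_{a_F}\mathcal A(P)=\mathcal A(P|_F)\,\mathcal A(P|_{E\setminus F})\qquad\text{if }E\setminus F\notin L(P).$$ If $E\setminus F\in L(P)$, so that $\{a_F=0\}=\{a_{E\setminus F}=0\}$ is the divisor of two faces of $P$ with $a_{E\setminus F}=-a_F$, then the residue is the difference of the contributions of the two faces: $$\mathrm{res}_{a_F}\mathcal A(P)=\mathcal A(P|_F)\,\mathcal A(P|_{E\setminus F})-\mathcal A'(P|_{E\setminus F})\,\mathcal A'(P|_F),$$ where $\mathcal A'(P|_{E\setminus F})$ is the amplitude for $\mathcal M|_{E\setminus F}$ and $\mathcal A'(P|_F)$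 is the amplitude for $\mathcal M/(E\setminus F)$. -/

import Mathlib

noncomputable section

open Set
open scoped Matroid

namespace MatroidAmplitude

universe u

variable {α : Type u}

/-! ### Matroids -/

/-- `M` is decomposable: it is a direct sum of its restrictions to two nonempty
complementary subsets of the ground set. -/
def Decomposable (M : Matroid α) : Prop :=
  ∃ (E₁ E₂ : Set α) (h : Disjoint E₁ E₂), E₁.Nonempty ∧ E₂.Nonempty ∧ E₁ ∪ E₂ = M.E ∧
    M = (M ↾ E₁).disjointSum (M ↾ E₂) h

/-- A matroid is connected (indecomposable) if it is not decomposable. -/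
def Connected (M : Matroid α) : Prop := ¬ Decomposable M

/-- The rank of a matroid (always applied to matroids of finite rank). -/
def rank (M : Matroid α) : ℕ := M.eRank.toNat

/-- Saturated flags of flats `F₁ ⊂ ⋯ ⊂ F_k` with `rk F_i = i`, where `F i` is the flat of rank
`i + 1`. The step `F₀`, which is always the set of loops, is not recorded. -/
def IsFlag (M : Matroid α) (k : ℕ) (F : Fin k → Set α) : Prop :=
  StrictMono F ∧ ∀ i, M.IsFlat (F i) ∧ M.eRk (F i) = (i : ℕ) + 1

/-! ### The Orlik–Solomon algebra and its residue maps -/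

/-- The exterior algebra over `ℤ` on the generators `e ∈ α`. -/
abbrev Ext (α : Type u) : Type u := ExteriorAlgebra ℤ (α →₀ ℤ)

/-- The generator of the exterior algebra attached to `e`. -/
def gen (e : α) : Ext α := ExteriorAlgebra.ι ℤ (Finsupp.single e 1)

/-- The product `e₁ ∧ e₂ ∧ ⋯ ∧ e_k` for a list `[e₁, …, e_k]`. -/
def monomial (l : List α) : Ext α := (l.map gen).prod

/-- The linear functional on the span of `α` that is `1` on the elements of `c` and `0` on
the other elements. -/
def indicatorFunctional (c : Set α) : Module.Dual ℤ (α →₀ ℤ) :=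
  Finsupp.linearCombination ℤ (c.indicator fun _ => (1 : ℤ))

/-- Contraction from the right with the functional `1_c`:
`e₁ ∧ ⋯ ∧ e_k ↦ ∑_{e_i ∈ c} (-1)^(k-i) e₁ ∧ ⋯ ê_i ⋯ ∧ e_k`. -/
def contraction (c : Set α) : Ext α →ₗ[ℤ] Ext α :=
  (CliffordAlgebra.contractRight (Q := (0 : QuadraticForm ℤ (α →₀ ℤ)))).flip
    (indicatorFunctional c)

/-- The boundary map
`∂ (e₁ ∧ ⋯ ∧ e_k) = ∑ (-1)^(k-i) e₁ ∧ ⋯ ê_i ⋯ ∧ e_k`. -/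
def boundary : Ext α →ₗ[ℤ] Ext α := contraction univ

/-- The generators of the Orlik–Solomon ideal: `∂ e_S` for `S ⊆ E` dependent, together with
the elements of `α` outside the ground set `E`, so that the quotient is the quotient
of the exterior algebra on `E`. -/
def osRelations (M : Matroid α) : Set (Ext α) :=
  {x | ∃ l : List α, l.Nodup ∧ M.Dep {e | e ∈ l} ∧ x = boundary (monomial l)} ∪
    {x | ∃ e, e ∉ M.E ∧ x = gen e}

/-- The Orlik–Solomon ideal: the two-sided ideal generated by the relations. -/
def osIdeal (M : Matroid α) : Submodule ℤ (Ext α) :=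
  Submodule.span ℤ {x | ∃ u, ∃ g ∈ osRelations M, ∃ v, x = u * g * v}

/-- The Orlik–Solomon algebra of `M`, as a `ℤ`-module. -/
abbrev OS (M : Matroid α) : Type u := Ext α ⧸ osIdeal M

/-- The degree `k` component of the Orlik–Solomon algebra. -/
def OS.degree (M : Matroid α) (k : ℕ) : Submodule ℤ (OS M) :=
  Submodule.map (osIdeal M).mkQ (⋀[ℤ]^k (α →₀ ℤ))

open Classical in
/-- The residue map `Res_c : A(M) → A(M/c)` at an atom `c`, which sends
`x ∧ e` to `x` if `e ∈ c` and no factor of the monomial `x` is in `c`, and a monomial without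
factors in `c` to `0`. It is induced by contraction with `1_c`, because the elements of `c`
are zero in `A(M/c)`. The set `c` is intersected with the ground set. By `osIdeal_le_comap`
the map descends to the quotients when `M` is loopless and `c ∩ M.E` is an atom. -/
def res (M : Matroid α) (c : Set α) : OS M →ₗ[ℤ] OS (M ／ c) :=
  if h : osIdeal M ≤ (osIdeal (M ／ c)).comap (contraction (c ∩ M.E)) then
    (osIdeal M).mapQ (osIdeal (M ／ c)) (contraction (c ∩ M.E)) h
  else 0

open Classical in
/-- The degree `0` coefficient, which gives the identification `A⁰(M) ≅ ℤ`.
By `osIdeal_le_ker` it is well defined when `M` is loopless. -/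
def coeff (M : Matroid α) : OS M →ₗ[ℤ] ℤ :=
  if h : osIdeal M ≤ LinearMap.ker (ExteriorAlgebra.algebraMapInv (R := ℤ)
      (M := α →₀ ℤ)).toLinearMap then
    (osIdeal M).liftQ (ExteriorAlgebra.algebraMapInv (R := ℤ) (M := α →₀ ℤ)).toLinearMap h
  else 0

/-- The residue `Res_{F_•} = Res_{F_k/F_{k-1}} ∘ ⋯ ∘ Res_{F_2/F_1} ∘ Res_{F_1}` along a flag
`[F₁, …, F_k]` of flats, followed by the identification of degree `0` with `ℤ`. After the first
`i` steps the matroid is `M/F_i` with ground set `E ∖ F_i`, so the next step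
is the residue at the atom `F_{i+1} ∖ F_i`. -/
def flagRes : (M : Matroid α) → List (Set α) → (OS M →ₗ[ℤ] ℤ)
  | M, [] => coeff M
  | M, F :: l => flagRes (M ／ F) l ∘ₗ res M F

open Classical in
/-- The de Rham cohomology intersection form on `A^k(M)`,
`⟨x, y⟩ = ∑_{F_•} Res_{F_•}(x) · ∏_{i=1}^{k-1} 1 / a_{F_i} · Res_{F_•}(y)`,
where the value of `a_S` in the field `K` is `w S`. -/
def deRhamForm [Fintype α] {K : Type*} [Field K] (M : Matroid α) (w : Set α → K) (k : ℕ)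
    (x y : OS M) : K :=
  ∑ F : Fin k → Set α, if IsFlag M k F then
    (flagRes M (List.ofFn F) x : K) *
      (∏ i : Fin k, if (i : ℕ) + 1 < k then (w (F i))⁻¹ else 1) *
      (flagRes M (List.ofFn F) y : K)
  else 0

/-! ### The residue maps are well defined -/

theorem contraction_mul (c : Set α) (x y : Ext α) :
    contraction c (x * y) = x * contraction c y +
      contraction c x * CliffordAlgebra.involute y := by
  induction y using ExteriorAlgebra.induction generalizing x with
  | algebraMap r =>
    have h1 := CliffordAlgebra.contractRight_mul_algebraMap (Q := (0 : QuadraticForm ℤ (α →₀ ℤ)))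
      (indicatorFunctional c) x r
    have h2 := CliffordAlgebra.contractRight_algebraMap (0 : QuadraticForm ℤ (α →₀ ℤ))
      (indicatorFunctional c) r
    simp only [contraction, LinearMap.flip_apply] at h1 h2 ⊢
    rw [h1, h2, AlgHom.commutes, mul_zero, zero_add]
  | ι v =>
    have := CliffordAlgebra.contractRight_mul_ι (Q := (0 : QuadraticForm ℤ (α →₀ ℤ)))
      (indicatorFunctional c) v x
    simp only [contraction, LinearMap.flip_apply, ExteriorAlgebra.ι] at this ⊢
    rw [this, CliffordAlgebra.contractRight_ι, CliffordAlgebra.involute_ι]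
    rw [← Algebra.commutes, ← Algebra.smul_def, mul_neg]
    abel
  | mul a b ha hb =>
    rw [← mul_assoc, hb, ha x, hb a, map_mul]
    noncomm_ring
  | add a b ha hb =>
    rw [mul_add, map_add, ha, hb, map_add, map_add]
    noncomm_ring

theorem contraction_gen_of_mem {c : Set α} {e : α} (h : e ∈ c) : contraction c (gen e) = 1 := by
  simp only [contraction, gen, ExteriorAlgebra.ι, LinearMap.flip_apply,
    CliffordAlgebra.contractRight_ι]
  simp [indicatorFunctional, h]

theorem contraction_gen_of_notMem {c : Set α} {e : α} (h : e ∉ c) :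
    contraction c (gen e) = 0 := by
  simp only [contraction, gen, ExteriorAlgebra.ι, LinearMap.flip_apply,
    CliffordAlgebra.contractRight_ι]
  simp [indicatorFunctional, h]

theorem contraction_one (c : Set α) : contraction c (1 : Ext α) = 0 := by
  simp [contraction, CliffordAlgebra.contractRight_one]

theorem involute_gen (e : α) : CliffordAlgebra.involute (gen e : Ext α) = -gen e := by
  simp only [gen, ExteriorAlgebra.ι, CliffordAlgebra.involute_ι]

theorem involute_monomial (l : List α) :
    CliffordAlgebra.involute (monomial l : Ext α) = monomial l ∨
    CliffordAlgebra.involute (monomial l : Ext α) = -monomial l := by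
  induction l with
  | nil => left; simp [monomial]
  | cons a l ih =>
    have h : monomial (a :: l) = gen a * monomial l := by simp [monomial]
    rw [h, map_mul, involute_gen]
    rcases ih with ih | ih <;> rw [ih] <;> simp

theorem monomial_append (l l' : List α) : monomial (l ++ l') = monomial l * monomial l' := by
  simp [monomial]

theorem monomial_perm {l l' : List α} (h : l.Perm l') :
    monomial l = monomial l' ∨ monomial l = -monomial l' := by
  induction h with
  | nil => simp
  | cons x _ ih =>
    simp only [monomial, List.map_cons, List.prod_cons] at ih ⊢
    rcases ih with ih | ih <;> rw [ih] <;> simp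
  | swap x y l =>
    right
    simp only [monomial, List.map_cons, List.prod_cons, ← mul_assoc]
    rw [← neg_mul]
    congr 1
    exact eq_neg_of_add_eq_zero_left (ExteriorAlgebra.ι_add_mul_swap _ _)
  | trans _ _ ih₁ ih₂ =>
    rcases ih₁ with h₁ | h₁ <;> rcases ih₂ with h₂ | h₂ <;> rw [h₁, h₂] <;> simp

theorem mul_mem_osIdeal (M : Matroid α) {x : Ext α} (hx : x ∈ osIdeal M) (u v : Ext α) :
    u * x * v ∈ osIdeal M := by
  induction hx using Submodule.span_induction with
  | mem x h =>
    obtain ⟨a, g, hg, b, rfl⟩ := h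
    exact Submodule.subset_span ⟨u * a, g, hg, b * v, by noncomm_ring⟩
  | zero => simp
  | add x y _ _ hx hy => rw [mul_add, add_mul]; exact add_mem hx hy
  | smul r x _ hx =>
    rw [mul_smul_comm, smul_mul_assoc]; exact Submodule.smul_mem _ _ hx

theorem mul_mem_osIdeal_left (M : Matroid α) {x : Ext α} (hx : x ∈ osIdeal M) (u : Ext α) :
    u * x ∈ osIdeal M := by simpa using mul_mem_osIdeal M hx u 1

theorem mul_mem_osIdeal_right (M : Matroid α) {x : Ext α} (hx : x ∈ osIdeal M) (v : Ext α) :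
    x * v ∈ osIdeal M := by simpa using mul_mem_osIdeal M hx 1 v

theorem gen_mem_osIdeal (M : Matroid α) {e : α} (he : e ∉ M.E) : gen e ∈ osIdeal M :=
  Submodule.subset_span ⟨1, gen e, Or.inr ⟨e, he, rfl⟩, 1, by simp⟩

theorem boundary_mem_osIdeal (M : Matroid α) {l : List α} (hn : l.Nodup)
    (hl : M.Dep {e | e ∈ l}) : boundary (monomial l) ∈ osIdeal M :=
  Submodule.subset_span ⟨1, _, Or.inl ⟨l, hn, hl, rfl⟩, 1, by simp⟩

theorem gen_mul_self (e : α) : gen e * gen e = 0 := ExteriorAlgebra.ι_sq_zero _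

theorem monomial_mem_osIdeal (M : Matroid α) {l : List α} (hn : l.Nodup)
    (hl : M.Dep {e | e ∈ l}) : monomial l ∈ osIdeal M := by
  rcases List.eq_nil_or_concat l with rfl | ⟨l', e, rfl⟩
  · exact absurd M.empty_indep (by simpa using hl.not_indep)
  · have h1 := mul_mem_osIdeal_right M (boundary_mem_osIdeal M hn hl) (gen e)
    have h2 : boundary (monomial (l'.concat e)) * gen e = monomial (l'.concat e) := by
      rw [List.concat_eq_append, monomial_append]
      have : monomial [e] = gen e := by simp [monomial]
      rw [this, boundary, contraction_mul, contraction_gen_of_mem (mem_univ e), involute_gen,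
        add_mul, mul_assoc, mul_assoc, neg_mul, gen_mul_self]
      simp
    rwa [h2] at h1

theorem isBasis_singleton (M : Matroid α) [M.Loopless] {c : Set α} (hc : c ⊆ M.E)
    (hr : M.eRk c = 1) {s : α} (hs : s ∈ c) : M.IsBasis {s} c := by
  have hi : M.Indep {s} := (M.isNonloop_of_loopless (hc hs)).indep
  obtain ⟨J, hJ, hsJ⟩ := hi.subset_isBasis_of_subset (singleton_subset_iff.2 hs)
  have h1 : J.encard = 1 := by rw [hJ.encard_eq_eRk, hr]
  obtain ⟨t, rfl⟩ := encard_eq_one.1 h1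
  obtain rfl : s = t := by simpa using hsJ
  exact hJ

theorem contraction_boundary (c : Set α) (x : Ext α) :
    contraction c (boundary x) = -boundary (contraction c x) := by
  simpa [contraction, boundary] using CliffordAlgebra.contractRight_comm
    (Q := (0 : QuadraticForm ℤ (α →₀ ℤ))) (indicatorFunctional univ) (indicatorFunctional c) x

theorem contraction_monomial_of_disjoint {c : Set α} {l : List α} (h : ∀ e ∈ l, e ∉ c) :
    contraction c (monomial l) = 0 := by
  induction l with
  | nil => simp [monomial, contraction_one]
  | cons a l ih =>
    have hm : monomial (a :: l) = gen a * monomial l := by simp [monomial]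
    rw [hm, contraction_mul, ih fun e he => h e (by simp [he]),
      contraction_gen_of_notMem (h a (by simp))]
    simp

theorem contraction_boundary_monomial_mem (M : Matroid α) [M.Loopless] {c : Set α}
    (hc : c ⊆ M.E) (hr : M.eRk c = 1) {l : List α} (hn : l.Nodup) (hl : M.Dep {e | e ∈ l}) :
    boundary (monomial l) ∈ osIdeal (M ／ c) ∧
      contraction c (boundary (monomial l)) ∈ osIdeal (M ／ c) := by
  classical
  set I := osIdeal (M ／ c) with hI
  have genmem : ∀ e ∈ c, gen e ∈ I := fun e he => gen_mem_osIdeal _ (by simp [he])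
  have hperm := List.filter_append_perm (fun e => decide (e ∉ c)) l
  set l₁ := l.filter (fun e => decide (e ∉ c)) with hl₁
  set l₂ := l.filter (fun e => !decide (e ∉ c)) with hl₂
  have h₁ : ∀ e ∈ l₁, e ∉ c := fun e he => by simpa using (List.mem_filter.1 he).2
  have h₂ : ∀ e ∈ l₂, e ∈ c := fun e he => by simpa using (List.mem_filter.1 he).2
  have hn₁ : l₁.Nodup := hn.filter _
  have hdj : Disjoint c {e | e ∈ l₁} :=
    Set.disjoint_left.2 fun e he he' => h₁ e he' he
  have hset : {e | e ∈ l} = {e | e ∈ l₁} ∪ {e | e ∈ l₂} := by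
    ext e; simp [← hperm.mem_iff]
  obtain ⟨s₀, hs₀⟩ : c.Nonempty := by
    rw [nonempty_iff_ne_empty]; rintro rfl; simp at hr
  suffices hmain : boundary (monomial (l₁ ++ l₂)) ∈ I ∧
      contraction c (boundary (monomial (l₁ ++ l₂))) ∈ I by
    rcases monomial_perm hperm with h | h
    · rwa [h] at hmain
    · rw [h] at hmain; simpa using hmain
  have hx0 : contraction c (monomial l₁) = 0 := contraction_monomial_of_disjoint h₁
  have hx1 : contraction c (boundary (monomial l₁)) = 0 := by
    rw [contraction_boundary, hx0]; simp
  clear_value l₁ l₂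
  rw [monomial_append]
  match l₂, h₂, hset with
  | [], _, hset =>
    have hd : (M ／ c).Dep {e | e ∈ l₁} := by
      rw [(isBasis_singleton M hc hr hs₀).contract_dep_iff]
      refine ⟨Matroid.Dep.superset (M := M) ?_ subset_union_left ?_, hdj⟩
      · simpa [hset] using hl
      · refine union_subset ?_ (singleton_subset_iff.2 (hc hs₀))
        simpa [hset] using hl.subset_ground
    have : monomial ([] : List α) = 1 := by simp [monomial]
    rw [this, mul_one, hx1]
    exact ⟨boundary_mem_osIdeal _ hn₁ hd, zero_mem _⟩
  | [s], h₂, hset =>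
    have hs : s ∈ c := h₂ s (by simp)
    have hd : (M ／ c).Dep {e | e ∈ l₁} := by
      rw [(isBasis_singleton M hc hr hs).contract_dep_iff]
      refine ⟨?_, hdj⟩
      have : {e | e ∈ l₁} ∪ {s} = {e | e ∈ l} := by rw [hset]; simp
      rwa [this]
    have hm : monomial [s] = gen s := by simp [monomial]
    have hb : boundary (monomial l₁ * monomial [s]) =
        monomial l₁ - boundary (monomial l₁) * gen s := by
      rw [hm, boundary, contraction_mul, contraction_gen_of_mem (mem_univ s), involute_gen]
      noncomm_ring
    rw [hb]
    refine ⟨sub_mem (monomial_mem_osIdeal _ hn₁ hd)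
      (mul_mem_osIdeal_left _ (genmem s hs) _), ?_⟩
    rw [map_sub, hx0, contraction_mul, hx1, contraction_gen_of_mem hs]
    simpa using boundary_mem_osIdeal _ hn₁ hd
  | s :: t :: l₃, h₂, _ =>
    have hs := genmem s (h₂ s (by simp))
    have ht := genmem t (h₂ t (by simp))
    have hst : gen s - gen t ∈ I := sub_mem hs ht
    have hm : monomial (s :: t :: l₃) = gen s * gen t * monomial l₃ := by
      simp [monomial, mul_assoc]
    have key : ∀ c' : Set α, s ∈ c' → t ∈ c' →
        contraction c' (gen s * gen t) = gen s - gen t := fun c' h h' => by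
      rw [contraction_mul, contraction_gen_of_mem h, contraction_gen_of_mem h', involute_gen]
      noncomm_ring
    have hsc := h₂ s (by simp)
    have htc := h₂ t (by simp)
    have hinv2 : CliffordAlgebra.involute (gen s * gen t : Ext α) = gen s * gen t := by
      rw [map_mul, involute_gen, involute_gen]; noncomm_ring
    set z := monomial l₃ with hz
    set y := monomial (s :: t :: l₃) with hy
    have hst2 : gen s * gen t ∈ I := mul_mem_osIdeal_right _ hs _
    have hyI : y ∈ I := by rw [hm]; exact mul_mem_osIdeal_right _ hst2 _
    have hinvy : CliffordAlgebra.involute y ∈ I := by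
      rcases involute_monomial (s :: t :: l₃) with h | h <;> rw [← hy] at h <;> rw [h]
      · exact hyI
      · exact neg_mem hyI
    have hby : boundary y = gen s * gen t * boundary z +
        (gen s - gen t) * CliffordAlgebra.involute z := by
      rw [hm, boundary, contraction_mul, key _ (mem_univ _) (mem_univ _)]
    have hbyI : boundary y ∈ I := by
      rw [hby]
      exact add_mem (mul_mem_osIdeal_right _ hst2 _) (mul_mem_osIdeal_right _ hst _)
    have hcy : contraction c y ∈ I := by
      rw [hm, contraction_mul, key _ hsc htc]
      exact add_mem (mul_mem_osIdeal_right _ hst2 _) (mul_mem_osIdeal_right _ hst _)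
    have hcy' : contraction c (CliffordAlgebra.involute y) ∈ I := by
      rcases involute_monomial (s :: t :: l₃) with h | h <;> rw [← hy] at h <;> rw [h]
      · exact hcy
      · rw [map_neg]; exact neg_mem hcy
    have hcby : contraction c (boundary y) ∈ I := by
      rw [hby, map_add, contraction_mul, contraction_mul _ (gen s - gen t), key _ hsc htc,
        map_sub, contraction_gen_of_mem hsc, contraction_gen_of_mem htc, sub_self, zero_mul,
        add_zero]
      exact add_mem (add_mem (mul_mem_osIdeal_right _ hst2 _) (mul_mem_osIdeal_right _ hst _))
        (mul_mem_osIdeal_right _ hst _)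
    have hb : boundary (monomial l₁ * y) = monomial l₁ * boundary y +
        boundary (monomial l₁) * CliffordAlgebra.involute y := by
      rw [boundary, contraction_mul]
    rw [hb]
    refine ⟨add_mem (mul_mem_osIdeal_left _ hbyI _) (mul_mem_osIdeal_left _ hinvy _), ?_⟩
    rw [map_add, contraction_mul, contraction_mul, hx0, hx1]
    simpa using add_mem (mul_mem_osIdeal_left _ hcby _) (mul_mem_osIdeal_left _ hcy' _)

/-- The residue map at an atom `c` of a loopless matroid is well defined: contraction with `1_c`
maps the Orlik–Solomon ideal of `M` into that of `M/c`. -/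
theorem osIdeal_le_comap (M : Matroid α) [M.Loopless] {c : Set α} (hc : c ⊆ M.E)
    (hr : M.eRk c = 1) : osIdeal M ≤ (osIdeal (M ／ c)).comap (contraction c) := by
  have hgood : ∀ g ∈ osRelations M, g ∈ osIdeal (M ／ c) ∧ contraction c g ∈ osIdeal (M ／ c) ∧
      CliffordAlgebra.involute g ∈ osIdeal (M ／ c) := by
    rintro g (⟨l, hn, hl, rfl⟩ | ⟨e, he, rfl⟩)
    · have h := contraction_boundary_monomial_mem M hc hr hn hl
      refine ⟨h.1, h.2, ?_⟩
      have h' : CliffordAlgebra.involute (boundary (monomial l)) =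
          -boundary (CliffordAlgebra.involute (monomial l)) := by
        generalize monomial l = x
        induction x using ExteriorAlgebra.induction with
        | algebraMap r =>
          have h2 := CliffordAlgebra.contractRight_algebraMap (0 : QuadraticForm ℤ (α →₀ ℤ))
            (indicatorFunctional univ) r
          simp only [boundary, contraction, LinearMap.flip_apply] at h2 ⊢
          rw [h2, AlgHom.commutes, h2]; simp
        | ι v =>
          simp only [boundary, contraction, LinearMap.flip_apply, ExteriorAlgebra.ι,
            CliffordAlgebra.contractRight_ι, CliffordAlgebra.involute_ι, AlgHom.commutes, map_neg,
            neg_neg]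
        | mul a b ha hb =>
          simp only [boundary] at ha hb ⊢
          rw [contraction_mul, map_add, map_mul, map_mul, ha, hb, map_mul, contraction_mul]
          noncomm_ring
        | add a b ha hb => rw [map_add, map_add, ha, hb, map_add, map_add, neg_add]
      rw [h']
      rcases involute_monomial l with h2 | h2 <;> rw [h2]
      · exact neg_mem h.1
      · simpa using h.1
    · have hec : e ∉ c := fun h => he (hc h)
      have hm : gen e ∈ osIdeal (M ／ c) := gen_mem_osIdeal _ (fun h => he h.1)
      refine ⟨hm, ?_, ?_⟩
      · rw [contraction_gen_of_notMem hec]; exact zero_mem _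
      · rw [involute_gen]; exact neg_mem hm
  refine Submodule.span_le.2 ?_
  rintro x ⟨u, g, hg, v, rfl⟩
  obtain ⟨h1, h2, h3⟩ := hgood g hg
  change contraction c (u * g * v) ∈ osIdeal (M ／ c)
  rw [contraction_mul, contraction_mul]
  refine add_mem (mul_mem_osIdeal _ h1 _ _) (mul_mem_osIdeal_right _ (add_mem ?_ ?_) _)
  · exact mul_mem_osIdeal_left _ h2 _
  · exact mul_mem_osIdeal_left _ h3 _

/-- The degree `0` coefficient is well defined on the Orlik–Solomon algebra of a loopless
matroid. -/
theorem osIdeal_le_ker (M : Matroid α) [M.Loopless] :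
    osIdeal M ≤ LinearMap.ker (ExteriorAlgebra.algebraMapInv (R := ℤ)
      (M := α →₀ ℤ)).toLinearMap := by
  have hgen : ∀ e : α, ExteriorAlgebra.algebraMapInv (gen e : Ext α) = 0 := fun e => by
    simp [ExteriorAlgebra.algebraMapInv, gen]
  refine Submodule.span_le.2 ?_
  rintro x ⟨u, g, hg, v, rfl⟩
  suffices h : ExteriorAlgebra.algebraMapInv g = 0 by simp [h]
  rcases hg with ⟨l, hn, hl, rfl⟩ | ⟨e, he, rfl⟩
  · match l, hl with
    | [], hl => exact absurd M.empty_indep (by simpa using hl.not_indep)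
    | [a], hl =>
      refine absurd (M.subsingleton_indep (I := {e | e ∈ [a]}) ?_ hl.subset_ground) hl.not_indep
      simp
    | a :: b :: l, hl =>
      have hm : monomial (a :: b :: l) = gen a * gen b * monomial l := by
        simp [monomial, mul_assoc]
      rw [hm, boundary, contraction_mul, contraction_mul, contraction_gen_of_mem (mem_univ a),
        contraction_gen_of_mem (mem_univ b), involute_gen]
      simp [hgen]
  · exact hgen e

/-! ### Oriented matroids -/

/-- The composition `X ∘ Y` of sign vectors. -/
def comp (X Y : α → SignType) : α → SignType := fun e => if X e ≠ 0 then X e else Y e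

/-- An oriented matroid with underlying matroid `toMatroid`, given by its signed covectors
(extended by `0` outside the ground set), together with a choice of one of
its two chirotopes. -/
structure OrientedMatroid (α : Type u) where
  /-- The underlying matroid. -/
  toMatroid : Matroid α
  /-- The signed covectors. -/
  covectors : Set (α → SignType)
  /-- The chirotope. -/
  chirotope : List α → SignType
  apply_eq_zero : ∀ X ∈ covectors, ∀ e, e ∉ toMatroid.E → X e = 0
  zero_mem : 0 ∈ covectors
  neg_mem : ∀ X ∈ covectors, -X ∈ covectors
  comp_mem : ∀ X ∈ covectors, ∀ Y ∈ covectors, comp X Y ∈ covectors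
  elimination : ∀ X ∈ covectors, ∀ Y ∈ covectors, ∀ e, X e ≠ 0 → X e = -Y e →
    ∃ Z ∈ covectors, Z e = 0 ∧ ∀ f, ¬ (X f ≠ 0 ∧ X f = -Y f) → Z f = comp X Y f
  /-- The flats of the underlying matroid are the zero sets of the covectors. -/
  isFlat_iff : ∀ F, toMatroid.IsFlat F ↔ ∃ X ∈ covectors, F = {e ∈ toMatroid.E | X e = 0}
  /-- The chirotope is nonzero exactly on the ordered bases. -/
  chirotope_ne_zero_iff : ∀ l, chirotope l ≠ 0 ↔ l.Nodup ∧ toMatroid.IsBase {e | e ∈ l}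
  /-- The chirotope is alternating. -/
  chirotope_swap : ∀ l₁ e f l₂,
    chirotope (l₁ ++ e :: f :: l₂) = -chirotope (l₁ ++ f :: e :: l₂)
  /-- The chirotope is compatible with the covectors: if two bases differ by the exchange of `e`
  and `f`, and `X` vanishes on their common elements, then `X e` and `X f` are
  in the ratio of the values of the chirotope. -/
  chirotope_covector : ∀ X ∈ covectors, ∀ l : List α, (∀ x ∈ l, X x = 0) → ∀ e f,
    chirotope (e :: l) * X f = chirotope (f :: l) * X e

namespace OrientedMatroid

variable (M : OrientedMatroid α)

theorem eq_zero_of_mem_closure {X : α → SignType} (hX : X ∈ M.covectors) {S : Set α}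
    (hS : ∀ e ∈ S, X e = 0) {e : α} (he : e ∈ M.toMatroid.closure S) : X e = 0 := by
  have hflat : M.toMatroid.IsFlat {e ∈ M.toMatroid.E | X e = 0} :=
    (M.isFlat_iff _).2 ⟨X, hX, rfl⟩
  have := (M.toMatroid.mem_closure_iff_forall_mem_isFlat (S ∩ M.toMatroid.E)).1
    (by simpa using he) _ hflat (fun x hx => ⟨hx.2, hS x hx.1⟩)
  exact this.2

/-- The contraction `M/F`, where `b` is an ordered basis of `F`: its covectors are the
covectors of `M` that vanish on `F`, and its chirotope is `χ_{M/F}(l) = χ_M(l, b)`. -/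
def contract (F : Set α) (b : List α) (hn : b.Nodup) (hb : M.toMatroid.IsBasis {e | e ∈ b} F) :
    OrientedMatroid α where
  toMatroid := M.toMatroid ／ F
  covectors := {X ∈ M.covectors | ∀ e ∈ F, X e = 0}
  chirotope l := M.chirotope (l ++ b)
  apply_eq_zero := by
    rintro X ⟨hX, hF⟩ e he
    by_cases h : e ∈ F
    · exact hF e h
    · exact M.apply_eq_zero X hX e fun h' => he ⟨h', h⟩
  zero_mem := ⟨M.zero_mem, fun _ _ => rfl⟩
  neg_mem := fun X hX => ⟨M.neg_mem X hX.1, fun e he => by simp [hX.2 e he]⟩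
  comp_mem := fun X hX Y hY =>
    ⟨M.comp_mem X hX.1 Y hY.1, fun e he => by simp [comp, hX.2 e he, hY.2 e he]⟩
  elimination := by
    intro X hX Y hY e he hXY
    obtain ⟨Z, hZ, hZe, hZf⟩ := M.elimination X hX.1 Y hY.1 e he hXY
    refine ⟨Z, ⟨hZ, fun f hf => ?_⟩, hZe, hZf⟩
    rw [hZf f (by simp [hX.2 f hf])]
    simp [comp, hX.2 f hf, hY.2 f hf]
  isFlat_iff := by
    intro G
    rw [Matroid.isFlat_iff_closure_eq, Matroid.contract_closure_eq]
    constructor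
    · intro h
      obtain ⟨X, hX, hXG⟩ := (M.isFlat_iff _).1 (M.toMatroid.isFlat_closure (G ∪ F))
      have hF : F ⊆ M.toMatroid.closure (G ∪ F) :=
        (M.toMatroid.subset_closure F hb.subset_ground).trans
          (M.toMatroid.closure_subset_closure subset_union_right)
      refine ⟨X, ⟨hX, fun e he => ?_⟩, ?_⟩
      · have := hF he
        rw [hXG] at this
        exact this.2
      · rw [← h, hXG]
        ext e
        simp only [mem_sdiff, mem_ofPred_eq, Matroid.contract_ground]
        tauto
    · rintro ⟨X, ⟨hX, hXF⟩, rfl⟩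
      have hflat : M.toMatroid.IsFlat {e ∈ M.toMatroid.E | X e = 0} :=
        (M.isFlat_iff _).2 ⟨X, hX, rfl⟩
      have hEF : F ⊆ M.toMatroid.E := hb.subset_ground
      have : {e | e ∈ (M.toMatroid ／ F).E ∧ X e = 0} ∪ F = {e ∈ M.toMatroid.E | X e = 0} := by
        ext e
        simp only [mem_union, mem_ofPred_eq, Matroid.contract_ground, mem_sdiff]
        constructor
        · rintro (h | h)
          · exact ⟨h.1.1, h.2⟩
          · exact ⟨hEF h, hXF e h⟩
        · rintro ⟨h1, h2⟩
          by_cases h : e ∈ F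
          · exact Or.inr h
          · exact Or.inl ⟨⟨h1, h⟩, h2⟩
      rw [this, hflat.closure]
      ext e
      simp only [mem_sdiff, mem_ofPred_eq, Matroid.contract_ground]
      tauto
  chirotope_ne_zero_iff := by
    intro l
    rw [M.chirotope_ne_zero_iff, List.nodup_append']
    have hu : {e | e ∈ l ++ b} = {e | e ∈ l} ∪ {e | e ∈ b} := by ext; simp
    rw [hu, Matroid.isBase_iff_indep_closure_eq, Matroid.isBase_iff_indep_closure_eq,
      hb.contract_indep_iff, Matroid.contract_closure_eq]
    have hcl : M.toMatroid.closure ({e | e ∈ l} ∪ F) =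
        M.toMatroid.closure ({e | e ∈ l} ∪ {e | e ∈ b}) := by
      rw [← M.toMatroid.closure_union_closure_right_eq, ← hb.closure_eq_closure,
        M.toMatroid.closure_union_closure_right_eq]
    rw [hcl]
    have hFc : F ⊆ M.toMatroid.closure ({e | e ∈ l} ∪ {e | e ∈ b}) := by
      rw [← hcl]
      exact (M.toMatroid.subset_closure F hb.subset_ground).trans
        (M.toMatroid.closure_subset_closure subset_union_right)
    constructor
    · rintro ⟨⟨h1, -, h3⟩, h4, h5⟩
      refine ⟨h1, ⟨h4, Set.disjoint_left.2 fun e heF hel => ?_⟩, by rw [h5]; rfl⟩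
      have heb : e ∉ b := fun h => h3 hel h
      have hins : M.toMatroid.Indep (insert e {e | e ∈ b}) :=
        h4.subset (insert_subset (Or.inl hel) subset_union_right)
      exact heb (hb.mem_of_insert_indep heF hins)
    · rintro ⟨h1, ⟨h2, h3⟩, h4⟩
      refine ⟨⟨h1, hn, fun e hel heb => Set.disjoint_left.1 h3 (hb.subset heb) hel⟩, h2, ?_⟩
      rw [← sdiff_union_of_subset hFc, h4, Matroid.contract_ground,
        sdiff_union_of_subset hb.subset_ground]
  chirotope_swap := fun l₁ e f l₂ => by
    simpa using M.chirotope_swap l₁ e f (l₂ ++ b)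
  chirotope_covector := by
    rintro X ⟨hX, hF⟩ l hl e f
    refine M.chirotope_covector X hX (l ++ b) (fun x hx => ?_) e f
    rcases List.mem_append.1 hx with h | h
    · exact hl x h
    · exact hF x (hb.subset h)

theorem isBase_append_iff {F : Set α} (hF : F ⊆ M.toMatroid.E) {b : List α} (hn : b.Nodup)
    (hb : (M.toMatroid ／ F).IsBase {e | e ∈ b}) {l : List α} (hl : ∀ e ∈ l, e ∈ F) :
    (l ++ b).Nodup ∧ M.toMatroid.IsBase {e | e ∈ l ++ b} ↔
      l.Nodup ∧ M.toMatroid.IsBasis {e | e ∈ l} F := by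
  have hu : {e | e ∈ l ++ b} = {e | e ∈ l} ∪ {e | e ∈ b} := by ext; simp
  have hbE : ∀ e ∈ b, e ∉ F := fun e he => (hb.subset_ground he).2
  have hbase : ∀ B, M.toMatroid.IsBasis B F → M.toMatroid.IsBase (B ∪ {e | e ∈ b}) := by
    intro B hB
    rw [Matroid.isBase_iff_indep_closure_eq, hB.contract_indep_iff,
      Matroid.contract_closure_eq] at hb
    rw [Matroid.isBase_iff_indep_closure_eq, union_comm]
    refine ⟨hb.1.1, ?_⟩
    have hcl : M.toMatroid.closure ({e | e ∈ b} ∪ F) =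
        M.toMatroid.closure ({e | e ∈ b} ∪ B) := by
      rw [← M.toMatroid.closure_union_closure_right_eq, ← hB.closure_eq_closure,
        M.toMatroid.closure_union_closure_right_eq]
    have hFc : F ⊆ M.toMatroid.closure ({e | e ∈ b} ∪ F) :=
      (M.toMatroid.subset_closure F hF).trans
        (M.toMatroid.closure_subset_closure subset_union_right)
    rw [← hcl, ← sdiff_union_of_subset hFc, hb.2, Matroid.contract_ground,
      sdiff_union_of_subset hF]
  rw [List.nodup_append', hu]
  constructor
  · rintro ⟨⟨h1, -, -⟩, h2⟩
    refine ⟨h1, ?_⟩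
    obtain ⟨B, hB, hlB⟩ := (h2.indep.subset subset_union_left).subset_isBasis_of_subset
      (show {e | e ∈ l} ⊆ F from hl)
    have heq := h2.eq_of_subset_isBase (hbase B hB) (union_subset_union_left _ hlB)
    have : B = {e | e ∈ l} := by
      refine subset_antisymm (fun e he => ?_) hlB
      have : e ∈ {e | e ∈ l} ∪ {e | e ∈ b} := heq ▸ Or.inl he
      exact this.resolve_right fun h => hbE e h (hB.subset he)
    rwa [← this]
  · rintro ⟨h1, h2⟩
    exact ⟨⟨h1, hn, fun e he he' => hbE e he' (hl e he)⟩, hbase _ h2⟩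

open Classical in
/-- The restriction `M|F`, where `b` is an ordered basis of `M/F`: its covectors are the
restrictions of the covectors of `M` to `F`, and its chirotope is
`χ_{M|F}(l) = χ_M(l, b)` for lists of elements of `F`. -/
def restrict (F : Set α) (hF : F ⊆ M.toMatroid.E) (b : List α) (hn : b.Nodup)
    (hb : (M.toMatroid ／ F).IsBase {e | e ∈ b}) : OrientedMatroid α where
  toMatroid := M.toMatroid ↾ F
  covectors := {X | ∃ Y ∈ M.covectors, X = F.indicator Y}
  chirotope l := if ∀ e ∈ l, e ∈ F then M.chirotope (l ++ b) else 0
  apply_eq_zero := by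
    rintro _ ⟨Y, hY, rfl⟩ e he
    exact indicator_of_notMem he _
  zero_mem := ⟨0, M.zero_mem, by simp⟩
  neg_mem := by
    rintro _ ⟨Y, hY, rfl⟩
    exact ⟨-Y, M.neg_mem Y hY, by ext e; by_cases h : e ∈ F <;> simp [h]⟩
  comp_mem := by
    rintro _ ⟨X, hX, rfl⟩ _ ⟨Y, hY, rfl⟩
    exact ⟨_, M.comp_mem X hX Y hY, by ext e; by_cases h : e ∈ F <;> simp [h, comp]⟩
  elimination := by
    rintro _ ⟨X, hX, rfl⟩ _ ⟨Y, hY, rfl⟩ e he hXY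
    have heF : e ∈ F := by
      by_contra h; simp [h] at he
    simp only [heF, indicator_of_mem] at he hXY
    obtain ⟨Z, hZ, hZe, hZf⟩ := M.elimination X hX Y hY e he hXY
    refine ⟨_, ⟨Z, hZ, rfl⟩, by simp [hZe], fun f hf => ?_⟩
    by_cases h : f ∈ F
    · simp only [h, indicator_of_mem] at hf ⊢
      rw [hZf f hf]; simp [comp, h]
    · simp [comp, h]
  isFlat_iff := by
    intro G
    constructor
    · intro h
      have hGF : G ⊆ F := h.subset_ground
      rw [Matroid.isFlat_iff_closure_eq, Matroid.restrict_closure_eq _ hGF hF] at h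
      obtain ⟨X, hX, hXG⟩ := (M.isFlat_iff _).1 (M.toMatroid.isFlat_closure G)
      refine ⟨_, ⟨X, hX, rfl⟩, ?_⟩
      rw [← h, hXG]
      ext e
      simp only [mem_inter_iff, mem_ofPred_eq, Matroid.restrict_ground_eq]
      constructor
      · rintro ⟨⟨_, h2⟩, h3⟩; exact ⟨h3, by simp [h3, h2]⟩
      · rintro ⟨h1, h2⟩; exact ⟨⟨hF h1, by simpa [h1] using h2⟩, h1⟩
    · rintro ⟨_, ⟨X, hX, rfl⟩, rfl⟩
      have hsub : {e | e ∈ (M.toMatroid ↾ F).E ∧ F.indicator X e = 0} ⊆ F := fun e he => he.1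
      rw [Matroid.isFlat_iff_closure_eq, Matroid.restrict_closure_eq _ hsub hF]
      refine subset_antisymm ?_ ?_
      · rintro e ⟨h1, h2⟩
        refine ⟨h2, ?_⟩
        rw [indicator_of_mem h2]
        refine M.eq_zero_of_mem_closure hX ?_ h1
        rintro x ⟨hx1, hx2⟩
        have hx1' : x ∈ F := hx1
        rwa [indicator_of_mem hx1'] at hx2
      · exact subset_inter (M.toMatroid.subset_closure _ (hsub.trans hF)) hsub
  chirotope_ne_zero_iff := by
    intro l
    rw [Matroid.isBase_restrict_iff hF]
    split_ifs with hl
    · rw [M.chirotope_ne_zero_iff, M.isBase_append_iff hF hn hb hl]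
    · simp only [ne_eq, not_true_eq_false, false_iff]
      rintro ⟨-, h⟩
      exact hl fun e he => h.subset he
  chirotope_swap := by
    intro l₁ e f l₂
    have : (∀ x ∈ l₁ ++ e :: f :: l₂, x ∈ F) ↔ (∀ x ∈ l₁ ++ f :: e :: l₂, x ∈ F) := by
      simp only [List.mem_append, List.mem_cons]
      constructor <;> intro h x hx <;> exact h x (by tauto)
    simp only [this]
    split_ifs
    · simpa using M.chirotope_swap l₁ e f (l₂ ++ b)
    · simp
  chirotope_covector := by
    -- by symmetry it suffices to treat a basis containing `e`
    have key : ∀ X ∈ M.covectors, ∀ l : List α, (∀ x ∈ l, x ∈ F ∧ X x = 0) → ∀ e ∈ F, ∀ f ∈ F,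
        M.chirotope (e :: (l ++ b)) ≠ 0 →
        M.chirotope (e :: (l ++ b)) * X f = M.chirotope (f :: (l ++ b)) * X e := by
      intro X hX l hl e he f hf hne
      have hne' := (M.chirotope_ne_zero_iff _).1 hne
      have hbas := (M.isBase_append_iff hF hn hb (l := e :: l) (by
        intro x hx
        rcases List.mem_cons.1 hx with rfl | h
        · exact he
        · exact (hl x h).1)).1 hne'
      have hFcl : F ⊆ M.toMatroid.closure {x | x ∈ e :: l} := hbas.2.subset_closure
      by_cases hXe : X e = 0
      · have : X f = 0 := M.eq_zero_of_mem_closure hX (S := {x | x ∈ e :: l}) (by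
          intro x hx
          rcases List.mem_cons.1 hx with rfl | h
          · exact hXe
          · exact (hl x h).2) (hFcl hf)
        rw [this, hXe]; simp
      · obtain ⟨Y₀, hY₀, hH⟩ := (M.isFlat_iff _).1
          (M.toMatroid.isFlat_closure {x | x ∈ l ++ b})
        have hsub : {x | x ∈ l ++ b} ⊆ M.toMatroid.E :=
          Subset.trans (fun x hx => List.mem_cons_of_mem _ hx) hne'.2.subset_ground
        have hY₀l : ∀ x ∈ l ++ b, Y₀ x = 0 := by
          intro x hx
          have : x ∈ M.toMatroid.closure {x | x ∈ l ++ b} := M.toMatroid.subset_closure _ hsub hx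
          rw [hH] at this
          exact this.2
        have hY₀e : Y₀ e ≠ 0 := by
          intro h
          have h1 : e ∈ M.toMatroid.closure {x | x ∈ l ++ b} := by
            rw [hH]; exact ⟨hF he, h⟩
          have h2 : e ∉ l ++ b := (List.nodup_cons.1 hne'.1).1
          refine hne'.2.indep.notMem_closure_sdiff_of_mem (e := e) (by simp) ?_
          refine M.toMatroid.closure_subset_closure ?_ h1
          intro x hx
          exact ⟨List.mem_cons_of_mem _ hx, by rintro rfl; exact h2 hx⟩
        obtain ⟨Y, hY, hYl, hYe⟩ : ∃ Y ∈ M.covectors, (∀ x ∈ l ++ b, Y x = 0) ∧ Y e = X e := by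
          by_cases h : Y₀ e = X e
          · exact ⟨Y₀, hY₀, hY₀l, h⟩
          · refine ⟨-Y₀, M.neg_mem _ hY₀, fun x hx => by simp [hY₀l x hx], ?_⟩
            revert h hY₀e hXe
            simp only [Pi.neg_apply]
            generalize Y₀ e = p
            generalize X e = q
            revert p q; decide
        have hYf : Y f = X f := by
          obtain ⟨Z, hZ, hZe, hZf⟩ := M.elimination X hX (-Y) (M.neg_mem _ hY) e hXe
            (by simp [hYe])
          have hZ0 : Z f = 0 := M.eq_zero_of_mem_closure hZ (S := {x | x ∈ e :: l}) (by
            intro x hx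
            rcases List.mem_cons.1 hx with rfl | h
            · exact hZe
            · rw [hZf x (by simp [(hl x h).2])]
              simp [comp, (hl x h).2, hYl x (List.mem_append_left _ h)]) (hFcl hf)
          by_cases h : X f ≠ 0 ∧ X f = -(-Y) f
          · simpa using h.2.symm
          · have := hZf f h
            rw [hZ0] at this
            by_cases hXf : X f = 0
            · simp only [comp, hXf, ne_eq, not_true_eq_false, if_false, Pi.neg_apply] at this
              rw [hXf]
              simpa using this.symm
            · simp only [comp, ne_eq, hXf, not_false_eq_true, if_true] at this
              exact absurd this.symm hXf
        rw [← hYf, ← hYe]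
        exact M.chirotope_covector Y hY (l ++ b) hYl e f
    rintro _ ⟨X, hX, rfl⟩ l hl e f
    by_cases he : e ∈ F
    · by_cases hf : f ∈ F
      · by_cases hlF : ∀ x ∈ l, x ∈ F
        · have hle : ∀ x ∈ e :: l, x ∈ F := by simpa [he] using hlF
          have hlf : ∀ x ∈ f :: l, x ∈ F := by simpa [hf] using hlF
          have hl' : ∀ x ∈ l, x ∈ F ∧ X x = 0 := fun x hx =>
            ⟨hlF x hx, by simpa [hlF x hx] using hl x hx⟩
          rw [if_pos hle, if_pos hlf, indicator_of_mem he, indicator_of_mem hf]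
          by_cases h1 : M.chirotope (e :: (l ++ b)) = 0
          · by_cases h2 : M.chirotope (f :: (l ++ b)) = 0
            · simp [h1, h2]
            · exact (key X hX l hl' f hf e he h2).symm
          · exact key X hX l hl' e he f hf h1
        · have hle : ¬ ∀ x ∈ e :: l, x ∈ F := fun h => hlF fun x hx => h x (by simp [hx])
          have hlf : ¬ ∀ x ∈ f :: l, x ∈ F := fun h => hlF fun x hx => h x (by simp [hx])
          rw [if_neg hle, if_neg hlf]; simp
      · have hlf : ¬ ∀ x ∈ f :: l, x ∈ F := fun h => hf (h f (by simp))
        rw [if_neg hlf, indicator_of_notMem hf]; simp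
    · have hle : ¬ ∀ x ∈ e :: l, x ∈ F := fun h => he (h e (by simp))
      rw [if_neg hle, indicator_of_notMem he]; simp

end OrientedMatroid

/-! ### Rings of parameters, poles and residues -/

theorem mem_of_elimination {E : Set α} {I : Ideal (MvPolynomial E ℤ)}
    {ψ : MvPolynomial E ℤ →ₐ[ℤ] MvPolynomial E ℤ}
    (h : ∀ e, ψ (MvPolynomial.X e) - MvPolynomial.X e ∈ I) {p : MvPolynomial E ℤ}
    (hp : ψ p = 0) : p ∈ I := by
  have : ((Ideal.Quotient.mkₐ ℤ I).comp ψ) = Ideal.Quotient.mkₐ ℤ I := by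
    ext e
    simpa using (Ideal.Quotient.mk_eq_mk_iff_sub_mem _ _).2 (h e)
  have h2 := DFunLike.congr_fun this p
  rw [AlgHom.comp_apply, hp, map_zero] at h2
  exact Ideal.Quotient.eq_zero_iff_mem.1 h2.symm

section Parameters

variable [Fintype α]

open Classical in
/-- The linear form `a_S = ∑_{e ∈ S} a_e` in the polynomial ring `ℤ[a_e | e ∈ E]`, for `S ⊆ E`. -/
def linearForm (E S : Set α) : MvPolynomial E ℤ :=
  ∑ e : E, if (e : α) ∈ S then MvPolynomial.X e else 0

/-- The ring `R₀ = ℤ[a_e | e ∈ E] / (a_E)`. -/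
def R₀ (E : Set α) : Type u := MvPolynomial E ℤ ⧸ Ideal.span {linearForm E E}

instance (E : Set α) : CommRing (R₀ E) :=
  inferInstanceAs (CommRing (MvPolynomial E ℤ ⧸ Ideal.span {linearForm E E}))

/-- The quotient map `ℤ[a_e | e ∈ E] → R₀`. -/
def toR₀ (E : Set α) : MvPolynomial E ℤ →+* R₀ E := Ideal.Quotient.mk _

/-- The class of `a_S` in `R₀`. -/
def aForm (E S : Set α) : R₀ E := toR₀ E (linearForm E S)

/-- The ring `R₀ / (a_F)`. -/
def R₀Mod (E F : Set α) : Type u := R₀ E ⧸ Ideal.span {aForm E F}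

instance (E F : Set α) : CommRing (R₀Mod E F) :=
  inferInstanceAs (CommRing (R₀ E ⧸ Ideal.span {aForm E F}))

/-- The restriction map `R₀ → R₀ / (a_F)` to the locus `a_F = 0`. -/
def restrictZero (E F : Set α) : R₀ E →+* R₀Mod E F := Ideal.Quotient.mk _

theorem toR₀_surjective (E : Set α) : Function.Surjective (toR₀ E) :=
  Ideal.Quotient.mk_surjective

theorem restrictZero_surjective (E F : Set α) : Function.Surjective (restrictZero E F) :=
  Ideal.Quotient.mk_surjective

theorem toR₀_eq_zero_iff {E : Set α} {p : MvPolynomial E ℤ} :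
    toR₀ E p = 0 ↔ p ∈ Ideal.span {linearForm E E} := Ideal.Quotient.eq_zero_iff_mem

theorem restrictZero_eq_zero_iff {E F : Set α} {x : R₀ E} :
    restrictZero E F x = 0 ↔ x ∈ Ideal.span {aForm E F} := Ideal.Quotient.eq_zero_iff_mem

open Classical in
theorem linearForm_add (E F : Set α) : linearForm E F + linearForm E (E \ F) = linearForm E E := by
  simp only [linearForm, ← Finset.sum_add_distrib]
  refine Finset.sum_congr rfl fun e _ => ?_
  by_cases h : (e : α) ∈ F <;> simp [h]

open Classical in
/-- Substitution that eliminates one variable in `F ∩ E` and one variable in `E \ F`. -/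
theorem exists_elimination (E F : Set α) : ∃ ψ : MvPolynomial E ℤ →ₐ[ℤ] MvPolynomial E ℤ,
    ψ (linearForm E F) = 0 ∧ ψ (linearForm E (E \ F)) = 0 ∧
    ∀ e, ψ (MvPolynomial.X e) - MvPolynomial.X e ∈
      Ideal.span {linearForm E F, linearForm E (E \ F)} := by
  have hc : ∀ S : Set α, ∃ c : E → ℤ, (∀ e : E, (e : α) ∉ S → c e = 0) ∧
      ((∑ e, c e = 1) ∨ linearForm E S = 0) := by
    intro S
    by_cases h : ∃ e : E, (e : α) ∈ S
    · obtain ⟨e, he⟩ := h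
      refine ⟨Pi.single e 1, fun f hf => ?_, Or.inl (by simp)⟩
      rw [Pi.single_eq_of_ne]; rintro rfl; exact hf he
    · push Not at h
      exact ⟨0, by simp, Or.inr (by simp [linearForm, h])⟩
  obtain ⟨c, hc0, hc1⟩ := hc F
  obtain ⟨d, hd0, hd1⟩ := hc (E \ F)
  let ψ : MvPolynomial E ℤ →ₐ[ℤ] MvPolynomial E ℤ := MvPolynomial.aeval fun e =>
    MvPolynomial.X e - c e • linearForm E F - d e • linearForm E (E \ F)
  have hψ : ∀ S, ψ (linearForm E S) = linearForm E S -
      (∑ e : E, if (e : α) ∈ S then c e else 0) • linearForm E F -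
      (∑ e : E, if (e : α) ∈ S then d e else 0) • linearForm E (E \ F) := by
    intro S
    rw [Finset.sum_smul, Finset.sum_smul]
    conv_lhs => rw [linearForm]
    conv_rhs => rw [linearForm]
    rw [map_sum, ← Finset.sum_sub_distrib, ← Finset.sum_sub_distrib]
    refine Finset.sum_congr rfl fun e _ => ?_
    by_cases h : (e : α) ∈ S <;> simp [h, ψ, linearForm]
  have hs1 : ∀ (S : Set α) (c : E → ℤ), (∀ e : E, (e : α) ∉ S → c e = 0) →
      (∑ e : E, if (e : α) ∈ S then c e else 0) = ∑ e, c e := fun S c h =>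
    Finset.sum_congr rfl fun e _ => by
      by_cases he : (e : α) ∈ S
      · rw [if_pos he]
      · rw [if_neg he, h e he]
  have hs0 : ∀ (S : Set α) (c : E → ℤ), (∀ e : E, (e : α) ∈ S → c e = 0) →
      (∑ e : E, if (e : α) ∈ S then c e else 0) = 0 := fun S c h =>
    Finset.sum_eq_zero fun e _ => by
      by_cases he : (e : α) ∈ S
      · rw [if_pos he, h e he]
      · rw [if_neg he]
  refine ⟨ψ, ?_, ?_, fun e => ?_⟩
  · rw [hψ, hs1 F c hc0, hs0 F d fun e he => hd0 e fun h => h.2 he]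
    rcases hc1 with h | h <;> simp [h]
  · rw [hψ, hs1 (E \ F) d hd0, hs0 (E \ F) c fun e he => hc0 e he.2]
    rcases hd1 with h | h <;> simp [h]
  · have : ψ (MvPolynomial.X e) - MvPolynomial.X e =
        -(c e • linearForm E F) - d e • linearForm E (E \ F) := by
      simp only [ψ, MvPolynomial.aeval_X]
      abel
    rw [this]
    exact sub_mem (neg_mem (zsmul_mem (Ideal.subset_span (by simp)) _))
      (zsmul_mem (Ideal.subset_span (by simp)) _)

theorem toR₀_linearForm (E : Set α) : toR₀ E (linearForm E E) = 0 :=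
  toR₀_eq_zero_iff.2 (Ideal.subset_span rfl)

theorem restrictZero_aForm (E F : Set α) : restrictZero E F (aForm E F) = 0 :=
  restrictZero_eq_zero_iff.2 (Ideal.subset_span rfl)

theorem aForm_sdiff (E F : Set α) : aForm E (E \ F) = -aForm E F := by
  rw [eq_neg_iff_add_eq_zero, add_comm, aForm, aForm, ← map_add, linearForm_add, toR₀_linearForm]

/-- The universal property of `R₀`. -/
def liftR₀ {E : Set α} {B : Type*} [CommRing B] (f : MvPolynomial E ℤ →+* B)
    (hf : f (linearForm E E) = 0) : R₀ E →+* B :=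
  Ideal.Quotient.lift _ f fun p hp => by
    obtain ⟨r, rfl⟩ := Ideal.mem_span_singleton'.1 hp
    rw [map_mul, hf, mul_zero]

theorem liftR₀_toR₀ {E : Set α} {B : Type*} [CommRing B] (f : MvPolynomial E ℤ →+* B)
    (hf : f (linearForm E E) = 0) (p : MvPolynomial E ℤ) : liftR₀ f hf (toR₀ E p) = f p :=
  Ideal.Quotient.lift_mk _ _ _

/-- The universal property of `R₀ / (a_F)`. -/
def liftR₀Mod {E F : Set α} {B : Type*} [CommRing B] (f : R₀ E →+* B)
    (hf : f (aForm E F) = 0) : R₀Mod E F →+* B :=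
  Ideal.Quotient.lift _ f fun p hp => by
    obtain ⟨r, rfl⟩ := Ideal.mem_span_singleton'.1 hp
    rw [map_mul, hf, mul_zero]

theorem liftR₀Mod_restrictZero {E F : Set α} {B : Type*} [CommRing B] (f : R₀ E →+* B)
    (hf : f (aForm E F) = 0) (x : R₀ E) : liftR₀Mod f hf (restrictZero E F x) = f x :=
  Ideal.Quotient.lift_mk _ _ _

instance (E : Set α) : IsDomain (R₀ E) := by
  obtain ⟨ψ, h1, h2, h3⟩ := exists_elimination E E
  have h0 : linearForm E (E \ E) = 0 := by simp [linearForm]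
  let ψ₀ : R₀ E →+* MvPolynomial E ℤ :=
    liftR₀ (ψ : MvPolynomial E ℤ →+* MvPolynomial E ℤ) (by simpa using h1)
  refine Function.Injective.isDomain ψ₀ ((injective_iff_map_eq_zero ψ₀).2 fun x hx => ?_)
  obtain ⟨p, rfl⟩ := toR₀_surjective E x
  rw [liftR₀_toR₀] at hx
  have hmem := mem_of_elimination h3 (by simpa using hx)
  obtain ⟨a, b, rfl⟩ := Ideal.mem_span_pair.1 hmem
  rw [h0, mul_zero, add_zero, map_mul, toR₀_linearForm, mul_zero]

instance (E F : Set α) : IsDomain (R₀Mod E F) := by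
  obtain ⟨ψ, h1, h2, h3⟩ := exists_elimination E F
  have h4 : ψ (linearForm E E) = 0 := by rw [← linearForm_add E F, map_add, h1, h2, add_zero]
  let ψ₀ : R₀ E →+* MvPolynomial E ℤ :=
    liftR₀ (ψ : MvPolynomial E ℤ →+* MvPolynomial E ℤ) (by simpa using h4)
  let ψ₁ : R₀Mod E F →+* MvPolynomial E ℤ := liftR₀Mod ψ₀ (by
    rw [aForm, liftR₀_toR₀]; simpa using h1)
  refine Function.Injective.isDomain ψ₁ ((injective_iff_map_eq_zero ψ₁).2 fun x hx => ?_)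
  obtain ⟨y, rfl⟩ := restrictZero_surjective E F x
  obtain ⟨p, rfl⟩ := toR₀_surjective E y
  rw [liftR₀Mod_restrictZero, liftR₀_toR₀] at hx
  have hmem := mem_of_elimination h3 (by simpa using hx)
  obtain ⟨a, b, rfl⟩ := Ideal.mem_span_pair.1 hmem
  have hF : restrictZero E F (toR₀ E (linearForm E F)) = 0 := restrictZero_aForm E F
  have hF' : restrictZero E F (toR₀ E (linearForm E (E \ F))) = 0 := by
    have := aForm_sdiff E F
    rw [aForm] at this
    rw [this, map_neg, restrictZero_aForm, neg_zero]
  rw [map_add, map_add, map_mul, map_mul, map_mul, map_mul, hF, hF', mul_zero, mul_zero, add_zero]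

/-- The field `Q₀ = Frac(R₀)` in which the amplitudes live. -/
abbrev Q₀ (E : Set α) : Type u := FractionRing (R₀ E)

/-- The field `Frac(R₀ / (a_F))` in which residues along `a_F = 0` live. -/
abbrev ResField (E F : Set α) : Type u := FractionRing (R₀Mod E F)

/-- The residue `res_{a_F}(q) = (a_F q)|_{a_F = 0}` is defined and equal to `ρ`: for some
fraction `g / h` equal to `a_F q` whose denominator does not vanish on `a_F = 0`, the element `ρ`
is the restriction of `g / h` to `a_F = 0`. -/
def HasResidue (E F : Set α) (q : Q₀ E) (ρ : ResField E F) : Prop :=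
  ∃ g h : R₀ E, restrictZero E F h ≠ 0 ∧
    algebraMap (R₀ E) (Q₀ E) (aForm E F) * q =
      algebraMap (R₀ E) (Q₀ E) g / algebraMap (R₀ E) (Q₀ E) h ∧
    ρ = algebraMap (R₀Mod E F) (ResField E F) (restrictZero E F g) /
      algebraMap (R₀Mod E F) (ResField E F) (restrictZero E F h)

/-- The rational function `q` has no pole along the prime divisor `π = 0`. -/
def RegularAlong {E : Set α} (π : R₀ E) (q : Q₀ E) : Prop :=
  ∃ g h : R₀ E, ¬ π ∣ h ∧ q = algebraMap (R₀ E) (Q₀ E) g / algebraMap (R₀ E) (Q₀ E) h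

theorem rename_linearForm {E S : Set α} (hSE : S ⊆ E) :
    MvPolynomial.rename (R := ℤ) (Set.inclusion hSE) (linearForm S S) = linearForm E S := by
  classical
  simp only [linearForm, map_sum, Subtype.coe_prop, if_true, MvPolynomial.rename_X]
  rw [← Finset.sum_filter]
  refine Finset.sum_bij (fun e _ => Set.inclusion hSE e) ?_ ?_ ?_ ?_
  · intro e _; simp
  · intro e _ f _ h; exact Set.inclusion_injective hSE h
  · intro e he; exact ⟨⟨e, by simpa using he⟩, by simp, rfl⟩
  · intro e _; rfl

/-- For `S = F` or `S = E ∖ F`, the map `ℤ[a_e | e ∈ S] / (a_S) → R₀ / (a_F)` induced by the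
inclusion of `S` in `E`. -/
def partHom {E F S : Set α} (hSE : S ⊆ E) (hS : S = F ∨ S = E \ F) : R₀ S →+* R₀Mod E F :=
  liftR₀ (((restrictZero E F).comp (toR₀ E)).comp
    (MvPolynomial.rename (R := ℤ) (Set.inclusion hSE)).toRingHom) (by
      have h1 : restrictZero E F (aForm E S) = 0 := by
        rcases hS with rfl | rfl
        · exact restrictZero_aForm _ _
        · rw [aForm_sdiff, map_neg, restrictZero_aForm, neg_zero]
      rw [← h1, aForm, ← rename_linearForm hSE]
      rfl)

theorem partHom_injective {E F S : Set α} (hSE : S ⊆ E) (hS : S = F ∨ S = E \ F) :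
    Function.Injective (partHom hSE hS) := by
  classical
  -- a left inverse is obtained by setting the variables outside `S` to zero
  let φ : MvPolynomial E ℤ →ₐ[ℤ] MvPolynomial S ℤ := MvPolynomial.aeval fun e =>
    if h : (e : α) ∈ S then MvPolynomial.X ⟨e, h⟩ else 0
  have hφ : ∀ T : Set α, φ (linearForm E T) = linearForm S T := by
    intro T
    simp only [linearForm, map_sum]
    symm
    refine Finset.sum_of_injOn (Set.inclusion hSE) (Set.inclusion_injective hSE).injOn
      (by intro e _; simp) ?_ ?_
    · intro e _ he
      have : (e : α) ∉ S := fun h => he ⟨⟨e, h⟩, by simp, rfl⟩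
      by_cases h : (e : α) ∈ T <;> simp [h, φ, this]
    · intro e _
      by_cases h : (e : α) ∈ T <;> simp [h, φ]
  have hE : linearForm S E = linearForm S S :=
    Finset.sum_congr rfl fun e _ => by simp [hSE e.2]
  have hF : toR₀ S (linearForm S F) = 0 := by
    rcases hS with rfl | rfl
    · exact toR₀_linearForm _
    · have : linearForm (E \ F) F = 0 := Finset.sum_eq_zero fun e _ => by simp [e.2.2]
      rw [this, map_zero]
  let ρ₀ : R₀ E →+* R₀ S := liftR₀ ((toR₀ S).comp φ.toRingHom) (by
    change toR₀ S (φ _) = 0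
    rw [hφ, hE, toR₀_linearForm])
  let ρ : R₀Mod E F →+* R₀ S := liftR₀Mod ρ₀ (by
    rw [aForm, liftR₀_toR₀]
    change toR₀ S (φ _) = 0
    rw [hφ, hF])
  refine Function.LeftInverse.injective (g := ρ) fun x => ?_
  obtain ⟨p, rfl⟩ := toR₀_surjective S x
  have h1 : partHom hSE hS (toR₀ S p) =
      restrictZero E F (toR₀ E (MvPolynomial.rename (Set.inclusion hSE) p)) := by
    rw [partHom, liftR₀_toR₀]; rfl
  rw [h1, liftR₀Mod_restrictZero, liftR₀_toR₀]
  change toR₀ S (φ _) = toR₀ S p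
  congr 1
  rw [MvPolynomial.aeval_rename]
  have h2 : (fun e : E => if h : (e : α) ∈ S then MvPolynomial.X (R := ℤ) (⟨e, h⟩ : S) else 0) ∘
      Set.inclusion hSE = MvPolynomial.X := by
    ext1 e; simp
  rw [h2, MvPolynomial.aeval_X_left, AlgHom.id_apply]

/-- For `S = F` or `S = E ∖ F`, the embedding of the field `Q₀` of `S` in
`Frac(R₀ / (a_F))` induced by the inclusion of `S` in `E`. -/
def partEmbedding {E F S : Set α} (hSE : S ⊆ E) (hS : S = F ∨ S = E \ F) :
    Q₀ S →+* ResField E F :=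
  IsFractionRing.lift (A := R₀ S)
    (g := (algebraMap (R₀Mod E F) (ResField E F)).comp (partHom hSE hS))
    ((IsFractionRing.injective _ _).comp (partHom_injective hSE hS))

end Parameters

namespace OrientedMatroid

variable (M : OrientedMatroid α)

/-! ### Topes, faces and canonical forms -/

/-- A tope is a maximal signed covector. -/
def IsTope (P : α → SignType) : Prop :=
  P ∈ M.covectors ∧ ∀ Y ∈ M.covectors, (∀ e, P e ≠ 0 → Y e = P e) → Y = P

/-- The face lattice `L(P)` of a tope: the zero sets of the covectors that are obtained from `P` by
setting some entries to `0`. -/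
def faces (P : α → SignType) : Set (Set α) :=
  {F | ∃ X ∈ M.covectors, (∀ e, X e ≠ 0 → X e = P e) ∧ F = {e ∈ M.toMatroid.E | X e = 0}}

theorem faces_subset {P : α → SignType} {F : Set α} (h : F ∈ M.faces P) : F ⊆ M.toMatroid.E := by
  obtain ⟨X, -, -, rfl⟩ := h
  exact fun e he => he.1

/-- `Ω` is the canonical form of the tope `P` of the oriented matroid `M` of rank `n`. In rank `0`
this is `Ω = χ(∅)`. In positive rank it is an element of `A^n(M)` such that, for every atom `c`,
the residue `Res_c Ω` is `P(e) Ω_{P/c}` if `c` is a face of `P`, where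
the chirotope of `M/c` is `χ(·, e)` for any chosen `e ∈ c`, and is `0` otherwise. -/
def IsCanonicalForm : ℕ → (M : OrientedMatroid α) → (α → SignType) → OS M.toMatroid → Prop
  | 0, M, _, Ω => Ω = ((M.chirotope [] : SignType) : ℤ) • (osIdeal M.toMatroid).mkQ 1
  | n + 1, M, P, Ω => Ω ∈ OS.degree M.toMatroid (n + 1) ∧
      ∀ c, M.toMatroid.IsFlat c → ∀ e, ∀ he : M.toMatroid.IsBasis {e} c,
        (c ∈ M.faces P → ∃ Ω' : OS (M.toMatroid ／ c),
          IsCanonicalForm n (M.contract c [e] (by simp) (by simpa using he)) (cᶜ.indicator P) Ω' ∧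
          res M.toMatroid c Ω = ((P e : SignType) : ℤ) • Ω') ∧
        (c ∉ M.faces P → res M.toMatroid c Ω = 0)

/-- The canonical form `Ω_P` of a tope `P`. -/
def canonicalForm (P : α → SignType) : OS M.toMatroid :=
  Classical.epsilon (IsCanonicalForm (rank M.toMatroid) M P)

/-! ### Amplitudes -/

theorem exists_ordered_basis [Finite α] (N : Matroid α) {F : Set α} (hF : F ⊆ N.E) :
    ∃ b : List α, b.Nodup ∧ N.IsBasis {e | e ∈ b} F := by
  obtain ⟨B, hB⟩ := N.exists_isBasis F
  refine ⟨B.toFinite.toFinset.toList, Finset.nodup_toList _, ?_⟩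
  simpa using hB

theorem exists_ordered_base [Finite α] (N : Matroid α) :
    ∃ b : List α, b.Nodup ∧ N.IsBase {e | e ∈ b} := by
  obtain ⟨B, hB⟩ := N.exists_isBase
  refine ⟨B.toFinite.toFinset.toList, Finset.nodup_toList _, ?_⟩
  simpa using hB

section Amplitude

variable [Fintype α]

/-- The amplitude `A(P) = ⟨Ω_P, Ω_P⟩`, where the intersection form is reduced modulo `a_E`
(its denominators `a_F`, for flats `F` other than `∅` and `E`, are nonzero modulo `a_E`). -/
def amplitude (P : α → SignType) : Q₀ M.toMatroid.E :=
  deRhamForm M.toMatroid (fun S => algebraMap (R₀ M.toMatroid.E) _ (aForm M.toMatroid.E S))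
    (rank M.toMatroid) (M.canonicalForm P) (M.canonicalForm P)

/-- The restriction `M|F`, with some choice of chirotope. -/
def restrictTo (F : Set α) (hF : F ⊆ M.toMatroid.E) : OrientedMatroid α :=
  M.restrict F hF (exists_ordered_base (M.toMatroid ／ F)).choose
    (exists_ordered_base (M.toMatroid ／ F)).choose_spec.1
    (exists_ordered_base (M.toMatroid ／ F)).choose_spec.2

/-- The contraction `M/F`, with some choice of chirotope. -/
def contractBy (F : Set α) (hF : F ⊆ M.toMatroid.E) : OrientedMatroid α :=
  M.contract F (exists_ordered_basis M.toMatroid hF).choose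
    (exists_ordered_basis M.toMatroid hF).choose_spec.1
    (exists_ordered_basis M.toMatroid hF).choose_spec.2

/-- The amplitude `A(P|_F)` of the tope `P|_F` of `M|F`. -/
def restrictAmplitude (P : α → SignType) (F : Set α) (hF : F ⊆ M.toMatroid.E) : Q₀ F :=
  (M.restrictTo F hF).amplitude (F.indicator P)

/-- The amplitude `A(P|_{E ∖ F})` of the tope `P|_{E ∖ F}` of `M/F`. -/
def contractAmplitude (P : α → SignType) (F : Set α) (hF : F ⊆ M.toMatroid.E) :
    Q₀ (M.toMatroid.E \ F) :=
  (M.contractBy F hF).amplitude (Fᶜ.indicator P)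

/-- The product `A(P|_F) A(P|_{E ∖ F})` of the amplitudes of the topes `P|_F` of `M|F` and
`P|_{E ∖ F}` of `M/F`, in the field `Frac(R₀ / (a_G))`, where `F = G` or `F = E ∖ G` (in both cases
`a_F` and `a_{E ∖ F}` are zero in `R₀ / (a_G)`). -/
def amplitudeProduct (P : α → SignType) (F G : Set α) (hF : F ⊆ M.toMatroid.E)
    (h₁ : F = G ∨ F = M.toMatroid.E \ G) (h₂ : M.toMatroid.E \ F = G ∨
      M.toMatroid.E \ F = M.toMatroid.E \ G) : ResField M.toMatroid.E G :=
  partEmbedding hF h₁ (M.restrictAmplitude P F hF) *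
    partEmbedding sdiff_subset h₂ (M.contractAmplitude P F hF)

end Amplitude

end OrientedMatroid

end MatroidAmplitude

end

/-!
The amplitude of a tope `P` is first rewritten as a sum over complete flags of faces of `P`, and
the three assertions are then read off from this sum.

The canonical form is never computed. In top degree an element of the Orlik–Solomon algebra is
determined by its residues along the complete flags of flats (`eq_zero_of_flagRes_eq_zero`), and a
function on complete flags is a system of such residues as soon as its sum over all ways to fill
a gap in a flag is zero (`exists_flagRes_eq`). Both facts come from a basis of monomials indexed by
the flags that are adapted to a choice of one element in each flat: these monomials span
(`monomial_mem_span_adapted`), they are dual to the residues along the adapted flags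
(`chainVal_monomial_chosen`), and the gap relations express every residue by residues along adapted
flags (`eq_zero_of_gap_of_adapted`). For a tope, the function that is `χ(b) ∏ P(b_i)` on a flag of
faces with transversal `b`, and `0` on the other flags, satisfies the gap relations: a gap between
two faces can be filled by exactly two faces (`IsFull.exists_diamond`), and exchanging two
consecutive elements of `b` changes the sign of `χ`. Hence the canonical form exists and its
residues are `±1` on the flags of faces and `0` elsewhere (`IsFull.isCanonicalForm_iff`,
`IsFull.exists_isCanonicalForm`). The signs are squared in the intersection form, so
`A(P) = ∑ ∏ 1 / a_{F_i}`, the sum being over the complete flags in `L(P)` (`IsFull.amplitude_eq`).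

If `M` is the direct sum of its restrictions to `E₁` and `E₂`, then `L(P)` is a product and its
flags are shuffles of flags of the two factors. Let `f(G)` be the sum over the flags up to `G` of
`∏ 1 / a_{F_i}`, the factor of `G` included. Removing the largest member gives
`a_G f(G) = ∑_H f(H)`, the sum being over the faces `H` covered by `G`, and by induction
`f(G₁ ∪ G₂) = f(G₁) f(G₂)` because `a_{G₁ ∪ G₂} = a_{G₁} + a_{G₂}`. For `G = E` the sum over `H` is
the amplitude, and it is equal to `a_E f(E₁) f(E₂) = 0`
(`IsDirectSum.flagSum_union_eq`, `IsFull.amplitude_eq_zero`).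

For the residue along `a_F = 0`, the only proper linear forms `a_G` that vanish on this divisor
are those of `G = F` and `G = E ∖ F` (`restrictZero_aForm_ne_zero_of_ne`), and no flag contains
both sets. So every term of `A(P)` has at most a simple pole. The flags through `F` are pairs of a
flag of `M|F` and a flag of `M/F` (`sum_flagsIn_filter_mem`), and `a_{F ∪ G} = a_G` modulo `a_F`, so
their residues add up to the product of the two amplitudes; the flags through `E ∖ F` contribute in
the same way, with a minus sign from `a_{E ∖ F} = -a_F` (`hasResidue_sum_filter_mem`). Finally, a
function whose residue vanishes is regular. If neither `M|F` nor, when `E ∖ F` is a face,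
`M|(E ∖ F)` is connected, then the residue is zero by the vanishing of decomposable amplitudes, so
poles occur only along the divisors of connected faces.
-/

noncomputable section

open Set
open scoped Matroid

namespace MatroidAmplitude

universe u

section

variable {α : Type u}

/-! ### Flags of flats -/

/-- `B` covers `A` in the lattice of flats of `M`. -/
def Covers (M : Matroid α) (A B : Set α) : Prop :=
  M.IsFlat A ∧ ∃ e ∈ M.E, e ∉ A ∧ B = M.closure (insert e A)

/-- A saturated flag of flats above `A`, listed from the largest flat down to the flat that
covers `A`; the flat `A` is not listed. -/
def IsDescFlag (M : Matroid α) (A : Set α) : List (Set α) → Prop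
  | [] => True
  | H :: t => Covers M (t.headD A) H ∧ IsDescFlag M A t

variable {M : Matroid α} {A B C : Set α}

theorem covers_closure_insert (hA : M.IsFlat A) {e : α} (he : e ∈ M.E) (heA : e ∉ A) :
    Covers M A (M.closure (insert e A)) := ⟨hA, e, he, heA, rfl⟩

theorem Covers.isFlat_right (h : Covers M A B) : M.IsFlat B := by
  obtain ⟨-, e, -, -, rfl⟩ := h
  exact M.isFlat_closure _

theorem Covers.subset (h : Covers M A B) : A ⊆ B := by
  obtain ⟨hA, e, he, -, rfl⟩ := h
  exact M.subset_closure_of_subset' (subset_insert _ _) hA.subset_ground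

theorem Covers.exists_mem (h : Covers M A B) : ∃ e ∈ B, e ∉ A := by
  obtain ⟨hA, e, he, heA, rfl⟩ := h
  exact ⟨e, M.mem_closure_of_mem (mem_insert _ _) (insert_subset he hA.subset_ground), heA⟩

theorem Covers.nonempty (h : Covers M A B) : B.Nonempty :=
  let ⟨e, he, _⟩ := h.exists_mem; ⟨e, he⟩

theorem Covers.closure_insert (h : Covers M A B) {f : α} (hf : f ∈ B) (hfA : f ∉ A) :
    M.closure (insert f A) = B := by
  obtain ⟨hA, e, he, heA, rfl⟩ := h
  exact Matroid.closure_insert_congr ⟨hf, by rwa [hA.closure]⟩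

theorem Covers.eRk_eq (h : Covers M A B) : M.eRk B = M.eRk A + 1 := by
  obtain ⟨hA, e, he, heA, rfl⟩ := h
  rw [M.eRk_closure_eq, Matroid.eRk_insert_eq_add_one ⟨he, by rwa [hA.closure]⟩]

theorem Covers.subset_of_mem (h : Covers M A B) (hC : M.IsFlat C) (hAC : A ⊆ C) {f : α}
    (hfB : f ∈ B) (hfA : f ∉ A) (hfC : f ∈ C) : B ⊆ C := by
  rw [← h.closure_insert hfB hfA, ← hC.closure]
  exact M.closure_subset_closure (insert_subset hfC hAC)

theorem Covers.inter_eq (h : Covers M A B) (h' : Covers M A C) (hne : B ≠ C) : B ∩ C = A := by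
  refine subset_antisymm (fun f hf => ?_) (subset_inter h.subset h'.subset)
  by_contra hfA
  exact hne (by rw [← h.closure_insert hf.1 hfA, ← h'.closure_insert hf.2 hfA])

theorem covers_of_eRk_eq [Finite α] (hA : M.IsFlat A) (hB : M.IsFlat B) (h : A ⊂ B)
    (hr : M.eRk B = M.eRk A + 1) : Covers M A B := by
  obtain ⟨e, heB, heA⟩ := exists_of_ssubset h
  have he := hB.subset_ground heB
  have hc := covers_closure_insert hA he heA
  refine ⟨hA, e, he, heA, ?_⟩
  have hsub : M.closure (insert e A) ⊆ B := by
    rw [← hB.closure]; exact M.closure_subset_closure (insert_subset heB h.subset)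
  have := Matroid.IsRkFinite.closure_eq_closure_of_subset_of_eRk_ge_eRk
    (M.isRkFinite_of_finite (toFinite (M.closure (insert e A)))) hsub (by rw [hr, hc.eRk_eq])
  rw [M.closure_closure, hB.closure] at this
  exact this.symm

theorem headD_append {β : Type*} (p t : List β) (a : β) :
    (p ++ t).headD a = p.headD (t.headD a) := by
  cases p <;> rfl

theorem isDescFlag_append {p t : List (Set α)} :
    IsDescFlag M A (p ++ t) ↔ IsDescFlag M (t.headD A) p ∧ IsDescFlag M A t := by
  induction p with
  | nil => simp [IsDescFlag]
  | cons H p ih => simp only [List.cons_append, IsDescFlag, ih, headD_append, and_assoc]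

namespace IsDescFlag

variable {t : List (Set α)}

theorem isFlat_head (hA : M.IsFlat A) (h : IsDescFlag M A t) : M.IsFlat (t.headD A) := by
  cases t with
  | nil => exact hA
  | cons H t => exact h.1.isFlat_right

theorem base_subset_head (h : IsDescFlag M A t) : A ⊆ t.headD A := by
  induction t with
  | nil => exact subset_rfl
  | cons H t ih => exact (ih h.2).trans h.1.subset

theorem subset_head (h : IsDescFlag M A t) : ∀ F ∈ t, F ⊆ t.headD A := by
  induction t with
  | nil => simp
  | cons H t ih =>
    intro F hF
    rcases List.mem_cons.1 hF with rfl | hF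
    · exact subset_rfl
    · exact (ih h.2 F hF).trans h.1.subset

theorem base_subset (h : IsDescFlag M A t) : ∀ F ∈ t, A ⊆ F := by
  induction t with
  | nil => simp
  | cons H t ih =>
    intro F hF
    rcases List.mem_cons.1 hF with rfl | hF
    · exact base_subset_head h
    · exact ih h.2 F hF

theorem isFlat (h : IsDescFlag M A t) : ∀ F ∈ t, M.IsFlat F := by
  induction t with
  | nil => simp
  | cons H t ih =>
    intro F hF
    rcases List.mem_cons.1 hF with rfl | hF
    · exact h.1.isFlat_right
    · exact ih h.2 F hF

theorem eRk_head (h : IsDescFlag M A t) : M.eRk (t.headD A) = M.eRk A + t.length := by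
  induction t with
  | nil => simp
  | cons H t ih =>
    have := h.1.eRk_eq
    rw [ih h.2] at this
    rw [List.headD_cons, this, List.length_cons]
    push_cast
    rw [add_assoc]

end IsDescFlag

theorem isFlat_empty [M.Loopless] : M.IsFlat (∅ : Set α) := by
  rw [Matroid.isFlat_iff_closure_eq, Matroid.closure_empty, Matroid.loops_eq_empty]

theorem IsDescFlag.length_eq [M.Loopless] {t : List (Set α)} (h : IsDescFlag M ∅ t) :
    M.eRk (t.headD ∅) = t.length := by
  rw [h.eRk_head, Matroid.eRk_empty, zero_add]

theorem loopless_contract (hA : M.IsFlat A) : (M ／ A).Loopless := by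
  rw [Matroid.loopless_iff, Matroid.contract_loops_eq, hA.closure, sdiff_self]

end

section

variable {α : Type u}

variable {M : Matroid α} {A B C : Set α}

theorem Covers.covers_closure_insert_of_mem (h : Covers M A C) (h' : Covers M C B) {e : α}
    (heB : e ∈ B) (heA : e ∉ A) : Covers M (M.closure (insert e A)) B := by
  have heE := h'.isFlat_right.subset_ground heB
  have hc := covers_closure_insert h.1 heE heA
  have heX : e ∈ M.closure (insert e A) :=
    M.mem_closure_of_mem (mem_insert _ _) (insert_subset heE h.1.subset_ground)
  by_cases heC : e ∈ C
  · rwa [h.closure_insert heC heA]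
  · obtain ⟨f, hfC, hfA⟩ := h.exists_mem
    have hfE := h.isFlat_right.subset_ground hfC
    have hfX : f ∉ M.closure (insert e A) := fun hf => heC <| by
      rw [← h.closure_insert hfC hfA, hc.closure_insert hf hfA]; exact heX
    refine ⟨M.isFlat_closure _, f, hfE, hfX, ?_⟩
    rw [M.closure_insert_closure_eq_closure_insert, insert_comm,
      ← M.closure_insert_closure_eq_closure_insert, h.closure_insert hfC hfA,
      h'.closure_insert heB heC]

/-! ### Iterated residues in the exterior algebra -/

theorem contraction_comm (c d : Set α) (x : Ext α) :
    contraction c (contraction d x) = -contraction d (contraction c x) := by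
  simpa [contraction] using CliffordAlgebra.contractRight_comm
    (Q := (0 : QuadraticForm ℤ (α →₀ ℤ))) (indicatorFunctional d) (indicatorFunctional c) x

theorem contraction_contraction_self (c : Set α) (x : Ext α) :
    contraction c (contraction c x) = 0 := by
  simpa [contraction] using CliffordAlgebra.contractRight_contractRight
    (Q := (0 : QuadraticForm ℤ (α →₀ ℤ))) (indicatorFunctional c) x

theorem contraction_gen_mul {c : Set α} {e : α} (he : e ∉ c) (x : Ext α) :
    contraction c (gen e * x) = gen e * contraction c x := by
  rw [contraction_mul, contraction_gen_of_notMem he, zero_mul, add_zero]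

/-- Contraction is additive over a partition of `c`. -/
theorem contraction_sum {ι : Type*} (S : Finset ι) (f : ι → Set α) {c : Set α}
    (h : ∀ e, e ∈ c → ∃ i ∈ S, e ∈ f i ∧ ∀ j ∈ S, e ∈ f j → j = i)
    (h' : ∀ i ∈ S, f i ⊆ c) (x : Ext α) :
    contraction c x = ∑ i ∈ S, contraction (f i) x := by
  classical
  have : indicatorFunctional c = ∑ i ∈ S, indicatorFunctional (f i) := by
    ext e
    simp only [indicatorFunctional, LinearMap.coe_comp, Function.comp_apply,
      Finsupp.lsingle_apply, Finsupp.linearCombination_single, LinearMap.coe_sum,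
      Finset.sum_apply, one_smul]
    by_cases he : e ∈ c
    · obtain ⟨i, hi, hei, huniq⟩ := h e he
      rw [Finset.sum_eq_single_of_mem i hi, indicator_of_mem he, indicator_of_mem hei]
      intro j hj hne
      exact indicator_of_notMem (fun hej => hne (huniq j hj hej)) _
    · rw [indicator_of_notMem he, Finset.sum_eq_zero]
      intro i hi
      exact indicator_of_notMem (fun hei => he (h' i hi hei)) _
  rw [contraction, this, map_sum, LinearMap.sum_apply]
  rfl

/-- The composition of the contractions at the steps of a descending flag above `A`, the step
at the bottom of the flag being applied first. -/
def chainRes (A : Set α) : List (Set α) → (Ext α →ₗ[ℤ] Ext α)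
  | [] => LinearMap.id
  | H :: t => contraction (H \ t.headD A) ∘ₗ chainRes A t

theorem chainRes_append (A : Set α) (p t : List (Set α)) :
    chainRes A (p ++ t) = chainRes (t.headD A) p ∘ₗ chainRes A t := by
  induction p with
  | nil => rfl
  | cons H p ih =>
    rw [List.cons_append, chainRes, chainRes, ih, headD_append, LinearMap.comp_assoc]

/-- The value in `ℤ` of the iterated residue along a descending flag above `A`. -/
def chainVal (A : Set α) (t : List (Set α)) : Ext α →ₗ[ℤ] ℤ :=
  ExteriorAlgebra.algebraMapInv.toLinearMap ∘ₗ chainRes A t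

/-- The sum of the iterated residues over all ways to fill a gap in a flag vanishes, because a
contraction has square zero. -/
theorem sum_chainVal_eq_zero {A₀ : Set α} (hX : Covers M A C) (hX' : Covers M C B)
    (p q : List (Set α)) (hq : q.headD A₀ = A) (S : Finset (Set α))
    (hS : ∀ X, X ∈ S ↔ Covers M A X ∧ Covers M X B) (x : Ext α) :
    ∑ X ∈ S, chainVal A₀ (p ++ B :: X :: q) x = 0 := by
  have key : ∀ y : Ext α, ∑ X ∈ S, contraction (B \ X) (contraction (X \ A) y) = 0 := by
    intro y
    have h1 : ∀ z : Ext α, contraction (B \ A) z = ∑ X ∈ S, contraction (X \ A) z := by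
      refine contraction_sum S _ (fun e he => ?_) fun X hXS =>
        sdiff_subset_sdiff_left ((hS X).1 hXS).2.subset
      have heE := hX'.isFlat_right.subset_ground he.1
      refine ⟨M.closure (insert e A), (hS _).2 ⟨covers_closure_insert hX.1 heE he.2,
        hX.covers_closure_insert_of_mem hX' he.1 he.2⟩, ⟨?_, he.2⟩, fun Y hY heY => ?_⟩
      · exact M.mem_closure_of_mem (mem_insert _ _) (insert_subset heE hX.1.subset_ground)
      · exact (((hS Y).1 hY).1.closure_insert heY.1 heY.2).symm
    have h2 : ∀ X ∈ S, ∀ z : Ext α, contraction (B \ X) z =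
        contraction (B \ A) z - contraction (X \ A) z := by
      intro X hXS z
      have hc := (hS X).1 hXS
      have := contraction_sum (Finset.univ : Finset Bool)
        (fun b => if b then B \ X else X \ A) (c := B \ A) ?_ ?_ z
      · rw [this]; simp
      · intro e he
        by_cases heX : e ∈ X
        · refine ⟨false, Finset.mem_univ _, by simpa using ⟨heX, he.2⟩, ?_⟩
          rintro (_ | _) - h
          · rfl
          · exact absurd heX (by simpa using h : e ∈ B \ X).2
        · refine ⟨true, Finset.mem_univ _, by simpa using ⟨he.1, heX⟩, ?_⟩
          rintro (_ | _) - h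
          · exact absurd (by simpa using h : e ∈ X \ A).1 heX
          · rfl
      · rintro (_ | _) -
        · simpa using sdiff_subset_sdiff_left hc.2.subset
        · simpa using sdiff_subset_sdiff_right hc.1.subset
    rw [Finset.sum_congr rfl fun X hXS => by
      rw [h2 X hXS, contraction_contraction_self, sub_zero], ← map_sum, ← h1,
      contraction_contraction_self]
  have h3 : ∀ X, chainVal A₀ (p ++ B :: X :: q) x =
      chainVal B p (contraction (B \ X) (contraction (X \ A) (chainRes A₀ q x))) := by
    intro X
    simp only [chainVal, chainRes_append, chainRes, List.headD_cons, hq, LinearMap.comp_apply]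
  rw [Finset.sum_congr rfl fun X _ => h3 X, ← map_sum, key, map_zero]

theorem contraction_chainRes_eq_zero {c : Set α} {x : Ext α} (h : contraction c x = 0)
    (A : Set α) (t : List (Set α)) : contraction c (chainRes A t x) = 0 := by
  induction t with
  | nil => exact h
  | cons H t ih =>
    rw [chainRes, LinearMap.comp_apply, contraction_comm, ih, map_zero, neg_zero]

theorem chainRes_gen_mul {e : α} {t : List (Set α)} (he : ∀ F ∈ t, e ∉ F) (x : Ext α) :
    chainRes A t (gen e * x) = gen e * chainRes A t x := by
  induction t with
  | nil => rfl
  | cons H t ih =>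
    rw [chainRes, LinearMap.comp_apply, ih fun F hF => he F (List.mem_cons_of_mem _ hF),
      contraction_gen_mul fun h => he H List.mem_cons_self h.1]
    rfl

/-- The iterated residue along a flag vanishes on the monomials of a flat that does not contain
the top of the flag: at the first step that leaves the flat, no factor is met. -/
theorem chainRes_monomial_eq_zero {t : List (Set α)} (ht : IsDescFlag M A t) (hC : M.IsFlat C)
    (hAC : A ⊆ C) (hne : ¬ t.headD A ⊆ C) {l : List α} (hl : ∀ e ∈ l, e ∈ C) :
    chainRes A t (monomial l) = 0 := by
  induction t with
  | nil => exact absurd hAC hne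
  | cons H t ih =>
    rw [chainRes, LinearMap.comp_apply]
    by_cases h : t.headD A ⊆ C
    · refine contraction_chainRes_eq_zero (contraction_monomial_of_disjoint fun e he heH => ?_) _ _
      exact hne (ht.1.subset_of_mem hC h heH.1 heH.2 (hl e he))
    · rw [ih ht.2 h, map_zero]

theorem algebraMapInv_involute (x : Ext α) :
    ExteriorAlgebra.algebraMapInv (CliffordAlgebra.involute x) =
      ExteriorAlgebra.algebraMapInv x := by
  have : (ExteriorAlgebra.algebraMapInv (R := ℤ) (M := α →₀ ℤ)).comp
      (CliffordAlgebra.involute (Q := (0 : QuadraticForm ℤ (α →₀ ℤ)))) =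
      ExteriorAlgebra.algebraMapInv := by
    ext e
    simp [ExteriorAlgebra.algebraMapInv]
  exact DFunLike.congr_fun this x

theorem algebraMapInv_gen (e : α) : ExteriorAlgebra.algebraMapInv (gen e : Ext α) = 0 := by
  simp [ExteriorAlgebra.algebraMapInv, gen]

/-! ### Flags adapted to a choice of elements, and the dual basis of monomials -/

open Classical in
/-- The elements chosen in the members of a list of sets: every nonempty set `H` has a fixed
element, here the one provided by the axiom of choice. -/
def chosen : List (Set α) → List α
  | [] => []
  | H :: t => if h : H.Nonempty then h.some :: chosen t else chosen t

/-- The flags such that the element chosen in each member is not in the preceding member. The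
monomials `monomial (chosen t)` of these flags form a basis of the top degree of the
Orlik–Solomon algebra. -/
def IsAdapted (A : Set α) : List (Set α) → Prop
  | [] => True
  | H :: t => (∀ h : H.Nonempty, h.some ∉ t.headD A) ∧ IsAdapted A t

theorem chosen_cons {H : Set α} (h : H.Nonempty) (t : List (Set α)) :
    chosen (H :: t) = h.some :: chosen t := by
  rw [chosen, dif_pos h]

theorem monomial_cons (e : α) (l : List α) : monomial (e :: l) = gen e * monomial l := by
  simp [monomial]

theorem mem_of_mem_chosen {t : List (Set α)} {e : α} (he : e ∈ chosen t) : ∃ F ∈ t, e ∈ F := by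
  induction t with
  | nil => simp [chosen] at he
  | cons H t ih =>
    rw [chosen] at he
    split_ifs at he with h
    · rcases List.mem_cons.1 he with rfl | he
      · exact ⟨H, List.mem_cons_self, h.some_mem⟩
      · obtain ⟨F, hF, heF⟩ := ih he
        exact ⟨F, List.mem_cons_of_mem _ hF, heF⟩
    · obtain ⟨F, hF, heF⟩ := ih he
      exact ⟨F, List.mem_cons_of_mem _ hF, heF⟩

theorem IsDescFlag.mem_head_of_mem_chosen {t : List (Set α)} (h : IsDescFlag M A t) {e : α}
    (he : e ∈ chosen t) : e ∈ t.headD A := by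
  obtain ⟨F, hF, heF⟩ := mem_of_mem_chosen he
  exact h.subset_head F hF heF

theorem length_chosen {t : List (Set α)} (h : IsDescFlag M A t) :
    (chosen t).length = t.length := by
  induction t with
  | nil => rfl
  | cons H t ih => rw [chosen_cons h.1.nonempty, List.length_cons, List.length_cons, ih h.2]

open Classical in
/-- The monomials of the adapted flags with a given largest member are dual to the residues along
these flags: the first factor is removed by the last contraction, and if the flags differ below, the
residue along the one leaves the flat spanned by the other. -/
theorem chainVal_monomial_chosen {t t' : List (Set α)} (hA : M.IsFlat A)
    (ht : IsDescFlag M A t) (ht' : IsDescFlag M A t')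
    (ha : IsAdapted A t) (ha' : IsAdapted A t') (hh : t.headD A = t'.headD A) :
    chainVal A t (monomial (chosen t')) = if t = t' then 1 else 0 := by
  induction t generalizing t' with
  | nil =>
    cases t' with
    | nil => simp [chainVal, chainRes, chosen, monomial]
    | cons H' s' =>
      obtain ⟨e, he, he'⟩ := ht'.1.exists_mem
      rw [List.headD_cons, List.headD_nil] at hh
      exact absurd (IsDescFlag.base_subset_head ht'.2 (hh ▸ he)) he'
  | cons H s ih =>
    cases t' with
    | nil =>
      obtain ⟨e, he, he'⟩ := ht.1.exists_mem
      rw [List.headD_cons, List.headD_nil] at hh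
      exact absurd (IsDescFlag.base_subset_head ht.2 (hh ▸ he)) he'
    | cons H' s' =>
      obtain rfl : H = H' := hh
      have hne := ht.1.nonempty
      have heH : hne.some ∈ H \ s.headD A := ⟨hne.some_mem, ha.1 hne⟩
      have h1 : chainVal A (H :: s) (monomial (chosen (H :: s'))) =
          chainVal A s (monomial (chosen s')) := by
        rw [chosen_cons hne, monomial_cons, chainVal, LinearMap.comp_apply, chainRes,
          LinearMap.comp_apply, chainRes_gen_mul fun F hF h => ha.1 hne (ht.2.subset_head F hF h),
          contraction_mul, contraction_gen_of_mem heH, one_mul]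
        simp [chainVal, algebraMapInv_involute, algebraMapInv_gen]
      rw [h1]
      by_cases hs : s.headD A = s'.headD A
      · rw [ih ht.2 ht'.2 ha.2 ha'.2 hs]
        simp
      · have hns : ¬ s.headD A ⊆ s'.headD A := by
          intro hsub
          obtain ⟨f, hf', hf⟩ := exists_of_ssubset (hsub.ssubset_of_ne hs)
          obtain ⟨g, hg, hg'⟩ := ht'.1.exists_mem
          exact hg' (ht.1.subset_of_mem (ht'.2.isFlat_head hA) hsub (ht'.1.subset hf') hf hf' hg)
        rw [chainVal, LinearMap.comp_apply, chainRes_monomial_eq_zero ht.2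
          (ht'.2.isFlat_head hA) ht'.2.base_subset_head hns
          fun e he => ht'.2.mem_head_of_mem_chosen he, map_zero, if_neg]
        rintro h
        exact hs (by rw [(List.cons.inj h).2])

end

section

variable {α : Type u}

variable {M : Matroid α} {A B C : Set α}

/-- A function on complete flags that satisfies the gap relations and vanishes on the adapted
flags vanishes. By induction on the length, the part of the flag below a fixed member `H` may
be taken adapted if the element chosen in `H` is not in the member below `H`. Otherwise the gap
relation at the smallest member containing this element expresses the value by values on
flags in which the element enters one step later. -/
theorem eq_zero_of_gap_of_adapted [Finite α] {E : Set α} {δ : List (Set α) → ℤ}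
    (hgap : ∀ p B X q, IsDescFlag M ∅ (p ++ B :: X :: q) → (p ++ B :: X :: q).headD ∅ = E →
      ∀ S : Finset (Set α), (∀ Y, Y ∈ S ↔ Covers M (q.headD ∅) Y ∧ Covers M Y B) →
        ∑ Y ∈ S, δ (p ++ B :: Y :: q) = 0)
    (hδ : ∀ t, IsDescFlag M ∅ t → t.headD ∅ = E → IsAdapted ∅ t → δ t = 0)
    {t : List (Set α)} (ht : IsDescFlag M ∅ t) (hE : t.headD ∅ = E) : δ t = 0 := by
  suffices main : ∀ n, ∀ p t : List (Set α), t.length = n → IsDescFlag M ∅ (p ++ t) →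
      (p ++ t).headD ∅ = E → (∀ t', IsDescFlag M ∅ t' → t'.headD ∅ = t.headD ∅ → IsAdapted ∅ t' →
        δ (p ++ t') = 0) → δ (p ++ t) = 0 by
    exact main _ [] t rfl ht hE fun t' h1 h2 h3 => hδ t' h1 (h2.trans hE) h3
  intro n
  induction n with
  | zero =>
    intro p t hn hf hE hv
    obtain rfl := List.eq_nil_of_length_eq_zero hn
    exact hv [] trivial rfl trivial
  | succ n ih =>
    intro p t hn hf hE hv
    obtain _ | ⟨H, s⟩ := t
    · simp at hn
    have hs : s.length = n := by simpa using hn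
    have hH : Covers M (s.headD ∅) H := ((isDescFlag_append.1 hf).2).1
    have hp : IsDescFlag M H p := (isDescFlag_append.1 hf).1
    set e := hH.nonempty.some with he
    -- induction on the number of members `u` of the flag below `H` that contain `e`
    have inner : ∀ m, ∀ u q : List (Set α), u.length = m → (u ++ q).length = n →
        IsDescFlag M ∅ (H :: (u ++ q)) → e ∉ q.headD ∅ → (∀ F ∈ u, e ∈ F) →
        δ (p ++ H :: (u ++ q)) = 0 := by
      intro m
      induction m with
      | zero =>
        intro u q hu hq hf' heq _
        obtain rfl := List.eq_nil_of_length_eq_zero hu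
        have := ih (p ++ [H]) q hq (by
            simpa using isDescFlag_append.2 ⟨hp, hf'⟩) (by simpa [headD_append] using hE)
          fun t' h1 h2 h3 => by
            simpa using hv (H :: t') ⟨h2 ▸ hf'.1, h1⟩ rfl ⟨fun h => by rw [h2]; exact heq, h3⟩
        simpa using this
      | succ m ihm =>
        intro u q hu hq hf' heq heu
        obtain rfl | ⟨u₀, X, rfl⟩ := u.eq_nil_or_concat
        · simp at hu
        obtain h | ⟨u', B, hB⟩ := (H :: u₀).eq_nil_or_concat
        · simp at h
        have hY : ∀ Y, p ++ H :: (u₀ ++ (Y :: q)) = (p ++ u') ++ B :: Y :: q := by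
          intro Y
          have : H :: (u₀ ++ (Y :: q)) = (H :: u₀) ++ Y :: q := rfl
          rw [this, hB]; simp
        have hX : p ++ H :: (u₀.concat X ++ q) = (p ++ u') ++ B :: X :: q := by
          rw [← hY]; simp
        have hfull : IsDescFlag M ∅ ((p ++ u') ++ B :: X :: q) := by
          rw [← hX]; exact isDescFlag_append.2 ⟨hp, hf'⟩
        have hEX : ((p ++ u') ++ B :: X :: q).headD ∅ = E := by
          rw [← hX, headD_append]; simpa [headD_append] using hE
        have hBX : Covers M X B ∧ Covers M (q.headD ∅) X ∧ IsDescFlag M ∅ q :=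
          (isDescFlag_append.1 hfull).2
        have hfin : {Y | Covers M (q.headD ∅) Y ∧ Covers M Y B}.Finite := toFinite _
        have h0 := hgap _ _ _ _ hfull hEX hfin.toFinset (fun Y => hfin.mem_toFinset)
        have hXS : X ∈ hfin.toFinset := hfin.mem_toFinset.2 ⟨hBX.2.1, hBX.1⟩
        rw [Finset.sum_eq_single_of_mem X hXS] at h0
        · rw [hX]; exact h0
        -- `X` is the only flat in the gap that contains `e`, so in the other terms `u` is shorter
        intro Y hYS hYX
        have hYc : Covers M (q.headD ∅) Y ∧ Covers M Y B := hfin.mem_toFinset.1 hYS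
        rw [← hY]
        refine ihm u₀ (Y :: q) (by simpa using hu) (by simpa [add_assoc, add_comm] using hq)
          ?_ ?_ fun F hF => heu F (by simp [hF])
        · have : IsDescFlag M ∅ ((p ++ u') ++ B :: Y :: q) :=
            isDescFlag_append.2 ⟨(isDescFlag_append.1 hfull).1, hYc.2, hYc.1, hBX.2.2⟩
          rw [← hY] at this
          exact (isDescFlag_append.1 this).2
        · intro heY
          refine hYX ?_
          rw [← hYc.1.closure_insert heY heq, ← hBX.2.1.closure_insert (heu X (by simp)) heq]
    have hsplit : ∀ s : List (Set α), ∃ u q, s = u ++ q ∧ e ∉ q.headD ∅ ∧ ∀ F ∈ u, e ∈ F := by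
      intro s
      induction s with
      | nil => exact ⟨[], [], rfl, by simp, by simp⟩
      | cons F s ih =>
        by_cases heF : e ∈ F
        · obtain ⟨u, q, rfl, h1, h2⟩ := ih
          exact ⟨F :: u, q, rfl, h1, by simpa [heF] using h2⟩
        · exact ⟨[], F :: s, rfl, heF, by simp⟩
    obtain ⟨u, q, rfl, h1, h2⟩ := hsplit s
    exact inner _ u q rfl hs (isDescFlag_append.1 hf).2 h1 h2

/-! ### Spanning by the monomials of adapted flags -/

theorem gen_mul_monomial_of_mem {e : α} {l : List α} (he : e ∈ l) :
    gen e * monomial l = 0 := by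
  classical
  rcases monomial_perm (List.perm_cons_erase he) with h | h <;>
    rw [h, monomial_cons] <;> simp [← mul_assoc, gen_mul_self]

theorem monomial_eq_zero {l : List α} (h : ¬ l.Nodup) : (monomial l : Ext α) = 0 := by
  induction l with
  | nil => simp at h
  | cons a l ih =>
    rw [monomial_cons]
    by_cases ha : a ∈ l
    · exact gen_mul_monomial_of_mem ha
    · rw [ih (by simpa [ha] using h), mul_zero]

theorem monomial_mem_osIdeal_of_notMem {l : List α} {e : α} (he : e ∈ l) (heE : e ∉ M.E) :
    monomial l ∈ osIdeal M := by
  obtain ⟨l₁, l₂, rfl⟩ := List.append_of_mem he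
  rw [monomial_append, monomial_cons, ← mul_assoc]
  exact mul_mem_osIdeal M (gen_mem_osIdeal M heE) _ _

theorem contraction_monomial_mem_span (c : Set α) (l : List α) :
    contraction c (monomial l) ∈
      Submodule.span ℤ {x | ∃ l₁ a l₂, l = l₁ ++ a :: l₂ ∧ x = monomial (l₁ ++ l₂)} := by
  induction l with
  | nil => simp [monomial, contraction_one]
  | cons a l ih =>
    rw [monomial_cons, contraction_mul]
    refine add_mem ?_ ?_
    · have : Submodule.map (LinearMap.mulLeft ℤ (gen a)) (Submodule.span ℤ
          {x | ∃ l₁ b l₂, l = l₁ ++ b :: l₂ ∧ x = monomial (l₁ ++ l₂)}) ≤ Submodule.span ℤ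
          {x | ∃ l₁ b l₂, a :: l = l₁ ++ b :: l₂ ∧ x = monomial (l₁ ++ l₂)} := by
        rw [Submodule.map_span_le]
        rintro _ ⟨l₁, b, l₂, rfl, rfl⟩
        exact Submodule.subset_span ⟨a :: l₁, b, l₂, rfl, by
          rw [List.cons_append, monomial_cons, LinearMap.mulLeft_apply]⟩
      exact this ⟨_, ih, rfl⟩
    · have h1 : (monomial l : Ext α) ∈ Submodule.span ℤ
          {x | ∃ l₁ b l₂, a :: l = l₁ ++ b :: l₂ ∧ x = monomial (l₁ ++ l₂)} :=
        Submodule.subset_span ⟨[], a, l, rfl, rfl⟩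
      have h2 : (CliffordAlgebra.involute (monomial l : Ext α) : Ext α) ∈ Submodule.span ℤ
          {x | ∃ l₁ b l₂, a :: l = l₁ ++ b :: l₂ ∧ x = monomial (l₁ ++ l₂)} := by
        rcases involute_monomial l with h | h
        · rwa [h]
        · rw [h]; exact neg_mem h1
      by_cases hac : a ∈ c
      · rwa [contraction_gen_of_mem hac, one_mul]
      · rw [contraction_gen_of_notMem hac, zero_mul]; exact zero_mem _

/-- Modulo the Orlik–Solomon ideal, the monomial of a basis of a flat is a combination of the
monomials of the adapted flags of this flat: if `e` is the element chosen in the flat, then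
`x ≡ ± e ∧ ∂x`, and a term `e ∧ y` of the right hand side vanishes unless `e` is
independent of `y`. -/
theorem monomial_mem_span_adapted [M.Loopless] (b : List α) (hn : b.Nodup)
    (hi : M.Indep {e | e ∈ b}) :
    monomial b ∈ Submodule.span ℤ {x | ∃ t, IsDescFlag M ∅ t ∧ IsAdapted ∅ t ∧
      t.headD ∅ = M.closure {e | e ∈ b} ∧ x = monomial (chosen t)} ⊔ osIdeal M := by
  induction h : b.length generalizing b with
  | zero =>
    obtain rfl := List.eq_nil_of_length_eq_zero h
    refine Submodule.mem_sup_left (Submodule.subset_span ⟨[], trivial, trivial, ?_, rfl⟩)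
    simp [M.closure_empty, Matroid.loops_eq_empty]
  | succ n ih =>
    set H := M.closure {e | e ∈ b} with hH
    have hbH : ∀ a ∈ b, a ∈ H := fun a ha => M.subset_closure _ hi.subset_ground ha
    have hHne : H.Nonempty := by
      obtain _ | ⟨a, b⟩ := b
      · simp at h
      · exact ⟨a, hbH a (by simp)⟩
    set e := hHne.some with he
    have heH : e ∈ H := hHne.some_mem
    set T := Submodule.span ℤ {x | ∃ t, IsDescFlag M ∅ t ∧ IsAdapted ∅ t ∧
      t.headD ∅ = H ∧ x = monomial (chosen t)} ⊔ osIdeal M with hT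
    -- `e` depends on the basis `b`, so `∂(e ∧ b)` is a relation
    have h1 : boundary (gen e * monomial b) ∈ T := by
      refine Submodule.mem_sup_right ?_
      by_cases heb : e ∈ b
      · rw [gen_mul_monomial_of_mem heb, map_zero]; exact zero_mem _
      · rw [← monomial_cons]
        refine boundary_mem_osIdeal M (List.nodup_cons.2 ⟨heb, hn⟩) ?_
        have : {x | x ∈ e :: b} = insert e {x | x ∈ b} := by ext; simp
        rw [this, hi.insert_dep_iff]
        exact ⟨heH, heb⟩
    have h2 : gen e * boundary (monomial b) ∈ T := by
      have : Submodule.map (LinearMap.mulLeft ℤ (gen e)) (Submodule.span ℤ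
          {x | ∃ l₁ a l₂, b = l₁ ++ a :: l₂ ∧ x = monomial (l₁ ++ l₂)}) ≤ T := by
        rw [Submodule.map_span_le]
        rintro _ ⟨l₁, a, l₂, hb, rfl⟩
        rw [LinearMap.mulLeft_apply]
        have hab : {x | x ∈ b} = insert a {x | x ∈ l₁ ++ l₂} := by
          rw [hb]; ext x; simp; tauto
        have hperm : b.Perm (a :: (l₁ ++ l₂)) := by rw [hb]; exact List.perm_middle
        have hn' := List.nodup_cons.1 (hperm.nodup_iff.1 hn)
        have hi' : M.Indep {x | x ∈ l₁ ++ l₂} := hi.subset (hab ▸ subset_insert _ _)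
        by_cases heK : e ∈ M.closure {x | x ∈ l₁ ++ l₂}
        · by_cases hel : e ∈ l₁ ++ l₂
          · rw [gen_mul_monomial_of_mem hel]; exact zero_mem _
          · rw [← monomial_cons]
            refine Submodule.mem_sup_right
              (monomial_mem_osIdeal M (List.nodup_cons.2 ⟨hel, hn'.2⟩) ?_)
            have : {x | x ∈ e :: (l₁ ++ l₂)} = insert e {x | x ∈ l₁ ++ l₂} := by ext; simp
            rw [this, hi'.insert_dep_iff]
            exact ⟨heK, hel⟩
        · have hrec := ih (l₁ ++ l₂) hn'.2 hi' (by
            have := hperm.length_eq; rw [h] at this; simpa using this.symm)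
          have hcov : Covers M (M.closure {x | x ∈ l₁ ++ l₂}) H := by
            refine ⟨M.isFlat_closure _, a, hi.subset_ground (hab ▸ mem_insert _ _), ?_, ?_⟩
            · have : M.Indep (insert a {x | x ∈ l₁ ++ l₂}) := hab ▸ hi
              exact ((hi'.insert_indep_iff_of_notMem hn'.1).1 this).2
            · rw [M.closure_insert_closure_eq_closure_insert, ← hab]
          obtain ⟨y, hy, z, hz, hyz⟩ := Submodule.mem_sup.1 hrec
          rw [← hyz, mul_add]
          refine add_mem ?_ (Submodule.mem_sup_right (mul_mem_osIdeal_left M hz _))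
          have hmap : Submodule.map (LinearMap.mulLeft ℤ (gen e)) (Submodule.span ℤ
              {x | ∃ t, IsDescFlag M ∅ t ∧ IsAdapted ∅ t ∧
                t.headD ∅ = M.closure {x | x ∈ l₁ ++ l₂} ∧ x = monomial (chosen t)}) ≤ T := by
            rw [Submodule.map_span_le]
            rintro _ ⟨t, ht, hta, hth, rfl⟩
            refine Submodule.mem_sup_left (Submodule.subset_span
              ⟨H :: t, ⟨hth ▸ hcov, ht⟩, ⟨fun _ => by rw [hth]; exact heK, hta⟩, rfl, ?_⟩)
            rw [chosen_cons hHne, monomial_cons, LinearMap.mulLeft_apply]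
          exact hmap ⟨y, hy, rfl⟩
      exact this ⟨_, contraction_monomial_mem_span univ b, rfl⟩
    -- `∂(e ∧ b) = e ∧ ∂b ± b`
    have h3 : CliffordAlgebra.involute (monomial b : Ext α) =
        boundary (gen e * monomial b) - gen e * boundary (monomial b) := by
      rw [boundary, contraction_mul, contraction_gen_of_mem (mem_univ e)]
      noncomm_ring
    have h4 : (CliffordAlgebra.involute (monomial b : Ext α) : Ext α) ∈ T := by
      rw [h3]; exact sub_mem h1 h2
    rcases involute_monomial b with h5 | h5 <;> rw [h5] at h4
    · exact h4
    · exact (neg_mem_iff (H := T)).1 h4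

theorem exteriorPower_eq_span (n : ℕ) : ⋀[ℤ]^n (α →₀ ℤ) =
    Submodule.span ℤ {x : Ext α | ∃ l : List α, l.length = n ∧ x = monomial l} := by
  have h1 : LinearMap.range (ExteriorAlgebra.ι ℤ (M := α →₀ ℤ)) =
      Submodule.span ℤ (range (gen : α → Ext α)) := by
    rw [LinearMap.range_eq_map, ← Finsupp.basisSingleOne.span_eq, Submodule.map_span,
      ← range_comp]
    congr 2
  rw [ExteriorAlgebra.exteriorPower, h1, Submodule.span_pow]
  congr 1
  ext x
  rw [Set.mem_pow]
  constructor
  · rintro ⟨f, rfl⟩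
    choose g hg using fun i => (f i).2
    refine ⟨List.ofFn g, by simp, ?_⟩
    rw [monomial, List.map_ofFn]
    congr 2
    ext1 i
    exact (hg i).symm
  · rintro ⟨l, rfl, rfl⟩
    refine ⟨fun i => ⟨gen (l.get i), mem_range_self _⟩, ?_⟩
    rw [monomial]
    congr 1
    conv_rhs => rw [← List.ofFn_get l, List.map_ofFn]
    rfl

end

section

variable {α : Type u}

variable {M : Matroid α} {A B C : Set α}

/-! ### Flag residues on the Orlik–Solomon algebra -/

theorem res_mk [M.Loopless] {c : Set α} (hr : M.eRk (c ∩ M.E) = 1) (x : Ext α) :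
    res M c ((osIdeal M).mkQ x) = (osIdeal (M ／ c)).mkQ (contraction (c ∩ M.E) x) := by
  have h := osIdeal_le_comap M (c := c ∩ M.E) inter_subset_right hr
  rw [M.contract_inter_ground_eq] at h
  rw [res, dif_pos h]
  rfl

theorem coeff_mk [M.Loopless] (x : Ext α) :
    coeff M ((osIdeal M).mkQ x) = ExteriorAlgebra.algebraMapInv x := by
  rw [coeff, dif_pos (osIdeal_le_ker M)]
  rfl

theorem Covers.eRk_contract_eq_one (h : Covers M A B) : (M ／ A).eRk (B ∩ (M ／ A).E) = 1 := by
  have := loopless_contract h.1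
  obtain ⟨e, heB, heA⟩ := h.exists_mem
  have he : e ∈ (M ／ A).E := ⟨h.isFlat_right.subset_ground heB, heA⟩
  have h1 : B ∩ (M ／ A).E = (M ／ A).closure {e} := by
    rw [Matroid.contract_closure_eq, singleton_union, h.closure_insert heB heA,
      Matroid.contract_ground, ← inter_sdiff_assoc,
      inter_eq_self_of_subset_left h.isFlat_right.subset_ground]
  rw [h1, Matroid.eRk_closure_eq, Matroid.eRk_singleton_eq he]

theorem flagRes_mk_chainRes (l : List (Set α)) : ∀ (t : List (Set α)) (N : Matroid α),
    N = M ／ t.headD A → M.IsFlat A → IsDescFlag M A (l.reverse ++ t) → ∀ x : Ext α,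
    flagRes N l ((osIdeal N).mkQ (chainRes A t x)) = chainVal A (l.reverse ++ t) x := by
  induction l with
  | nil =>
    rintro t N rfl hA ht x
    have := loopless_contract (IsDescFlag.isFlat_head hA (t := t) (by simpa using ht))
    exact coeff_mk _
  | cons F l ih =>
    rintro t N rfl hA ht x
    have ht' : IsDescFlag M A (l.reverse ++ F :: t) := by simpa using ht
    have hF : Covers M (t.headD A) F ∧ IsDescFlag M A t := (isDescFlag_append.1 ht').2
    have := loopless_contract hF.1.1
    have hFE : F ∩ (M ／ t.headD A).E = F \ t.headD A := by
      rw [Matroid.contract_ground, ← inter_sdiff_assoc,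
        inter_eq_self_of_subset_left hF.1.isFlat_right.subset_ground]
    rw [flagRes, LinearMap.comp_apply, res_mk hF.1.eRk_contract_eq_one, hFE]
    have := ih (F :: t) (M ／ t.headD A ／ F) (by
      rw [Matroid.contract_contract, union_eq_self_of_subset_left hF.1.subset]; rfl) hA ht' x
    rw [chainRes, LinearMap.comp_apply] at this
    rw [this]
    simp

/-- The residue of the Orlik–Solomon algebra along a flag is computed in the exterior
algebra. -/
theorem flagRes_mk [M.Loopless] {t : List (Set α)} (ht : IsDescFlag M ∅ t) (x : Ext α) :
    flagRes M t.reverse ((osIdeal M).mkQ x) = chainVal ∅ t x := by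
  have := flagRes_mk_chainRes (M := M) (A := ∅) t.reverse [] M (by simp) isFlat_empty
    (by simpa using ht) x
  simpa [chainRes] using this

theorem chainVal_eq_zero_of_mem_osIdeal [M.Loopless] {t : List (Set α)} (ht : IsDescFlag M ∅ t)
    {x : Ext α} (hx : x ∈ osIdeal M) : chainVal ∅ t x = 0 := by
  rw [← flagRes_mk ht, show (osIdeal M).mkQ x = 0 from (Submodule.Quotient.mk_eq_zero _).2 hx,
    map_zero]

theorem monomial_mem_degree (l : List α) :
    (osIdeal M).mkQ (monomial l) ∈ OS.degree M l.length := by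
  refine ⟨monomial l, ?_, rfl⟩
  rw [SetLike.mem_coe, exteriorPower_eq_span]
  exact Submodule.subset_span ⟨l, rfl, rfl⟩

theorem res_mem_degree [M.Loopless] {c : Set α} (hr : M.eRk (c ∩ M.E) = 1) {n : ℕ} {x : OS M}
    (hx : x ∈ OS.degree M (n + 1)) : res M c x ∈ OS.degree (M ／ c) n := by
  obtain ⟨y, hy, rfl⟩ := hx
  rw [res_mk hr]
  refine ⟨_, ?_, rfl⟩
  rw [SetLike.mem_coe, exteriorPower_eq_span] at hy ⊢
  have : Submodule.map (contraction (c ∩ M.E)) (Submodule.span ℤ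
      {x : Ext α | ∃ l : List α, l.length = n + 1 ∧ x = monomial l}) ≤
      Submodule.span ℤ {x : Ext α | ∃ l : List α, l.length = n ∧ x = monomial l} := by
    rw [Submodule.map_span_le]
    rintro _ ⟨l, hl, rfl⟩
    refine Submodule.span_mono ?_ (contraction_monomial_mem_span _ _)
    rintro _ ⟨l₁, a, l₂, rfl, rfl⟩
    exact ⟨l₁ ++ l₂, by simp at hl ⊢; lia, rfl⟩
  exact this ⟨_, hy, rfl⟩

/-- In top degree the Orlik–Solomon algebra is detected by the residues along complete flags. -/
theorem eq_zero_of_flagRes_eq_zero [Finite α] [M.Loopless] {n : ℕ} (hn : M.eRank = n) {x : OS M}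
    (hx : x ∈ OS.degree M n)
    (h : ∀ t, IsDescFlag M ∅ t → t.headD ∅ = M.E → flagRes M t.reverse x = 0) : x = 0 := by
  obtain ⟨y, hy, rfl⟩ := hx
  rw [SetLike.mem_coe, exteriorPower_eq_span] at hy
  let ι := {t : List (Set α) // IsDescFlag M ∅ t ∧ IsAdapted ∅ t ∧ t.headD ∅ = M.E}
  have hspan : y ∈ Submodule.span ℤ (range fun t : ι => (monomial (chosen t.1) : Ext α)) ⊔
      osIdeal M := by
    refine Submodule.span_le.2 ?_ hy
    rintro _ ⟨l, hl, rfl⟩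
    by_cases hlE : ∀ e ∈ l, e ∈ M.E
    · by_cases hnd : l.Nodup
      · by_cases hi : M.Indep {e | e ∈ l}
        · have hb : M.closure {e | e ∈ l} = M.E := by
            refine ((hi.isBase_of_eRk_ge (toFinite _) ?_).closure_eq)
            classical
            rw [hi.eRk_eq_encard, hn]
            have : {e | e ∈ l} = (l.toFinset : Set α) := by ext; simp
            rw [this, encard_coe_eq_coe_finsetCard, List.toFinset_card_of_nodup hnd, hl]
          have := monomial_mem_span_adapted l hnd hi
          rw [hb] at this
          have hle : Submodule.span ℤ {x : Ext α | ∃ t, IsDescFlag M ∅ t ∧ IsAdapted ∅ t ∧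
              t.headD ∅ = M.E ∧ x = monomial (chosen t)} ≤
              Submodule.span ℤ (range fun t : ι => (monomial (chosen t.1) : Ext α)) := by
            refine Submodule.span_mono ?_
            rintro _ ⟨t, h1, h2, h3, rfl⟩
            exact ⟨⟨t, h1, h2, h3⟩, rfl⟩
          exact sup_le_sup_right hle (osIdeal M) this
        · exact Submodule.mem_sup_right
            (monomial_mem_osIdeal M hnd ((M.not_indep_iff (X := {e | e ∈ l}) hlE).1 hi))
      · rw [monomial_eq_zero hnd]; exact zero_mem _
    · push Not at hlE
      obtain ⟨e, he, heE⟩ := hlE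
      exact Submodule.mem_sup_right (monomial_mem_osIdeal_of_notMem he heE)
  obtain ⟨z, hz, w, hw, rfl⟩ := Submodule.mem_sup.1 hspan
  obtain ⟨c, rfl⟩ := Finsupp.mem_span_range_iff_exists_finsupp.1 hz
  have hc : c = 0 := by
    classical
    ext t
    have h0 := h t.1 t.2.1 t.2.2.2
    rw [flagRes_mk t.2.1, map_add, chainVal_eq_zero_of_mem_osIdeal t.2.1 hw, add_zero,
      Finsupp.sum, map_sum] at h0
    rw [Finset.sum_congr rfl fun i _ => by
      rw [map_smul, chainVal_monomial_chosen isFlat_empty t.2.1 i.2.1 t.2.2.1 i.2.2.1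
        (t.2.2.2.trans i.2.2.2.symm)]] at h0
    rw [Finset.sum_eq_single t] at h0
    · simpa using h0
    · intro i _ hi
      rw [if_neg fun h => hi (Subtype.ext h.symm), smul_zero]
    · intro ht
      rw [Finsupp.notMem_support_iff.1 ht, zero_smul]
  rw [hc, Finsupp.sum_zero_index, zero_add]
  exact (Submodule.Quotient.mk_eq_zero _).2 hw

/-- A function on complete flags that satisfies the gap relations is the system of flag residues
of an element of the Orlik–Solomon algebra of top degree: a combination of the monomials of the
adapted flags has the given residues along the adapted flags, hence along all flags. -/
theorem exists_flagRes_eq [Finite α] [M.Loopless] {n : ℕ} (hn : M.eRank = n)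
    (φ : List (Set α) → ℤ)
    (hφ : ∀ p B X q, IsDescFlag M ∅ (p ++ B :: X :: q) → (p ++ B :: X :: q).headD ∅ = M.E →
      ∀ S : Finset (Set α), (∀ Y, Y ∈ S ↔ Covers M (q.headD ∅) Y ∧ Covers M Y B) →
        ∑ Y ∈ S, φ (p ++ B :: Y :: q) = 0) :
    ∃ x ∈ OS.degree M n, ∀ t, IsDescFlag M ∅ t → t.headD ∅ = M.E →
      flagRes M t.reverse x = φ t := by
  have hlen : ∀ t, IsDescFlag M ∅ t → t.headD ∅ = M.E → t.length = n := by
    intro t ht htE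
    have := ht.length_eq
    rw [htE, M.eRk_ground, hn] at this
    exact_mod_cast this.symm
  have hfin : {t | IsDescFlag M ∅ t ∧ IsAdapted ∅ t ∧ t.headD ∅ = M.E}.Finite :=
    (List.finite_length_le (Set α) n).subset fun t ht => (hlen t ht.1 ht.2.2).le
  set y : Ext α := ∑ t ∈ hfin.toFinset, φ t • monomial (chosen t) with hy
  refine ⟨(osIdeal M).mkQ y, ?_, fun t ht htE => ?_⟩
  · rw [hy, map_sum]
    refine sum_mem fun t ht => ?_
    have ht' := hfin.mem_toFinset.1 ht
    rw [map_smul]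
    refine Submodule.smul_mem _ _ ?_
    rw [← hlen t ht'.1 ht'.2.2, ← length_chosen ht'.1]
    exact monomial_mem_degree _
  · rw [flagRes_mk ht]
    rw [← sub_eq_zero]
    refine eq_zero_of_gap_of_adapted (M := M) (E := M.E) (δ := fun t => chainVal ∅ t y - φ t)
      ?_ ?_ ht htE
    · intro p B X q hf hfE S hS
      have h2 := (isDescFlag_append.1 hf).2
      rw [Finset.sum_sub_distrib, hφ p B X q hf hfE S hS,
        sum_chainVal_eq_zero (M := M) h2.2.1 h2.1 p q rfl S hS, sub_zero]
    · intro t ht htE hta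
      rw [sub_eq_zero, hy, map_sum]
      classical
      rw [Finset.sum_congr rfl fun i hi => by
        rw [map_smul, chainVal_monomial_chosen isFlat_empty ht (hfin.mem_toFinset.1 hi).1 hta
          (hfin.mem_toFinset.1 hi).2.1 (htE.trans (hfin.mem_toFinset.1 hi).2.2.symm)]]
      rw [Finset.sum_eq_single t]
      · simp
      · intro i _ hi
        rw [if_neg fun h => hi h.symm, smul_zero]
      · exact fun h => absurd (hfin.mem_toFinset.2 ⟨ht, hta, htE⟩) h

end

section

variable {α : Type u}

namespace OrientedMatroid

variable {M : OrientedMatroid α} {P : α → SignType} {A B C : Set α}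

/-! ### Topes and their faces -/

/-- A covector of full support. In a loopless oriented matroid these are the topes. -/
def IsFull (M : OrientedMatroid α) (P : α → SignType) : Prop :=
  P ∈ M.covectors ∧ ∀ e ∈ M.toMatroid.E, P e ≠ 0

theorem IsTope.isFull [M.toMatroid.Loopless] (h : M.IsTope P) : M.IsFull P := by
  refine ⟨h.1, fun e he hPe => ?_⟩
  obtain ⟨X, hX, hX0⟩ := (M.isFlat_iff ∅).1 isFlat_empty
  have hXe : X e ≠ 0 := fun h0 => by
    have : e ∈ (∅ : Set α) := by rw [hX0]; exact ⟨he, h0⟩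
    exact this
  have hc := h.2 _ (M.comp_mem P h.1 X hX) fun f hf => by simp [comp, hf]
  have := congrFun hc e
  simp only [comp, hPe, ne_eq, not_true_eq_false, if_false] at this
  exact hXe this

theorem IsFull.mem_faces_iff (hP : M.IsFull P) {F : Set α} :
    F ∈ M.faces P ↔ F ⊆ M.toMatroid.E ∧ Fᶜ.indicator P ∈ M.covectors := by
  constructor
  · rintro ⟨X, hX, hXP, rfl⟩
    refine ⟨fun e he => he.1, ?_⟩
    convert hX using 1
    ext1 e
    by_cases heE : e ∈ M.toMatroid.E
    · by_cases hXe : X e = 0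
      · rw [indicator_of_notMem (by simp [heE, hXe]), hXe]
      · rw [indicator_of_mem (by simp [hXe]), hXP e hXe]
    · rw [M.apply_eq_zero X hX e heE, indicator_apply_eq_zero]
      exact fun _ => M.apply_eq_zero P hP.1 e heE
  · rintro ⟨hFE, hF⟩
    refine ⟨_, hF, fun e he => ?_, ?_⟩
    · exact indicator_of_mem (by_contra fun h => he (indicator_of_notMem h _)) _
    · ext e
      by_cases heF : e ∈ F
      · simp [heF, hFE heF]
      · simp only [mem_ofPred_eq, heF, false_iff, not_and]
        intro heE
        rw [indicator_of_mem (by exact heF)]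
        exact hP.2 e heE

theorem isFlat_of_mem_faces {F : Set α} (h : F ∈ M.faces P) : M.toMatroid.IsFlat F := by
  obtain ⟨X, hX, -, rfl⟩ := h
  exact (M.isFlat_iff _).2 ⟨X, hX, rfl⟩

theorem IsFull.empty_mem_faces (hP : M.IsFull P) : ∅ ∈ M.faces P :=
  hP.mem_faces_iff.2 ⟨empty_subset _, by simpa using hP.1⟩

theorem IsFull.ground_mem_faces (hP : M.IsFull P) : M.toMatroid.E ∈ M.faces P := by
  refine hP.mem_faces_iff.2 ⟨subset_rfl, ?_⟩
  convert M.zero_mem using 1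
  ext1 e
  rw [Pi.zero_apply, indicator_apply_eq_zero]
  exact fun he => M.apply_eq_zero P hP.1 e he

theorem IsFull.headD_mem_faces (hP : M.IsFull P) {t : List (Set α)}
    (ht : ∀ F ∈ t, F ∈ M.faces P) : t.headD ∅ ∈ M.faces P := by
  cases t with
  | nil => exact hP.empty_mem_faces
  | cons H t => exact ht H (by simp)

/-! ### Signs along flags -/

/-- Two covectors that vanish on `A` and agree, with a nonzero value, at `e`, agree on the closure
of `A ∪ {e}`: otherwise eliminating `e` from one and the negative of the other yields a covector
that vanishes on `A ∪ {e}` but not on its closure. -/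
theorem apply_eq_of_apply_eq {X Y : α → SignType} (hX : X ∈ M.covectors) (hY : Y ∈ M.covectors)
    (hXA : ∀ a ∈ A, X a = 0) (hYA : ∀ a ∈ A, Y a = 0) {e f : α} (he : X e ≠ 0)
    (h : X e = Y e) (hf : f ∈ M.toMatroid.closure (insert e A)) : X f = Y f := by
  obtain ⟨Z, hZ, hZe, hZf⟩ := M.elimination X hX (-Y) (M.neg_mem _ hY) e he (by simpa using h)
  have hZ0 : Z f = 0 := by
    refine M.eq_zero_of_mem_closure hZ ?_ hf
    rintro a (rfl | ha)
    · exact hZe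
    · rw [hZf a (by simp [hXA a ha])]
      simp [comp, hXA a ha, hYA a ha]
  by_cases hs : X f ≠ 0 ∧ X f = -(-Y) f
  · simpa using hs.2
  · have h1 := hZf f hs
    rw [hZ0] at h1
    by_cases hXf : X f = 0
    · simp only [comp, hXf, ne_eq, not_true_eq_false, if_false, Pi.neg_apply] at h1
      rw [hXf]
      revert h1
      generalize Y f = y
      revert y; decide
    · simp only [comp, ne_eq, hXf, not_false_eq_true, if_true] at h1
      exact absurd h1.symm hXf

/-- In rank one covectors are unique up to sign: on a flat covering `A`, any two covectors that
vanish on `A` are proportional. -/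
theorem apply_mul_apply_eq {X Y : α → SignType} (hX : X ∈ M.covectors) (hY : Y ∈ M.covectors)
    (hXA : ∀ a ∈ A, X a = 0) (hYA : ∀ a ∈ A, Y a = 0) {e f : α}
    (he : e ∈ M.toMatroid.closure (insert f A)) (hf : f ∈ M.toMatroid.closure (insert e A)) :
    X e * Y f = X f * Y e := by
  have hz : ∀ Z ∈ M.covectors, (∀ a ∈ A, Z a = 0) → Z e = 0 → Z f = 0 := fun Z hZ hZA hZe =>
    M.eq_zero_of_mem_closure hZ (by rintro a (rfl | ha); exacts [hZe, hZA a ha]) hf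
  by_cases hXe : X e = 0
  · rw [hXe, hz X hX hXA hXe]; simp
  by_cases hYe : Y e = 0
  · rw [hYe, hz Y hY hYA hYe]; simp
  by_cases h : X e = Y e
  · rw [h, apply_eq_of_apply_eq hX hY hXA hYA hXe h hf, mul_comm]
  · have h' : X e = (-Y) e := by
      revert h hXe hYe
      simp only [Pi.neg_apply]
      generalize X e = x
      generalize Y e = y
      revert x y; decide
    have h2 := apply_eq_of_apply_eq hX (M.neg_mem Y hY) hXA (fun a ha => by simp [hYA a ha])
      hXe h' hf
    rw [h', h2]
    simp [mul_comm]

theorem chirotope_append_cons (p l : List α) (f : α) :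
    M.chirotope (p ++ f :: l) = (-1) ^ p.length * M.chirotope (f :: (p ++ l)) := by
  induction p using List.reverseRecOn generalizing l with
  | nil => simp
  | append_singleton p g ih =>
    have h := M.chirotope_swap p g f l
    simp only [List.append_assoc, List.cons_append, List.nil_append, List.length_append,
      List.length_singleton] at h ⊢
    rw [h, ih, pow_succ]
    simp

/-- If `f` and `f'` lie in a flat covering the face `A` of `P`, then `χ(f, l) P(f)` does not change
when `f` is replaced by `f'`, provided that `l` spans `A`. -/
theorem IsFull.chirotope_mul_apply (hP : M.IsFull P) (hA : A ∈ M.faces P)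
    (hB : Covers M.toMatroid A B) {f f' : α} (hf : f ∈ B) (hfA : f ∉ A) (hf' : f' ∈ B)
    (hfA' : f' ∉ A) {l : List α} (hl : A ⊆ M.toMatroid.closure {e | e ∈ l}) :
    M.chirotope (f :: l) * P f = M.chirotope (f' :: l) * P f' := by
  have hAc := (hP.mem_faces_iff.1 hA)
  have hBE := hB.isFlat_right.subset_ground
  set Z := M.toMatroid.closure {e | e ∈ l} with hZ
  have hiff : f ∈ Z ↔ f' ∈ Z := by
    constructor
    · exact fun h => hB.subset_of_mem (M.toMatroid.isFlat_closure _) hl hf hfA h hf'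
    · exact fun h => hB.subset_of_mem (M.toMatroid.isFlat_closure _) hl hf' hfA' h hf
  have hzero : ∀ g, g ∈ Z → M.chirotope (g :: l) = 0 := by
    intro g hg
    by_contra hne
    have hb := (M.chirotope_ne_zero_iff _).1 hne
    refine hb.2.indep.notMem_closure_sdiff_of_mem (e := g) (by simp) ?_
    refine M.toMatroid.closure_subset_closure ?_ hg
    intro x hx
    exact ⟨List.mem_cons_of_mem _ hx, by rintro rfl; exact (List.nodup_cons.1 hb.1).1 hx⟩
  by_cases hfZ : f ∈ Z
  · rw [hzero f hfZ, hzero f' (hiff.1 hfZ), zero_mul, zero_mul]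
  obtain ⟨X, hX, hXZ⟩ := (M.isFlat_iff _).1 (M.toMatroid.isFlat_closure {e | e ∈ l})
  have hX0 : ∀ g ∈ M.toMatroid.E, (X g = 0 ↔ g ∈ Z) := by
    intro g hg
    rw [hZ, hXZ]
    simp [hg]
  by_cases hlE : ∀ x ∈ l, x ∈ M.toMatroid.E
  · have h1 := M.chirotope_covector X hX l
      (fun x hx => (hX0 x (hlE x hx)).2 (M.toMatroid.mem_closure_of_mem hx hlE)) f f'
    have h2 := apply_mul_apply_eq (A := A) (e := f) (f := f') hX hAc.2
      (fun a ha => (hX0 a (hAc.1 ha)).2 (hl ha)) (fun a ha => indicator_of_notMem (by simpa) _)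
      (by rwa [hB.closure_insert hf' hfA']) (by rwa [hB.closure_insert hf hfA])
    rw [indicator_of_mem (by exact hfA'), indicator_of_mem (by exact hfA)] at h2
    have h3 : X f ≠ 0 := fun h => hfZ ((hX0 f (hBE hf)).1 h)
    have h4 : X f' ≠ 0 := fun h => hfZ (hiff.2 ((hX0 f' (hBE hf')).1 h))
    have hsq : ∀ x : SignType, x ≠ 0 → x * x = 1 := by decide
    calc M.chirotope (f :: l) * P f
        = M.chirotope (f :: l) * (X f' * X f') * P f := by rw [hsq _ h4, mul_one]
      _ = M.chirotope (f :: l) * X f' * (X f' * P f) := by simp only [mul_assoc]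
      _ = M.chirotope (f' :: l) * X f * (X f * P f') := by rw [h1, h2]
      _ = M.chirotope (f' :: l) * (X f * X f) * P f' := by simp only [mul_assoc]
      _ = M.chirotope (f' :: l) * P f' := by rw [hsq _ h3, mul_one]
  · have h0 : ∀ g, M.chirotope (g :: l) = 0 := by
      intro g
      by_contra hne
      exact hlE fun x hx => ((M.chirotope_ne_zero_iff _).1 hne).2.subset_ground
        (List.mem_cons_of_mem _ hx)
    rw [h0, h0, zero_mul, zero_mul]

end OrientedMatroid

/-- A list of elements, one in each step of a descending flag above `A`. -/
def IsTransversal (A : Set α) : List (Set α) → List α → Prop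
  | [], [] => True
  | H :: t, f :: b => f ∈ H ∧ f ∉ t.headD A ∧ IsTransversal A t b
  | _, _ => False

theorem IsTransversal.append {A : Set α} {t p : List (Set α)} {b c : List α}
    (h : IsTransversal A t b) (hp : IsTransversal (t.headD A) p c) :
    IsTransversal A (p ++ t) (c ++ b) := by
  induction p generalizing c with
  | nil => cases c with
    | nil => exact h
    | cons f c => exact hp.elim
  | cons H p ih => cases c with
    | nil => exact hp.elim
    | cons f c =>
      exact ⟨hp.1, (congrArg (f ∉ ·) (headD_append p t A)).mpr hp.2.1, ih hp.2.2⟩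

theorem IsDescFlag.exists_isTransversal {M : Matroid α} {A : Set α} {t : List (Set α)}
    (h : IsDescFlag M A t) : ∃ b, IsTransversal A t b := by
  induction t with
  | nil => exact ⟨[], trivial⟩
  | cons H t ih =>
    obtain ⟨b, hb⟩ := ih h.2
    obtain ⟨f, hf, hf'⟩ := h.1.exists_mem
    exact ⟨f :: b, hf, hf', hb⟩

/-- A transversal of a flag is an ordered basis of the largest member of the flag. -/
theorem IsTransversal.nodup_and_indep_and_closure_eq {M : Matroid α} [M.Loopless] {t : List (Set α)}
    {b : List α} (h : IsDescFlag M ∅ t) (hb : IsTransversal ∅ t b) :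
    b.Nodup ∧ M.Indep {e | e ∈ b} ∧ M.closure {e | e ∈ b} = t.headD ∅ := by
  induction t generalizing b with
  | nil =>
    cases b with
    | nil => simp [M.closure_empty, Matroid.loops_eq_empty]
    | cons f b => exact hb.elim
  | cons H t ih =>
    cases b with
    | nil => exact hb.elim
    | cons f b =>
      obtain ⟨h1, h2, h3⟩ := ih h.2 hb.2.2
      have hs : {e | e ∈ f :: b} = insert f {e | e ∈ b} := by ext; simp
      have hfE := h.1.isFlat_right.subset_ground hb.1
      have hfb : f ∉ b := fun hf => hb.2.1 (h3 ▸ M.subset_closure _ h2.subset_ground hf)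
      refine ⟨List.nodup_cons.2 ⟨hfb, h1⟩, ?_, ?_⟩
      · rw [hs, h2.insert_indep_iff_of_notMem hfb]
        exact ⟨hfE, by rw [h3]; exact hb.2.1⟩
      · rw [hs, ← M.closure_insert_closure_eq_closure_insert, h3, h.1.closure_insert hb.1 hb.2.1]
        rfl

namespace OrientedMatroid

variable {M : OrientedMatroid α} {P : α → SignType} {A B C : Set α}

/-- The sign `χ(b) ∏ P(b_i)` of a list `b` of elements. -/
def sgn (M : OrientedMatroid α) (P : α → SignType) (b : List α) : SignType :=
  M.chirotope b * (b.map P).prod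

theorem sgn_swap (p : List α) (e f : α) (q : List α) :
    M.sgn P (p ++ e :: f :: q) = -M.sgn P (p ++ f :: e :: q) := by
  rw [sgn, sgn, M.chirotope_swap]
  simp only [List.map_append, List.map_cons, List.prod_append, List.prod_cons, neg_mul]
  rw [mul_left_comm (P e) (P f)]

/-- Along a flag of faces of `P` the sign does not depend on the chosen elements. -/
theorem IsFull.sgn_eq [M.toMatroid.Loopless] (hP : M.IsFull P) {t : List (Set α)}
    (ht : IsDescFlag M.toMatroid ∅ t) (hf : ∀ F ∈ t, F ∈ M.faces P) (p : List α) {b b' : List α}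
    (hb : IsTransversal ∅ t b) (hb' : IsTransversal ∅ t b') :
    M.sgn P (p ++ b) = M.sgn P (p ++ b') := by
  induction t generalizing p b b' with
  | nil =>
    cases b with
    | cons f b => exact hb.elim
    | nil => cases b' with
      | cons f b => exact hb'.elim
      | nil => rfl
  | cons H t ih =>
    cases b with
    | nil => exact hb.elim
    | cons f c => cases b' with
      | nil => exact hb'.elim
      | cons f' c' =>
        have hf' : ∀ F ∈ t, F ∈ M.faces P := fun F hF => hf F (List.mem_cons_of_mem _ hF)
        have hcl := (IsTransversal.nodup_and_indep_and_closure_eq ht.2 hb.2.2).2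
        have hsub : t.headD ∅ ⊆ M.toMatroid.closure {e | e ∈ p ++ c} := by
          rw [← hcl.2]
          exact M.toMatroid.closure_subset_closure fun x hx => List.mem_append_right _ hx
        have h1 : M.sgn P (p ++ f :: c) = M.sgn P (p ++ f' :: c) := by
          have := hP.chirotope_mul_apply (hP.headD_mem_faces hf') ht.1 hb.1 hb.2.1 hb'.1 hb'.2.1
            hsub
          rw [sgn, sgn, chirotope_append_cons, chirotope_append_cons]
          simp only [List.map_append, List.map_cons, List.prod_append, List.prod_cons]
          calc _ = (-1) ^ p.length * (M.chirotope (f :: (p ++ c)) * P f) *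
                ((p.map P).prod * (c.map P).prod) := by
                simp only [mul_assoc, mul_left_comm, mul_comm]
            _ = (-1) ^ p.length * (M.chirotope (f' :: (p ++ c)) * P f') *
                ((p.map P).prod * (c.map P).prod) := by rw [this]
            _ = _ := by simp only [mul_assoc, mul_left_comm, mul_comm]
        rw [h1]
        simpa using ih ht.2 hf' (p ++ [f']) hb.2.2 hb'.2.2

/-- If the flats `A ⊂ C ⊂ B` have consecutive ranks and `A`, `B` are faces of `P`, then between
`A` and `B` there is a face that avoids a given element of `B ∖ A`. It is found by eliminating, one
after the other, the elements of `B` at which a covector differs in sign from `P`. -/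
theorem IsFull.exists_mem_faces_notMem [Finite α] (hP : M.IsFull P) (hA : A ∈ M.faces P)
    (hB : B ∈ M.faces P) (hAC : Covers M.toMatroid A C) (hCB : Covers M.toMatroid C B) {e : α}
    (heB : e ∈ B) (heA : e ∉ A) :
    ∃ X ∈ M.faces P, Covers M.toMatroid A X ∧ Covers M.toMatroid X B ∧ e ∉ X := by
  have hAc := hP.mem_faces_iff.1 hA
  have hBc := hP.mem_faces_iff.1 hB
  -- induction on the number of elements of `B` at which `Z` has the sign opposite to `P`
  have key : ∀ n, ∀ Z ∈ M.covectors, (∀ a ∈ A, Z a = 0) → Z e = P e →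
      (∃ f ∈ B, f ∉ A ∧ Z f = 0) → {g ∈ B | Z g ≠ 0 ∧ Z g = -P g}.ncard = n →
      ∃ X ∈ M.faces P, Covers M.toMatroid A X ∧ Covers M.toMatroid X B ∧ e ∉ X := by
    intro n
    induction n using Nat.strong_induction_on with
    | _ n ih =>
    rintro Z hZ hZA hZe ⟨f, hfB, hfA, hZf⟩ hn
    by_cases hsep : ∃ g ∈ B, Z g ≠ 0 ∧ Z g = -P g
    · obtain ⟨g, hgB, hg0, hgP⟩ := hsep
      have hP' : ∀ h, Z h ≠ 0 → Aᶜ.indicator P h = P h := fun h hh =>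
        indicator_of_mem (show h ∈ Aᶜ from fun hA' => hh (hZA h hA')) _
      obtain ⟨Z', hZ', hZ'g, hZ'f⟩ := M.elimination Z hZ _ hAc.2 g hg0 (by rw [hP' g hg0, hgP])
      have hgA : g ∉ A := fun h => hg0 (hZA g h)
      refine ih _ ?_ Z' hZ' (fun a ha => ?_) ?_ ⟨g, hgB, hgA, hZ'g⟩ rfl
      · rw [← hn]
        refine ncard_lt_ncard ?_ (toFinite _)
        refine ssubset_iff_exists.2 ⟨?_, g, ⟨hgB, hg0, hgP⟩, fun h => h.2.1 hZ'g⟩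
        rintro h ⟨hhB, hh0, hhP⟩
        refine ⟨hhB, ?_⟩
        by_contra hns
        have hns' : ¬ (Z h ≠ 0 ∧ Z h = -Aᶜ.indicator P h) := fun ⟨h1, h2⟩ =>
          hns ⟨h1, by rw [h2, hP' h h1]⟩
        have h1 := hZ'f h hns'
        by_cases hZh : Z h = 0
        · simp only [comp, hZh, ne_eq, not_true_eq_false, if_false] at h1
          have hPh := hP.2 h (hBc.1 hhB)
          by_cases hhA : h ∈ A
          · rw [indicator_of_notMem (by simpa)] at h1
            exact hh0 h1
          · rw [indicator_of_mem (by exact hhA)] at h1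
            rw [h1] at hhP
            revert hhP hPh
            generalize P h = x
            revert x; decide
        · simp only [comp, ne_eq, hZh, not_false_eq_true, if_true] at h1
          exact hns ⟨hZh, by rw [← h1, hhP]⟩
      · rw [hZ'f a (by simp [hZA a ha])]
        simp [comp, hZA a ha, ha]
      · have hPe := hP.2 e (hBc.1 heB)
        rw [hZ'f e]
        · simp [comp, hZe, hPe]
        · rintro ⟨h1, h2⟩
          rw [hP' e h1, hZe] at h2
          revert hPe h2
          generalize P e = x
          revert x; decide
    · -- `Z` conforms to `P` on `B`, so its zero set in `B` is a face
      push Not at hsep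
      have hW := M.comp_mem _ hBc.2 Z hZ
      have hle : ∀ g ∈ B, Z g ≠ 0 → Z g = P g := by
        intro g hg h0
        have h1 := hsep g hg h0
        have h2 := hP.2 g (hBc.1 hg)
        revert h0 h1 h2
        generalize Z g = x
        generalize P g = y
        revert x y; decide
      have hWout : ∀ g ∈ M.toMatroid.E, g ∉ B → comp (Bᶜ.indicator P) Z g = P g := by
        intro g hgE hg
        simp [comp, hg, hP.2 g hgE]
      have hWin : ∀ g ∈ B, comp (Bᶜ.indicator P) Z g = Z g := by
        intro g hg
        simp [comp, hg]
      have hX : {g ∈ B | Z g = 0} ∈ M.faces P := by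
        refine ⟨_, hW, fun g hg => ?_, ?_⟩
        · by_cases hgB : g ∈ B
          · rw [hWin g hgB] at hg ⊢
            exact hle g hgB hg
          · refine hWout g ?_ hgB
            by_contra hgE
            exact hg (M.apply_eq_zero _ hW g hgE)
        · ext g
          constructor
          · rintro ⟨h1, h2⟩
            exact ⟨hBc.1 h1, by rw [hWin g h1, h2]⟩
          · rintro ⟨h1, h2⟩
            by_cases hgB : g ∈ B
            · rw [hWin g hgB] at h2
              exact ⟨hgB, h2⟩
            · rw [hWout g h1 hgB] at h2
              exact absurd h2 (hP.2 g h1)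
      have hXflat := isFlat_of_mem_faces hX
      have hc1 := covers_closure_insert hAC.1 (hBc.1 hfB) hfA
      have hc2 := hAC.covers_closure_insert_of_mem hCB hfB hfA
      have hAX : A ⊆ {g ∈ B | Z g = 0} := fun a ha => ⟨hAC.subset.trans hCB.subset ha, hZA a ha⟩
      have heX : e ∉ {g ∈ B | Z g = 0} := fun h => hP.2 e (hBc.1 heB) (hZe ▸ h.2)
      have hsub : M.toMatroid.closure (insert f A) ⊆ {g ∈ B | Z g = 0} := by
        rw [← hXflat.closure]
        exact M.toMatroid.closure_subset_closure (insert_subset ⟨hfB, hZf⟩ hAX)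
      have heq : M.toMatroid.closure (insert f A) = {g ∈ B | Z g = 0} := by
        by_contra hne
        obtain ⟨g, hg, hg'⟩ := exists_of_ssubset (hsub.ssubset_of_ne hne)
        exact heX (hc2.subset_of_mem hXflat hsub hg.1 hg' hg heB)
      exact ⟨_, hX, heq ▸ hc1, heq ▸ hc2, heX⟩
  have hce := covers_closure_insert hAC.1 (hBc.1 heB) heA
  obtain ⟨f, hfB, hfe⟩ := (hAC.covers_closure_insert_of_mem hCB heB heA).exists_mem
  have hfA : f ∉ A := fun h => hfe (hce.subset h)
  have hcf := covers_closure_insert hAC.1 (hBc.1 hfB) hfA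
  have hmem : ∀ g ∈ B, g ∈ M.toMatroid.closure (insert g A) := fun g hg =>
    M.toMatroid.mem_closure_of_mem (mem_insert _ _) (insert_subset (hBc.1 hg) hAc.1)
  have hef : e ∉ M.toMatroid.closure (insert f A) := by
    intro h
    rw [hcf.closure_insert h heA] at hfe
    exact hfe (hmem f hfB)
  obtain ⟨X, hX, hX0⟩ := (M.isFlat_iff _).1 hcf.isFlat_right
  have hXz : ∀ g ∈ M.toMatroid.closure (insert f A), X g = 0 := fun g hg => by
    rw [hX0] at hg; exact hg.2
  have hXe : X e ≠ 0 := fun h => hef (by rw [hX0]; exact ⟨hBc.1 heB, h⟩)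
  by_cases h : X e = P e
  · exact key _ X hX (fun a ha => hXz a (hcf.subset ha)) h ⟨f, hfB, hfA, hXz f (hmem f hfB)⟩ rfl
  · refine key _ (-X) (M.neg_mem X hX) (fun a ha => by simp [hXz a (hcf.subset ha)]) ?_
      ⟨f, hfB, hfA, by simp [hXz f (hmem f hfB)]⟩ rfl
    have h2 := hP.2 e (hBc.1 heB)
    revert h hXe h2
    rw [Pi.neg_apply]
    generalize X e = x
    generalize P e = y
    revert x y; decide

/-- The diamond property: between two faces of `P` whose ranks differ by two there are exactly two
faces. -/
theorem IsFull.exists_diamond [Finite α] (hP : M.IsFull P) (hA : A ∈ M.faces P)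
    (hB : B ∈ M.faces P) (hAC : Covers M.toMatroid A C) (hCB : Covers M.toMatroid C B) :
    ∃ X₁ ∈ M.faces P, ∃ X₂ ∈ M.faces P, X₁ ≠ X₂ ∧
      (Covers M.toMatroid A X₁ ∧ Covers M.toMatroid X₁ B) ∧
      (Covers M.toMatroid A X₂ ∧ Covers M.toMatroid X₂ B) ∧
      ∀ X ∈ M.faces P, Covers M.toMatroid A X → Covers M.toMatroid X B → X = X₁ ∨ X = X₂ := by
  obtain ⟨e, heC, heA⟩ := hAC.exists_mem
  obtain ⟨X₁, hX₁, h₁, h₁', -⟩ :=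
    hP.exists_mem_faces_notMem hA hB hAC hCB (hCB.subset heC) heA
  obtain ⟨e₁, he₁, he₁A⟩ := h₁.exists_mem
  obtain ⟨X₂, hX₂, h₂, h₂', hn⟩ :=
    hP.exists_mem_faces_notMem hA hB hAC hCB (h₁'.subset he₁) he₁A
  have h12 : X₁ ≠ X₂ := by rintro rfl; exact hn he₁
  refine ⟨X₁, hX₁, X₂, hX₂, h12, ⟨h₁, h₁'⟩, ⟨h₂, h₂'⟩, fun X₃ hX₃ h₃ h₃' => ?_⟩
  -- with a third face, eliminating `e₃` from the covectors of `X₁` and `-X₂` yields a covector that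
  -- vanishes on `X₃` and has the signs of `-P` at `e₁` and of `P` at `e₂`; in rank one it would be
  -- proportional to the covector of `X₃`, which has the signs of `P` at both
  by_contra! hne
  obtain ⟨e₂, he₂, he₂A⟩ := h₂.exists_mem
  obtain ⟨e₃, he₃, he₃A⟩ := h₃.exists_mem
  have hdisj : ∀ {X Y : Set α}, Covers M.toMatroid A X → Covers M.toMatroid A Y → X ≠ Y →
      ∀ {e : α}, e ∈ X → e ∉ A → e ∉ Y := fun hX hY hXY e he heA heY =>
    heA (hX.inter_eq hY hXY ▸ ⟨he, heY⟩)
  have n12 := hdisj h₁ h₂ h12 he₁ he₁A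
  have n13 := hdisj h₁ h₃ hne.1.symm he₁ he₁A
  have n21 := hdisj h₂ h₁ h12.symm he₂ he₂A
  have n23 := hdisj h₂ h₃ hne.2.symm he₂ he₂A
  have n31 := hdisj h₃ h₁ hne.1 he₃ he₃A
  have n32 := hdisj h₃ h₂ hne.2 he₃ he₃A
  have hBE := h₁'.isFlat_right.subset_ground
  have hy₁ := (hP.mem_faces_iff.1 hX₁).2
  have hy₂ := (hP.mem_faces_iff.1 hX₂).2
  have hy₃ := (hP.mem_faces_iff.1 hX₃).2
  have p1 := hP.2 e₁ (hBE (h₁'.subset he₁))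
  have p2 := hP.2 e₂ (hBE (h₂'.subset he₂))
  have p3 := hP.2 e₃ (hBE (h₃'.subset he₃))
  obtain ⟨Z, hZ, hZ3, hZf⟩ := M.elimination _ hy₁ _ (M.neg_mem _ hy₂) e₃
    (by rwa [indicator_of_mem (by exact n31)])
    (by rw [Pi.neg_apply, neg_neg, indicator_of_mem (by exact n31),
      indicator_of_mem (by exact n32)])
  have hZA : ∀ a ∈ A, Z a = 0 := fun a ha => by
    have b1 := h₁.subset ha
    have b2 := h₂.subset ha
    rw [hZf a (by simp [b1])]
    simp [comp, b1, b2]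
  have hZX : ∀ a ∈ X₃, Z a = 0 := fun a ha => by
    refine M.eq_zero_of_mem_closure hZ (S := insert e₃ A) ?_
      (by rwa [h₃.closure_insert he₃ he₃A])
    rintro b (rfl | hb)
    exacts [hZ3, hZA b hb]
  have hZ1 : Z e₁ = -P e₁ := by
    rw [hZf e₁ (by simp [he₁])]
    simp [comp, he₁, n12]
  have hZ2 : Z e₂ = P e₂ := by
    rw [hZf e₂ (by simp [he₂, n21, p2])]
    simp [comp, n21, p2]
  have hfin := apply_mul_apply_eq (A := X₃) (e := e₁) (f := e₂) hZ hy₃ hZX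
    (fun a ha => indicator_of_notMem (by simpa) _)
    (by rw [h₃'.closure_insert (h₂'.subset he₂) n23]; exact h₁'.subset he₁)
    (by rw [h₃'.closure_insert (h₁'.subset he₁) n13]; exact h₂'.subset he₂)
  rw [hZ1, hZ2, indicator_of_mem (by exact n23), indicator_of_mem (by exact n13)] at hfin
  revert hfin p1 p2
  generalize P e₁ = x
  generalize P e₂ = y
  revert x y; decide

end OrientedMatroid

end

section

variable {α : Type u}

/-! ### Flags of a contraction -/

variable {M : Matroid α} {A B c : Set α}

theorem flagRes_cons_congr (M : Matroid α) {c c' : Set α} (h : c ∩ M.E = c' ∩ M.E)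
    (l : List (Set α)) : flagRes M (c :: l) = flagRes M (c' :: l) := by
  have key : ∀ (d : Set α) (N N' : Matroid α), N = N' →
      flagRes N l ∘ₗ (open Classical in if h : osIdeal M ≤ (osIdeal N).comap (contraction d) then
        (osIdeal M).mapQ (osIdeal N) (contraction d) h else 0) =
      flagRes N' l ∘ₗ (open Classical in if h : osIdeal M ≤ (osIdeal N').comap (contraction d) then
        (osIdeal M).mapQ (osIdeal N') (contraction d) h else 0) := by
    rintro d N _ rfl
    rfl
  rw [flagRes, flagRes, res, res, h]
  exact key _ _ _ (Matroid.contract_eq_contract_iff.2 h)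

theorem flagRes_congr (l l' : List (Set α)) : ∀ (M : Matroid α),
    List.Forall₂ (fun F F' => F ∩ M.E = F' ∩ M.E) l l' → flagRes M l = flagRes M l' := by
  induction l generalizing l' with
  | nil =>
    rintro M h
    cases h
    rfl
  | cons F l ih =>
    rintro M h
    cases h with
    | @cons _ F' _ l' h1 h2 =>
      rw [flagRes_cons_congr M h1]
      have : flagRes (M ／ F') l = flagRes (M ／ F') l' := ih l' _ (h2.imp fun G G' hG => by
        rw [Matroid.contract_ground, ← inter_sdiff_assoc, ← inter_sdiff_assoc, hG])
      rw [flagRes, flagRes, this]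

theorem flagRes_contract_map_union (M : Matroid α) (c : Set α) (l : List (Set α)) :
    flagRes (M ／ c) (l.map (c ∪ ·)) = flagRes (M ／ c) l := by
  refine flagRes_congr _ _ _ ?_
  rw [List.forall₂_map_left_iff, List.forall₂_same]
  intro F _
  ext e
  simp only [mem_inter_iff, mem_union, Matroid.contract_ground, mem_sdiff]
  tauto

theorem covers_contract_iff (hc : c ⊆ M.E) (hA : Disjoint c A) (hB : Disjoint c B) :
    Covers (M ／ c) A B ↔ Covers M (c ∪ A) (c ∪ B) := by
  have hflat : (M ／ c).IsFlat A ↔ M.IsFlat (c ∪ A) := by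
    rw [Matroid.isFlat_iff_closure_eq, Matroid.isFlat_iff_closure_eq, Matroid.contract_closure_eq,
      union_comm A c]
    constructor
    · intro h
      have hA' : A ⊆ M.E := by
        rw [← h]; exact sdiff_subset.trans (M.closure_subset_ground _)
      have : c ⊆ M.closure (c ∪ A) :=
        subset_union_left.trans (M.subset_closure _ (union_subset hc hA'))
      rw [← union_sdiff_cancel this, h]
    · intro h
      rw [h, union_sdiff_cancel_left]
      exact hA.le_bot
  rw [Covers, Covers, hflat]
  refine and_congr_right fun hfl => ?_
  have hcl : ∀ e, (M ／ c).closure (insert e A) = M.closure (insert e (c ∪ A)) \ c := by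
    intro e
    rw [Matroid.contract_closure_eq, insert_union, union_comm A c]
  constructor
  · rintro ⟨e, he, heA, rfl⟩
    refine ⟨e, he.1, fun h => h.elim he.2 heA, ?_⟩
    rw [hcl, union_sdiff_cancel]
    exact (subset_union_left.trans (subset_insert _ _)).trans
      (M.subset_closure _ (insert_subset he.1 hfl.subset_ground))
  · rintro ⟨e, he, heA, hB'⟩
    refine ⟨e, ⟨he, fun h => heA (Or.inl h)⟩, fun h => heA (Or.inr h), ?_⟩
    rw [hcl, ← hB', union_sdiff_cancel_left]
    exact hB.le_bot

theorem isDescFlag_contract_iff (hc : c ⊆ M.E) {t : List (Set α)} (ht : ∀ F ∈ t, Disjoint c F) :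
    IsDescFlag (M ／ c) ∅ t ↔ IsDescFlag M c (t.map (c ∪ ·)) := by
  induction t with
  | nil => rfl
  | cons H t ih =>
    have ht' : ∀ F ∈ t, Disjoint c F := fun F hF => ht F (List.mem_cons_of_mem _ hF)
    have hd : (t.map (c ∪ ·)).headD c = c ∪ t.headD ∅ := by cases t <;> simp
    rw [List.map_cons, IsDescFlag, IsDescFlag, ih ht', hd,
      covers_contract_iff hc ?_ (ht H (by simp))]
    cases t with
    | nil => simp
    | cons F t => exact ht' F (by simp)

theorem isTransversal_map_union_iff {t : List (Set α)} (ht : ∀ F ∈ t, Disjoint c F) {b : List α} :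
    IsTransversal c (t.map (c ∪ ·)) b ↔ IsTransversal ∅ t b := by
  induction t generalizing b with
  | nil => cases b <;> rfl
  | cons H t ih =>
    cases b with
    | nil => rfl
    | cons f b =>
      have ht' : ∀ F ∈ t, Disjoint c F := fun F hF => ht F (List.mem_cons_of_mem _ hF)
      have hd : (t.map (c ∪ ·)).headD c = c ∪ t.headD ∅ := by cases t <;> simp
      have hH := ht H (by simp)
      simp only [List.map_cons, IsTransversal, ih ht', hd, mem_union]
      have := fun h : f ∈ H => disjoint_right.1 hH h
      tauto

theorem IsTransversal.notMem_base {t : List (Set α)} {b : List α}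
    (ht : IsDescFlag M A t) (hb : IsTransversal A t b) : ∀ f ∈ b, f ∉ A := by
  induction t generalizing b with
  | nil => cases b with
    | nil => simp
    | cons f b => exact hb.elim
  | cons H t ih => cases b with
    | nil => simp
    | cons f b =>
      intro g hg
      rcases List.mem_cons.1 hg with rfl | hg
      · exact fun h => hb.2.1 (ht.2.base_subset_head h)
      · exact ih ht.2 hb.2.2 g hg

theorem IsTransversal.length_eq {t : List (Set α)} {b : List α} (hb : IsTransversal A t b) :
    b.length = t.length := by
  induction t generalizing b with
  | nil => cases b with
    | nil => rfl
    | cons f b => exact hb.elim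
  | cons H t ih => cases b with
    | nil => exact hb.elim
    | cons f b => rw [List.length_cons, List.length_cons, ih hb.2.2]

theorem IsTransversal.exists_of_append {p t : List (Set α)} {b : List α}
    (hb : IsTransversal A (p ++ t) b) : ∃ b₁ b₂, b = b₁ ++ b₂ ∧
      IsTransversal (t.headD A) p b₁ ∧ IsTransversal A t b₂ := by
  induction p generalizing b with
  | nil => exact ⟨[], b, rfl, trivial, hb⟩
  | cons H p ih => cases b with
    | nil => exact hb.elim
    | cons f b =>
      obtain ⟨b₁, b₂, rfl, h1, h2⟩ := ih hb.2.2
      exact ⟨f :: b₁, b₂, rfl, ⟨hb.1, (congrArg (f ∉ ·) (headD_append p t A)).mp hb.2.1, h1⟩, h2⟩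

namespace OrientedMatroid

variable {M : OrientedMatroid α} {P : α → SignType} {A B C : Set α}

/-! ### Canonical forms -/

open Classical in
/-- The residues of `Ω` along complete flags are the signs prescribed by `P` and the chirotope
for flags of faces of `P`, and vanish for the other flags. -/
def HasFlagSigns (M : OrientedMatroid α) (P : α → SignType) (Ω : OS M.toMatroid) : Prop :=
  ∀ t b, IsDescFlag M.toMatroid ∅ t → t.headD ∅ = M.toMatroid.E → IsTransversal ∅ t b →
    flagRes M.toMatroid t.reverse Ω =
      if ∀ F ∈ t, F ∈ M.faces P then ((M.sgn P b : SignType) : ℤ) else 0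

theorem IsFull.contract (hP : M.IsFull P) {c : Set α} (hc : c ∈ M.faces P) (b : List α)
    (hn : b.Nodup) (hb : M.toMatroid.IsBasis {e | e ∈ b} c) :
    (M.contract c b hn hb).IsFull (cᶜ.indicator P) := by
  refine ⟨⟨(hP.mem_faces_iff.1 hc).2, fun e he => indicator_of_notMem (by simpa) _⟩, ?_⟩
  intro e he
  rw [indicator_of_mem (by exact he.2)]
  exact hP.2 e he.1

theorem IsFull.mem_faces_contract_iff (hP : M.IsFull P) {c : Set α} (hc : c ∈ M.faces P)
    (b : List α) (hn : b.Nodup) (hb : M.toMatroid.IsBasis {e | e ∈ b} c) {F : Set α}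
    (hF : Disjoint c F) :
    F ∈ (M.contract c b hn hb).faces (cᶜ.indicator P) ↔ c ∪ F ∈ M.faces P := by
  rw [(hP.contract hc b hn hb).mem_faces_iff, hP.mem_faces_iff, indicator_indicator,
    compl_union, inter_comm Fᶜ]
  have hcE := (hP.mem_faces_iff.1 hc).1
  have h1 : F ⊆ (M.contract c b hn hb).toMatroid.E ↔ c ∪ F ⊆ M.toMatroid.E := by
    constructor
    · exact fun h => union_subset hcE fun e he => (h he).1
    · exact fun h e he => ⟨h (Or.inr he), disjoint_right.1 hF he⟩
  rw [h1]
  refine and_congr_right fun _ => ⟨fun h => h.1, fun h => ⟨h, fun e he => ?_⟩⟩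
  exact indicator_of_notMem (fun h' => h'.1 he) _

theorem eRank_eq_length_of_isBase [Finite α] {N : Matroid α} {l : List α} (hn : l.Nodup)
    (hl : N.IsBase {e | e ∈ l}) : N.eRank = l.length := by
  classical
  have : {e | e ∈ l} = (l.toFinset : Set α) := by ext; simp
  rw [← hl.encard_eq_eRank, this, encard_coe_eq_coe_finsetCard, List.toFinset_card_of_nodup hn]

theorem eRank_contract [Finite α] {n : ℕ} (hr : M.toMatroid.eRank = (n + 1 : ℕ)) {c : Set α}
    {e : α} (he : M.toMatroid.IsBasis {x | x ∈ [e]} c) : (M.toMatroid ／ c).eRank = n := by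
  obtain ⟨l, hl, hlb⟩ := exists_ordered_base (M.toMatroid ／ c)
  have h1 := ((M.contract c [e] (by simp) he).chirotope_ne_zero_iff l).2 ⟨hl, hlb⟩
  have h2 := (M.chirotope_ne_zero_iff (l ++ [e])).1 h1
  rw [eRank_eq_length_of_isBase h2.1 h2.2, List.length_append, List.length_singleton] at hr
  rw [eRank_eq_length_of_isBase hl hlb]
  have : l.length + 1 = n + 1 := by exact_mod_cast hr
  rw [Nat.succ_injective this]

/-- The members of a flag above `c` are the unions of `c` with sets that are disjoint from `c`. -/
theorem exists_map_union_of_isDescFlag {N : Matroid α} {c : Set α} {t : List (Set α)}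
    (ht : IsDescFlag N c t) : ∃ s : List (Set α), (∀ F ∈ s, Disjoint c F) ∧ t = s.map (c ∪ ·) := by
  refine ⟨t.map (· \ c), ?_, ?_⟩
  · intro F hF
    obtain ⟨G, -, rfl⟩ := List.mem_map.1 hF
    exact disjoint_sdiff_right
  · rw [List.map_map]
    conv_lhs => rw [← List.map_id t]
    refine List.map_congr_left fun F hF => ?_
    exact (union_sdiff_cancel (ht.base_subset F hF)).symm

theorem sgn_contract {c : Set α} {e : α} (he : M.toMatroid.IsBasis {x | x ∈ [e]} c) {b : List α}
    (hb : ∀ f ∈ b, f ∉ c) :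
    (M.contract c [e] (by simp) he).sgn (cᶜ.indicator P) b * P e = M.sgn P (b ++ [e]) := by
  have : b.map (cᶜ.indicator P) = b.map P :=
    List.map_congr_left fun f hf => indicator_of_mem (show f ∈ cᶜ from hb f hf) _
  rw [sgn, sgn, this]
  simp [OrientedMatroid.contract, mul_assoc]

theorem intCast_mul_self {s : SignType} (h : s ≠ 0) : ((s : ℤ)) * (s : ℤ) = 1 := by
  revert h s; decide

/-- If `Ω'` is the residue of `Ω` at the atom `c`, up to the sign `P(e)`, then the prescribed value
of the residue of `Ω` along a flag through `c` amounts to the prescribed value for `Ω'` along the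
flag of `M/c`. -/
theorem IsFull.flagRes_eq_iff_contract [M.toMatroid.Loopless] (hP : M.IsFull P) {c : Set α}
    (hc : c ∈ M.faces P) {e : α} (he : M.toMatroid.IsBasis {x | x ∈ [e]} c)
    {Ω : OS M.toMatroid} {Ω' : OS (M.toMatroid ／ c)}
    (hΩ : res M.toMatroid c Ω = ((P e : SignType) : ℤ) • Ω') {s : List (Set α)}
    (hs : ∀ F ∈ s, Disjoint c F) (b : List α) (hb : ∀ f ∈ b, f ∉ c) :
    open Classical in
    (flagRes M.toMatroid (s.map (c ∪ ·) ++ [c]).reverse Ω =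
      if ∀ F ∈ s.map (c ∪ ·) ++ [c], F ∈ M.faces P then ((M.sgn P (b ++ [e]) : SignType) : ℤ)
      else 0) ↔
    (flagRes (M.toMatroid ／ c) s.reverse Ω' =
      if ∀ F ∈ s, F ∈ (M.contract c [e] (by simp) he).faces (cᶜ.indicator P) then
        (((M.contract c [e] (by simp) he).sgn (cᶜ.indicator P) b : SignType) : ℤ) else 0) := by
  have hPe : P e ≠ 0 := hP.2 e (he.subset_ground (he.subset (by simp)))
  have h1 : flagRes M.toMatroid (s.map (c ∪ ·) ++ [c]).reverse Ω =
      ((P e : SignType) : ℤ) * flagRes (M.toMatroid ／ c) s.reverse Ω' := by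
    rw [List.reverse_append, List.reverse_singleton, List.singleton_append, flagRes,
      LinearMap.comp_apply, hΩ, map_smul, ← List.map_reverse, flagRes_contract_map_union,
      smul_eq_mul]
  have h2 : (∀ F ∈ s.map (c ∪ ·) ++ [c], F ∈ M.faces P) ↔
      ∀ F ∈ s, F ∈ (M.contract c [e] (by simp) he).faces (cᶜ.indicator P) := by
    constructor
    · intro h F hF
      rw [hP.mem_faces_contract_iff hc _ _ _ (hs F hF)]
      exact h _ (List.mem_append_left _ (List.mem_map_of_mem hF))
    · intro h F hF
      rcases List.mem_append.1 hF with hF | hF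
      · obtain ⟨G, hG, rfl⟩ := List.mem_map.1 hF
        rw [← hP.mem_faces_contract_iff hc _ _ _ (hs G hG)]
        exact h G hG
      · rw [List.mem_singleton.1 hF]; exact hc
  have h3 := intCast_mul_self hPe
  have hne : ((P e : SignType) : ℤ) ≠ 0 := fun h => by rw [h] at h3; simp at h3
  rw [h1, ← sgn_contract he hb]
  by_cases hF : ∀ F ∈ s, F ∈ (M.contract c [e] (by simp) he).faces (cᶜ.indicator P)
  · rw [if_pos hF, if_pos (h2.2 hF), SignType.coe_mul, mul_comm _ ((P e : SignType) : ℤ)]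
    exact mul_right_inj' hne
  · rw [if_neg hF, if_neg fun h => hF (h2.1 h)]
    simp [hne]

theorem covers_empty_of_isBasis_singleton {N : Matroid α} {c : Set α} (hc : N.IsFlat c) {e : α}
    (he : N.IsBasis {e} c) [N.Loopless] : Covers N ∅ c := by
  refine ⟨isFlat_empty, e, he.subset_ground (he.subset rfl), by simp, ?_⟩
  rw [insert_empty_eq, he.closure_eq_closure, hc.closure]

/-- The canonical form of a tope is characterized by its residues along complete flags. -/
theorem IsFull.isCanonicalForm_iff [Finite α] (n : ℕ) : ∀ (M : OrientedMatroid α)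
    [M.toMatroid.Loopless] {P : α → SignType}, M.IsFull P → M.toMatroid.eRank = n →
    ∀ Ω, IsCanonicalForm n M P Ω ↔ Ω ∈ OS.degree M.toMatroid n ∧ M.HasFlagSigns P Ω := by
  induction n with
  | zero =>
    intro M _ P hP hr Ω
    have hnil : ∀ t, IsDescFlag M.toMatroid ∅ t → t.headD ∅ = M.toMatroid.E → t = [] := by
      intro t ht hE
      have := ht.length_eq
      rw [hE, Matroid.eRk_ground, hr] at this
      exact List.eq_nil_of_length_eq_zero (by exact_mod_cast this.symm)
    have hdeg : ((M.chirotope [] : SignType) : ℤ) • (osIdeal M.toMatroid).mkQ 1 ∈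
        OS.degree M.toMatroid 0 := by
      have := monomial_mem_degree (M := M.toMatroid) []
      exact Submodule.smul_mem _ _ (by simpa [monomial] using this)
    have hval : flagRes M.toMatroid [] (((M.chirotope [] : SignType) : ℤ) •
        (osIdeal M.toMatroid).mkQ 1) = ((M.chirotope [] : SignType) : ℤ) := by
      rw [flagRes, map_smul, coeff_mk, map_one, smul_eq_mul, mul_one]
    constructor
    · rintro rfl
      refine ⟨hdeg, fun t b ht hE hb => ?_⟩
      obtain rfl := hnil t ht hE
      cases b with
      | cons f b => exact hb.elim
      | nil =>
        rw [List.reverse_nil, hval]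
        simp [sgn]
    · rintro ⟨h1, h2⟩
      rw [IsCanonicalForm, ← sub_eq_zero]
      refine eq_zero_of_flagRes_eq_zero hr (sub_mem h1 hdeg) fun t ht hE => ?_
      have h3 := h2
      obtain rfl := hnil t ht hE
      have := h2 [] [] ht hE trivial
      rw [List.reverse_nil] at this ⊢
      rw [map_sub, hval, this]
      simp [sgn]
  | succ n ih =>
    intro M _ P hP hr Ω
    have hE : ∀ {c : Set α} (s : List (Set α)), c ⊆ M.toMatroid.E → (∀ F ∈ s, Disjoint c F) →
        ((s.map (c ∪ ·) ++ [c]).headD ∅ = M.toMatroid.E ↔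
          s.headD ∅ = (M.toMatroid ／ c).E) := by
      intro c s hc hs
      have : (s.map (c ∪ ·) ++ [c]).headD ∅ = c ∪ s.headD ∅ := by cases s <;> simp
      rw [this, Matroid.contract_ground]
      have hd : Disjoint c (s.headD ∅) := by
        cases s with
        | nil => simp
        | cons F s => exact hs F (by simp)
      constructor
      · rintro h
        rw [← h, union_sdiff_cancel_left]
        exact hd.le_bot
      · rintro h
        rw [h, union_sdiff_cancel hc]
    constructor
    · rintro ⟨hdeg, hΩ⟩
      refine ⟨hdeg, fun t b ht htE hb => ?_⟩
      obtain rfl | ⟨t₀, c, rfl⟩ := t.eq_nil_or_concat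
      · have := ht.length_eq
        rw [htE, Matroid.eRk_ground, hr] at this
        simp at this
      rw [List.concat_eq_append] at ht htE hb ⊢
      obtain ⟨ht₀, hcov, -⟩ := isDescFlag_append.1 ht
      replace hcov : Covers M.toMatroid ∅ c := hcov
      obtain ⟨b₀, b₁, rfl, hb₀, hb₁⟩ := hb.exists_of_append
      obtain ⟨e, rfl⟩ : ∃ e, b₁ = [e] := List.length_eq_one_iff.1 hb₁.length_eq
      have hcl : M.toMatroid.closure {e} = c := by
        rw [← hcov.closure_insert hb₁.1 (by simp), insert_empty_eq]
      have hind : M.toMatroid.Indep {e} :=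
        (M.toMatroid.isNonloop_of_loopless (hcov.isFlat_right.subset_ground hb₁.1)).indep
      have hbas : M.toMatroid.IsBasis {e} c := hcl ▸ hind.isBasis_closure
      have hΩc := hΩ c hcov.isFlat_right e hbas
      by_cases hc : c ∈ M.faces P
      · obtain ⟨Ω', hΩ', hres⟩ := hΩc.1 hc
        obtain ⟨s, hs, rfl⟩ := exists_map_union_of_isDescFlag ht₀
        have hcE := hcov.isFlat_right.subset_ground
        have hbas' : M.toMatroid.IsBasis {x | x ∈ [e]} c := by simpa using hbas
        have : (M.contract c [e] (by simp) hbas').toMatroid.Loopless :=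
          loopless_contract hcov.isFlat_right
        have hc0 := ((ih (M.contract c [e] (List.nodup_singleton e) hbas') (hP.contract hc _ _ _)
          (eRank_contract hr hbas') Ω').1 hΩ').2
        refine (hP.flagRes_eq_iff_contract hc hbas' hres hs b₀ (hb₀.notMem_base ht₀)).2 ?_
        exact hc0 s b₀ ((isDescFlag_contract_iff hcE hs).2 ht₀) ((hE s hcE hs).1 htE)
          ((isTransversal_map_union_iff hs).1 hb₀)
      · rw [if_neg fun h => hc (h c (by simp)), List.reverse_append, List.reverse_singleton,
          List.singleton_append, flagRes, LinearMap.comp_apply, hΩc.2 hc, map_zero]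
    · rintro ⟨hdeg, hΩ⟩
      refine ⟨hdeg, fun c hcf e hbas => ?_⟩
      have hcov := covers_empty_of_isBasis_singleton hcf hbas
      have hcE := hcf.subset_ground
      have hbas' : M.toMatroid.IsBasis {x | x ∈ [e]} c := by simpa using hbas
      have hl : (M.toMatroid ／ c).Loopless := loopless_contract hcf
      have hr1 : M.toMatroid.eRk (c ∩ M.toMatroid.E) = 1 := by
        rw [inter_eq_self_of_subset_left hcE, hcov.eRk_eq, Matroid.eRk_empty, zero_add]
      have hdeg' := res_mem_degree hr1 hdeg
      have hflag : ∀ s, IsDescFlag (M.toMatroid ／ c) ∅ s → s.headD ∅ = (M.toMatroid ／ c).E →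
          (∀ F ∈ s, Disjoint c F) ∧ IsDescFlag M.toMatroid ∅ (s.map (c ∪ ·) ++ [c]) ∧
          (s.map (c ∪ ·) ++ [c]).headD ∅ = M.toMatroid.E := by
        intro s hs hsE
        have hd : ∀ F ∈ s, Disjoint c F := fun F hF =>
          disjoint_right.2 fun x hx => ((hs.isFlat F hF).subset_ground hx).2
        exact ⟨hd, isDescFlag_append.2 ⟨(isDescFlag_contract_iff hcE hd).1 hs, hcov, trivial⟩,
          (hE s hcE hd).2 hsE⟩
      constructor
      · intro hc
        have hPe : P e ≠ 0 := hP.2 e (hcE (hbas.subset rfl))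
        have hres : res M.toMatroid c Ω = ((P e : SignType) : ℤ) •
            (((P e : SignType) : ℤ) • res M.toMatroid c Ω) := by
          rw [smul_smul, intCast_mul_self hPe, one_smul]
        refine ⟨_, ?_, hres⟩
        have : (M.contract c [e] (by simp) hbas').toMatroid.Loopless := hl
        refine (ih (M.contract c [e] (List.nodup_singleton e) hbas') (hP.contract hc _ _ _)
          (eRank_contract hr hbas') _).2 ⟨Submodule.smul_mem _ _ hdeg', fun s b hs hsE hb => ?_⟩
        obtain ⟨hd, hf1, hf2⟩ := hflag s hs hsE
        have hb' := (isTransversal_map_union_iff hd).2 hb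
        refine (hP.flagRes_eq_iff_contract hc hbas' hres hd b
          (hb'.notMem_base (isDescFlag_append.1 hf1).1)).1 ?_
        exact hΩ _ _ hf1 hf2 (IsTransversal.append (t := [c]) (b := [e])
          ⟨hbas.subset rfl, by simp, trivial⟩ hb')
      · intro hc
        refine eq_zero_of_flagRes_eq_zero (eRank_contract hr hbas') hdeg' fun s hs hsE => ?_
        obtain ⟨hd, hf1, hf2⟩ := hflag s hs hsE
        obtain ⟨b, hb⟩ := hf1.exists_isTransversal
        have h1 := hΩ _ _ hf1 hf2 hb
        rw [if_neg fun h => hc (h c (by simp)), List.reverse_append, List.reverse_singleton,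
          List.singleton_append, flagRes, LinearMap.comp_apply, ← List.map_reverse,
          flagRes_contract_map_union] at h1
        exact h1

/-- Every tope of a loopless oriented matroid has a canonical form: the signs along flags of faces
satisfy the gap relations by the diamond property and the antisymmetry of the chirotope. -/
theorem IsFull.exists_isCanonicalForm [Finite α] [M.toMatroid.Loopless] (hP : M.IsFull P) {n : ℕ}
    (hr : M.toMatroid.eRank = n) : ∃ Ω, IsCanonicalForm n M P Ω := by
  classical
  let φ : List (Set α) → ℤ := fun t => if ∀ F ∈ t, F ∈ M.faces P then
    (if h : ∃ b, IsTransversal ∅ t b then ((M.sgn P h.choose : SignType) : ℤ) else 0) else 0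
  have hφ : ∀ t b, IsDescFlag M.toMatroid ∅ t → IsTransversal ∅ t b →
      φ t = if ∀ F ∈ t, F ∈ M.faces P then ((M.sgn P b : SignType) : ℤ) else 0 := by
    intro t b ht hb
    have h : ∃ b, IsTransversal ∅ t b := ⟨b, hb⟩
    by_cases hf : ∀ F ∈ t, F ∈ M.faces P
    · simp only [φ, if_pos hf, dif_pos h]
      rw [show M.sgn P h.choose = M.sgn P b from hP.sgn_eq ht hf [] h.choose_spec hb]
    · simp only [φ, if_neg hf]
  obtain ⟨Ω, hΩ, hres⟩ := exists_flagRes_eq hr φ (by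
    intro p B X q hfl hE S hS
    have hflag : ∀ Y ∈ S, IsDescFlag M.toMatroid ∅ (p ++ B :: Y :: q) := fun Y hY =>
      isDescFlag_append.2 ⟨(isDescFlag_append.1 hfl).1, ((hS Y).1 hY).2, ((hS Y).1 hY).1,
        (isDescFlag_append.1 hfl).2.2.2⟩
    by_cases hf : ∀ F ∈ p ++ B :: q, F ∈ M.faces P
    · have h2 := (isDescFlag_append.1 hfl).2
      have hB : B ∈ M.faces P := hf B (by simp)
      have hq : ∀ F ∈ q, F ∈ M.faces P := fun F hF => hf F (by simp [hF])
      obtain ⟨X₁, hX₁, X₂, hX₂, hne, h₁, h₂, huniq⟩ :=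
        hP.exists_diamond (hP.headD_mem_faces hq) hB h2.2.1 h2.1
      have hsub : ({X₁, X₂} : Finset (Set α)) ⊆ S := by
        intro Y hY
        rcases Finset.mem_insert.1 hY with rfl | hY
        · exact (hS _).2 h₁
        · rw [Finset.mem_singleton.1 hY]; exact (hS _).2 h₂
      rw [← Finset.sum_subset hsub, Finset.sum_pair hne]
      · obtain ⟨f₁, hf₁, hf₁A⟩ := h₁.1.exists_mem
        obtain ⟨f₂, hf₂, hf₂A⟩ := h₂.1.exists_mem
        have hint := h₁.1.inter_eq h₂.1 hne
        have h12 : f₁ ∉ X₂ := fun h => hf₁A (hint ▸ ⟨hf₁, h⟩)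
        have h21 : f₂ ∉ X₁ := fun h => hf₂A (hint ▸ ⟨h, hf₂⟩)
        obtain ⟨bp, hbp⟩ := (isDescFlag_append.1 hfl).1.exists_isTransversal
        obtain ⟨bq, hbq⟩ := h2.2.2.exists_isTransversal
        have hall : ∀ Y ∈ M.faces P, ∀ F ∈ p ++ B :: Y :: q, F ∈ M.faces P := by
          intro Y hY F hF
          simp only [List.mem_append, List.mem_cons] at hF
          rcases hF with hF | rfl | rfl | hF
          · exact hf F (by simp [hF])
          · exact hB
          · exact hY
          · exact hq F hF
        have t₁ : IsTransversal ∅ (p ++ B :: X₁ :: q) (bp ++ f₂ :: f₁ :: bq) :=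
          IsTransversal.append (t := B :: X₁ :: q) (b := f₂ :: f₁ :: bq)
            ⟨h₂.2.subset hf₂, h21, hf₁, hf₁A, hbq⟩ hbp
        have t₂ : IsTransversal ∅ (p ++ B :: X₂ :: q) (bp ++ f₁ :: f₂ :: bq) :=
          IsTransversal.append (t := B :: X₂ :: q) (b := f₁ :: f₂ :: bq)
            ⟨h₁.2.subset hf₁, h12, hf₂, hf₂A, hbq⟩ hbp
        rw [hφ _ _ (hflag X₁ ((hS _).2 h₁)) t₁, hφ _ _ (hflag X₂ ((hS _).2 h₂)) t₂,
          if_pos (hall X₁ hX₁), if_pos (hall X₂ hX₂), sgn_swap]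
        have : ∀ s : SignType, (((-s : SignType) : ℤ)) + (s : ℤ) = 0 := by decide
        exact this _
      · intro Y hY hYn
        simp only [φ]
        rw [if_neg]
        intro h
        refine hYn ?_
        have := huniq Y (h Y (by simp)) ((hS Y).1 hY).1 ((hS Y).1 hY).2
        simpa using this
    · refine Finset.sum_eq_zero fun Y _ => ?_
      simp only [φ]
      rw [if_neg]
      intro h
      refine hf fun F hF => h F ?_
      simp only [List.mem_append, List.mem_cons] at hF ⊢
      tauto)
  refine ⟨Ω, (hP.isCanonicalForm_iff n M hr Ω).2 ⟨hΩ, fun t b ht hE hb => ?_⟩⟩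
  rw [hres t ht hE, hφ t b ht hb]

theorem cast_rank [Finite α] (N : Matroid α) : N.eRank = (rank N : ℕ) := by
  rw [rank, ENat.natCast_toNat]
  rw [Matroid.eRank_ne_top_iff]
  infer_instance

theorem IsFull.hasFlagSigns_canonicalForm [Finite α] [M.toMatroid.Loopless] (hP : M.IsFull P) :
    M.HasFlagSigns P (M.canonicalForm P) := by
  have h := Classical.epsilon_spec (hP.exists_isCanonicalForm (cast_rank M.toMatroid))
  exact ((hP.isCanonicalForm_iff _ M (cast_rank M.toMatroid) _).1 h).2

end OrientedMatroid

end

section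

variable {α : Type u}

/-! ### Amplitudes as sums over flags of faces -/

variable {M : Matroid α} {A B C : Set α}

/-- The saturated flags of flats in `L` from the set of loops to `G`, listed downwards from
`G`. -/
def flagsIn (M : Matroid α) (L : Set (Set α)) (G : Set α) : Set (List (Set α)) :=
  {t | IsDescFlag M ∅ t ∧ t.headD ∅ = G ∧ ∀ F ∈ t, F ∈ L}

theorem finite_flagsIn [Finite α] (M : Matroid α) (L : Set (Set α)) (G : Set α) :
    (flagsIn M L G).Finite := by
  refine (List.finite_length_le (Set α) (M.eRk G).toNat).subset ?_
  rintro t ⟨ht, rfl, -⟩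
  have h1 := ht.eRk_head
  have h2 : M.eRk (t.headD ∅) ≠ ⊤ := by
    rw [Matroid.eRk_ne_top_iff]
    exact M.isRkFinite_of_finite (toFinite _)
  have h3 : ((t.length : ℕ) : ℕ∞) ≤ M.eRk (t.headD ∅) := by rw [h1]; exact le_add_self
  rw [← ENat.natCast_toNat h2] at h3
  exact_mod_cast h3

/-- The sum over the flags in `L` from the set of loops to `G` of the products of the inverse
weights of the members below `G`. -/
def flagSum [Finite α] {K : Type*} [Field K] (M : Matroid α) (L : Set (Set α)) (w : Set α → K)
    (G : Set α) : K :=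
  ∑ t ∈ (finite_flagsIn M L G).toFinset, (t.tail.map fun F => (w F)⁻¹).prod

theorem reverse_ofFn_succ {β : Type*} {k : ℕ} (F : Fin (k + 1) → β) :
    (List.ofFn F).reverse =
      F (Fin.last k) :: (List.ofFn fun i : Fin k => F i.castSucc).reverse := by
  rw [List.ofFn_succ', List.concat_eq_append, List.reverse_append]
  rfl

/-- A flag indexed by `Fin k` is the same as a list of `k` flats, each of which covers the
next. -/
theorem isFlag_iff [Finite α] [M.Loopless] {k : ℕ} (F : Fin k → Set α) :
    IsFlag M k F ↔ IsDescFlag M ∅ (List.ofFn F).reverse := by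
  induction k with
  | zero => simp [IsFlag, IsDescFlag, StrictMono]
  | succ k ih =>
    rw [reverse_ofFn_succ, IsDescFlag, ← ih]
    have hrk : IsFlag M k (fun i => F i.castSucc) →
        M.eRk ((List.ofFn fun i : Fin k => F i.castSucc).reverse.headD ∅) = k ∧
        M.IsFlat ((List.ofFn fun i : Fin k => F i.castSucc).reverse.headD ∅) := by
      intro h
      have := (ih _).1 h
      exact ⟨by rw [this.length_eq]; simp, this.isFlat_head isFlat_empty⟩
    have hlast : ∀ X : Set α, IsFlag M k (fun i => F i.castSucc) →
        ((List.ofFn fun i : Fin k => F i.castSucc).reverse.headD ∅ ⊆ X ↔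
          ∀ i : Fin k, F i.castSucc ⊆ X) := by
      intro X h
      have hd := (ih _).1 h
      constructor
      · intro hX i
        refine (hd.subset_head _ ?_).trans hX
        simp
      · intro hX
        cases k with
        | zero => simp
        | succ k => rw [reverse_ofFn_succ]; exact hX (Fin.last k)
    constructor
    · rintro ⟨hm, hF⟩
      have h1 : IsFlag M k (fun i => F i.castSucc) :=
        ⟨fun i j hij => hm (Fin.castSucc_lt_castSucc_iff.2 hij), fun i => hF i.castSucc⟩
      refine ⟨?_, h1⟩
      obtain ⟨h2, h3⟩ := hrk h1
      have h4 := hF (Fin.last k)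
      have h5 : M.eRk (F (Fin.last k)) =
          M.eRk ((List.ofFn fun i : Fin k => F i.castSucc).reverse.headD ∅) + 1 := by
        rw [h4.2, h2]; simp
      refine covers_of_eRk_eq h3 h4.1 (LE.le.ssubset_of_ne ((hlast _ h1).2 fun i =>
        (hm (Fin.castSucc_lt_last i)).le) fun heq => ?_) h5
      rw [← heq, h2] at h5
      have : k = k + 1 := by exact_mod_cast h5
      lia
    · rintro ⟨hc, h1⟩
      obtain ⟨h2, h3⟩ := hrk h1
      refine ⟨fun i j hij => ?_, fun i => ?_⟩
      · induction j using Fin.lastCases with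
        | cast j =>
          induction i using Fin.lastCases with
          | cast i => exact h1.1 (Fin.castSucc_lt_castSucc_iff.1 hij)
          | last => exact absurd hij (not_lt.2 (Fin.le_last _))
        | last =>
          induction i using Fin.lastCases with
          | cast i =>
            refine ssubset_of_subset_of_ssubset ((hlast _ h1).1 subset_rfl i) ?_
            obtain ⟨e, he, he'⟩ := hc.exists_mem
            exact ssubset_iff_exists.2 ⟨hc.subset, e, he, he'⟩
          | last => exact absurd hij (lt_irrefl _)
      · induction i using Fin.lastCases with
        | cast i => exact h1.2 i
        | last =>
          refine ⟨hc.isFlat_right, ?_⟩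
          rw [hc.eRk_eq, h2]
          simp

theorem IsDescFlag.head_eq_ground_iff [Finite α] [M.Loopless] {k : ℕ} (hk : M.eRank = k)
    {t : List (Set α)} (ht : IsDescFlag M ∅ t) : t.headD ∅ = M.E ↔ t.length = k := by
  have h1 := ht.length_eq
  constructor
  · intro h
    rw [h, Matroid.eRk_ground, hk] at h1
    exact_mod_cast h1.symm
  · intro h
    have hf := ht.isFlat_head isFlat_empty
    have := Matroid.IsRkFinite.closure_eq_closure_of_subset_of_eRk_ge_eRk
      (M.isRkFinite_of_finite (toFinite (t.headD ∅))) hf.subset_ground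
      (by rw [Matroid.eRk_ground, hk, h1, h])
    rwa [hf.closure, M.closure_ground] at this

namespace OrientedMatroid

variable {M : OrientedMatroid α} {P : α → SignType} {A B C : Set α}

theorem IsFull.sgn_ne_zero [Finite α] [M.toMatroid.Loopless] (hP : M.IsFull P)
    {t : List (Set α)} {b : List α} (ht : IsDescFlag M.toMatroid ∅ t)
    (hE : t.headD ∅ = M.toMatroid.E) (hb : IsTransversal ∅ t b) : M.sgn P b ≠ 0 := by
  obtain ⟨h1, h2, h3⟩ := IsTransversal.nodup_and_indep_and_closure_eq ht hb
  have hbase : M.toMatroid.IsBase {e | e ∈ b} :=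
    Matroid.isBase_iff_indep_closure_eq.2 ⟨h2, h3.trans hE⟩
  have hprod : ∀ l : List α, (∀ e ∈ l, P e ≠ 0) → (l.map P).prod ≠ 0 := by
    intro l hl
    induction l with
    | nil => simp
    | cons e l ih =>
      rw [List.map_cons, List.prod_cons]
      exact mul_ne_zero (hl e (by simp)) (ih fun f hf => hl f (by simp [hf]))
  exact mul_ne_zero ((M.chirotope_ne_zero_iff _).2 ⟨h1, hbase⟩)
    (hprod b fun e he => hP.2 e (hbase.subset_ground he))

/-- The amplitude of a tope is the sum over the complete flags of faces of the products of the
inverse linear forms, since the residues of the canonical form along these flags are signs and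
the other residues vanish. -/
theorem IsFull.deRhamForm_eq_flagSum [Fintype α] [M.toMatroid.Loopless] (hP : M.IsFull P)
    {K : Type*} [Field K] (w : Set α → K) :
    deRhamForm M.toMatroid w (rank M.toMatroid) (M.canonicalForm P) (M.canonicalForm P) =
      flagSum M.toMatroid (M.faces P) w M.toMatroid.E := by
  classical
  have hΩ := hP.hasFlagSigns_canonicalForm
  generalize M.canonicalForm P = Ω at hΩ
  have hk := cast_rank M.toMatroid
  generalize rank M.toMatroid = k at hk
  rw [deRhamForm, flagSum]
  have hterm : ∀ F : Fin k → Set α, IsFlag M.toMatroid k F →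
      (flagRes M.toMatroid (List.ofFn F) Ω : K) *
        (∏ i : Fin k, if (i : ℕ) + 1 < k then (w (F i))⁻¹ else 1) *
        (flagRes M.toMatroid (List.ofFn F) Ω : K) =
      if ∀ G ∈ (List.ofFn F).reverse, G ∈ M.faces P then
        ((List.ofFn F).reverse.tail.map fun F => (w F)⁻¹).prod else 0 := by
    intro F hF
    have ht := (isFlag_iff F).1 hF
    have hE := (ht.head_eq_ground_iff hk).2 (by simp)
    obtain ⟨b, hb⟩ := ht.exists_isTransversal
    have h1 := hΩ _ b ht hE hb
    rw [List.reverse_reverse] at h1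
    have hw : (∏ i : Fin k, if (i : ℕ) + 1 < k then (w (F i))⁻¹ else 1) =
        ((List.ofFn F).reverse.tail.map fun F => (w F)⁻¹).prod := by
      cases k with
      | zero => simp
      | succ k =>
        rw [reverse_ofFn_succ, List.tail_cons, List.map_reverse, List.prod_reverse, List.map_ofFn,
          List.prod_ofFn, Fin.prod_univ_castSucc]
        simp
    rw [h1, hw]
    split_ifs with h
    · have h2 := intCast_mul_self (hP.sgn_ne_zero ht hE hb)
      rw [mul_right_comm, ← Int.cast_mul, h2, Int.cast_one, one_mul]
    · simp
  rw [← Finset.sum_filter, Finset.sum_congr rfl fun F hF => hterm F (Finset.mem_filter.1 hF).2,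
    ← Finset.sum_filter, Finset.filter_filter]
  refine Finset.sum_bij (fun F _ => (List.ofFn F).reverse) ?_ ?_ ?_ ?_
  · intro F hF
    obtain ⟨h1, h2⟩ := (Finset.mem_filter.1 hF).2
    have ht := (isFlag_iff F).1 h1
    exact (Set.Finite.mem_toFinset _).2 ⟨ht, (ht.head_eq_ground_iff hk).2 (by simp), h2⟩
  · intro F _ F' _ h
    exact List.ofFn_injective (List.reverse_injective h)
  · intro t ht
    obtain ⟨h1, h2, h3⟩ := (Set.Finite.mem_toFinset _).1 ht
    have hlen := (h1.head_eq_ground_iff hk).1 h2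
    obtain ⟨F, hF⟩ : ∃ F : Fin k → Set α, List.ofFn F = t.reverse := by
      rw [← List.length_reverse] at hlen
      subst hlen
      exact ⟨t.reverse.get, List.ofFn_get _⟩
    have hF' : (List.ofFn F).reverse = t := by rw [hF, List.reverse_reverse]
    refine ⟨F, ?_, hF'⟩
    rw [Finset.mem_filter]
    refine ⟨Finset.mem_univ _, (isFlag_iff F).2 (hF'.symm ▸ h1), hF'.symm ▸ h3⟩
  · intro F hF
    rfl

theorem IsFull.amplitude_eq [Fintype α] [M.toMatroid.Loopless] (hP : M.IsFull P) :
    M.amplitude P = flagSum M.toMatroid (M.faces P)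
      (fun S => algebraMap (R₀ M.toMatroid.E) (Q₀ M.toMatroid.E) (aForm M.toMatroid.E S))
      M.toMatroid.E :=
  hP.deRhamForm_eq_flagSum _

end OrientedMatroid

end

section

variable {α : Type u}

/-! ### Recursion for sums over flags -/

variable {M : Matroid α} {L : Set (Set α)} {A B C E₁ E₂ : Set α}

/-- The members of `L` that are covered by `G`. -/
def lowerIn (M : Matroid α) (L : Set (Set α)) (G : Set α) : Set (Set α) :=
  {K | K ∈ L ∧ Covers M K G}

theorem sum_flagsIn_eq [Finite α] {K : Type*} [AddCommMonoid K] {G : Set α} (hL : ∅ ∈ L)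
    (hG : G ∈ L) (hne : G.Nonempty) (f : List (Set α) → K) :
    ∑ t ∈ (finite_flagsIn M L G).toFinset, f t =
      ∑ H ∈ (toFinite (lowerIn M L G)).toFinset,
        ∑ t ∈ (finite_flagsIn M L H).toFinset, f (G :: t) := by
  classical
  rw [Finset.sum_sigma']
  symm
  refine Finset.sum_bij (fun x _ => G :: x.2) ?_ ?_ ?_ ?_
  · rintro ⟨H, t⟩ h
    simp only [Finset.mem_sigma, Finite.mem_toFinset] at h ⊢
    obtain ⟨⟨hHL, hc⟩, ht, rfl, htL⟩ := h
    exact ⟨⟨hc, ht⟩, rfl, by simpa [hG] using htL⟩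
  · rintro ⟨H, t⟩ h ⟨H', t'⟩ h' heq
    simp only [Finset.mem_sigma, Finite.mem_toFinset] at h h'
    obtain rfl := (List.cons.inj heq).2
    obtain rfl := h.2.2.1.symm.trans h'.2.2.1
    rfl
  · intro t ht
    obtain ⟨h1, h2, h3⟩ := (Finite.mem_toFinset _).1 ht
    cases t with
    | nil => rw [← h2] at hne; simp at hne
    | cons H s =>
      obtain rfl : H = G := h2
      refine ⟨⟨s.headD ∅, s⟩, ?_, rfl⟩
      simp only [Finset.mem_sigma, Finite.mem_toFinset]
      refine ⟨⟨?_, h1.1⟩, h1.2, rfl, fun F hF => h3 F (List.mem_cons_of_mem _ hF)⟩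
      cases s with
      | nil => exact hL
      | cons F s => exact h3 F (by simp)
  · intro x _
    rfl

/-- The sum over the flags in `L` from the set of loops to `G` of the products of the inverse
weights of all members. -/
def fullFlagSum [Finite α] {K : Type*} [Field K] (M : Matroid α) (L : Set (Set α))
    (w : Set α → K) (G : Set α) : K :=
  ∑ t ∈ (finite_flagsIn M L G).toFinset, (t.map fun F => (w F)⁻¹).prod

section Sums

variable [Finite α] {K : Type*} [Field K] {w : Set α → K} {G : Set α}

theorem fullFlagSum_empty : fullFlagSum M L w ∅ = 1 := by
  have : (finite_flagsIn M L ∅).toFinset = {[]} := by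
    ext t
    simp only [Finite.mem_toFinset, Finset.mem_singleton]
    constructor
    · rintro ⟨h1, h2, -⟩
      cases t with
      | nil => rfl
      | cons H s =>
        have := h1.1.nonempty
        rw [show H = ∅ from h2] at this
        simp at this
    · rintro rfl
      exact ⟨trivial, rfl, by simp⟩
  rw [fullFlagSum, this]
  simp

theorem flagSum_eq_sum (hL : ∅ ∈ L) (hG : G ∈ L) (hne : G.Nonempty) :
    flagSum M L w G = ∑ H ∈ (toFinite (lowerIn M L G)).toFinset, fullFlagSum M L w H := by
  rw [flagSum, sum_flagsIn_eq hL hG hne]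
  rfl

theorem fullFlagSum_eq (hL : ∅ ∈ L) (hG : G ∈ L) (hne : G.Nonempty) :
    fullFlagSum M L w G = (w G)⁻¹ * flagSum M L w G := by
  rw [flagSum_eq_sum hL hG hne, fullFlagSum, sum_flagsIn_eq hL hG hne, Finset.mul_sum]
  simp only [fullFlagSum, Finset.mul_sum, List.map_cons, List.prod_cons]

/-- This form of the recursion also holds for `G = ∅`, where both sides are zero. -/
theorem sum_lowerIn_eq (hL : ∅ ∈ L) (hG : G ∈ L) (h0 : w ∅ = 0) (hw : G.Nonempty → w G ≠ 0) :
    ∑ H ∈ (toFinite (lowerIn M L G)).toFinset, fullFlagSum M L w H =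
      w G * fullFlagSum M L w G := by
  rcases G.eq_empty_or_nonempty with rfl | hne
  · rw [h0, zero_mul]
    refine Finset.sum_eq_zero fun H hH => ?_
    have := ((Finite.mem_toFinset _).1 hH).2.nonempty
    simp at this
  · rw [fullFlagSum_eq hL hG hne, mul_inv_cancel_left₀ (hw hne), flagSum_eq_sum hL hG hne]

end Sums

/-! ### Direct sums -/

/-- The matroid `M` is the direct sum of its restrictions to `E₁` and `E₂`. -/
structure IsDirectSum (M : Matroid α) (E₁ E₂ : Set α) : Prop where
  disjoint : Disjoint E₁ E₂
  union_eq : E₁ ∪ E₂ = M.E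
  indep_iff : ∀ I, M.Indep I ↔ M.Indep (I ∩ E₁) ∧ M.Indep (I ∩ E₂) ∧ I ⊆ M.E

theorem Decomposable.exists_isDirectSum (h : Decomposable M) :
    ∃ E₁ E₂ : Set α, E₁.Nonempty ∧ E₂.Nonempty ∧ IsDirectSum M E₁ E₂ := by
  obtain ⟨E₁, E₂, hd, h1, h2, hu, hM⟩ := h
  refine ⟨E₁, E₂, h1, h2, hd, hu, fun I => ?_⟩
  have h3 : M.Indep I ↔ ((M ↾ E₁).disjointSum (M ↾ E₂) hd).Indep I := by rw [← hM]
  refine h3.trans (Matroid.disjointSum_indep_iff.trans ?_)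
  simp [hu]

namespace IsDirectSum

theorem symm (h : IsDirectSum M E₁ E₂) : IsDirectSum M E₂ E₁ :=
  ⟨h.disjoint.symm, by rw [union_comm, h.union_eq], fun I => by rw [h.indep_iff I]; tauto⟩

/-- The closure in a direct sum is computed in each summand. -/
theorem mem_closure_inter (h : IsDirectSum M E₁ E₂) {X : Set α} {e : α} (he : e ∈ E₂)
    (heX : e ∈ M.closure X) : e ∈ M.closure (X ∩ E₂) := by
  have hE₁ : E₁ ⊆ M.E := h.union_eq ▸ subset_union_left
  have hE₂ : E₂ ⊆ M.E := h.union_eq ▸ subset_union_right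
  obtain ⟨I₁, hI₁⟩ := M.exists_isBasis (X ∩ E₁) (inter_subset_right.trans hE₁)
  obtain ⟨I₂, hI₂⟩ := M.exists_isBasis (X ∩ E₂) (inter_subset_right.trans hE₂)
  have h1 : I₁ ⊆ E₁ := hI₁.subset.trans inter_subset_right
  have h2 : I₂ ⊆ E₂ := hI₂.subset.trans inter_subset_right
  have hdis : ∀ {x}, x ∈ E₁ → x ∉ E₂ := fun hx => disjoint_left.1 h.disjoint hx
  have e1 : (I₁ ∪ I₂) ∩ E₁ = I₁ := by
    ext x
    have := @h1 x; have := @h2 x; have := @hdis x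
    simp only [mem_inter_iff, mem_union]; tauto
  have e2 : (I₁ ∪ I₂) ∩ E₂ = I₂ := by
    ext x
    have := @h1 x; have := @h2 x; have := @hdis x
    simp only [mem_inter_iff, mem_union]; tauto
  have hI : M.Indep (I₁ ∪ I₂) := by
    rw [h.indep_iff, e1, e2]
    exact ⟨hI₁.indep, hI₂.indep, union_subset (h1.trans hE₁) (h2.trans hE₂)⟩
  have hsub : M.closure X ⊆ M.closure (I₁ ∪ I₂) := by
    rw [← M.closure_inter_ground X, ← h.union_eq, inter_union_distrib_left]
    refine M.closure_subset_closure_of_subset_closure (union_subset ?_ ?_)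
    · exact hI₁.subset_closure.trans (M.closure_subset_closure subset_union_left)
    · exact hI₂.subset_closure.trans (M.closure_subset_closure subset_union_right)
  by_cases heI : e ∈ I₁ ∪ I₂
  · have : e ∈ I₂ := heI.resolve_left fun h' => hdis (h1 h') he
    exact M.mem_closure_of_mem (hI₂.subset this) (inter_subset_right.trans hE₂)
  · by_contra hcon
    rw [← hI₂.closure_eq_closure] at hcon
    refine ((hI.insert_dep_iff).2 ⟨hsub heX, heI⟩).not_indep ?_
    have e3 : insert e (I₁ ∪ I₂) ∩ E₁ = I₁ := by
      rw [insert_inter_of_notMem fun h' => hdis h' he, e1]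
    have e4 : insert e (I₁ ∪ I₂) ∩ E₂ = insert e I₂ := by
      rw [insert_inter_of_mem he, e2]
    rw [h.indep_iff, e3, e4]
    refine ⟨hI₁.indep, ?_, insert_subset (hE₂ he) hI.subset_ground⟩
    rw [hI₂.indep.insert_indep_iff_of_notMem fun h' => heI (Or.inr h')]
    exact ⟨hE₂ he, hcon⟩

theorem isFlat_union_inter (h : IsDirectSum M E₁ E₂) {F : Set α} (hF : M.IsFlat F) :
    M.IsFlat (E₁ ∪ F ∩ E₂) := by
  have hE₁ : E₁ ⊆ M.E := h.union_eq ▸ subset_union_left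
  rw [Matroid.isFlat_iff_closure_eq]
  refine subset_antisymm (fun e he => ?_) (M.subset_closure _
    (union_subset hE₁ (inter_subset_left.trans hF.subset_ground)))
  have heE : e ∈ E₁ ∪ E₂ := h.union_eq ▸ M.closure_subset_ground _ he
  rcases heE with he1 | he2
  · exact Or.inl he1
  · refine Or.inr ⟨?_, he2⟩
    have := h.mem_closure_inter he2 he
    rw [← hF.closure]
    refine M.closure_subset_closure ?_ this
    rintro x ⟨hx | hx, hx2⟩
    · exact absurd hx2 (disjoint_left.1 h.disjoint hx)
    · exact hx.1

theorem subset_of_notMem {G₁ G₂ K : Set α} (h : IsDirectSum M E₁ E₂) (h₂ : G₂ ⊆ E₂)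
    (hc : Covers M K (G₁ ∪ G₂)) {e : α} (he₁ : e ∈ E₁) (he : e ∈ G₁) (heK : e ∉ K) : G₂ ⊆ K := by
  intro x hx
  have hx2 := h₂ hx
  have hxc : x ∈ M.closure (insert e K) := by
    rw [hc.closure_insert (Or.inl he) heK]; exact Or.inr hx
  have := h.mem_closure_inter hx2 hxc
  rw [← hc.1.closure]
  refine M.closure_subset_closure ?_ this
  rintro y ⟨rfl | hy, hy2⟩
  · exact absurd hy2 (disjoint_left.1 h.disjoint he₁)
  · exact hy

theorem covers_inter {G₁ G₂ K : Set α} (h : IsDirectSum M E₁ E₂) [M.Loopless] (h₁ : G₁ ⊆ E₁)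
    (h₂ : G₂ ⊆ E₂) (hG₁ : M.IsFlat G₁) (hc : Covers M K (G₁ ∪ G₂)) {e : α} (he : e ∈ G₁)
    (heK : e ∉ K) : Covers M (K ∩ E₁) G₁ := by
  have hE₁ : E₁ ⊆ M.E := h.union_eq ▸ subset_union_left
  have hKG : K ∩ E₁ ⊆ G₁ := by
    rintro x ⟨hx, hx1⟩
    exact (hc.subset hx).resolve_right fun h' => disjoint_left.1 h.disjoint hx1 (h₂ h')
  have hflat : M.IsFlat (K ∩ E₁) := by
    rw [Matroid.isFlat_iff_closure_eq]
    refine subset_antisymm (fun x hx => ?_) (M.subset_closure _ (inter_subset_right.trans hE₁))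
    refine ⟨hc.1.closure ▸ M.closure_subset_closure inter_subset_left hx, ?_⟩
    exact h₁ (hG₁.closure ▸ M.closure_subset_closure hKG hx)
  refine ⟨hflat, e, hG₁.subset_ground he, fun h' => heK h'.1, subset_antisymm (fun x hx => ?_) ?_⟩
  · have hxc : x ∈ M.closure (insert e K) := by
      rw [hc.closure_insert (Or.inl he) heK]; exact Or.inl hx
    have := h.symm.mem_closure_inter (h₁ hx) hxc
    rwa [insert_inter_of_mem (h₁ he)] at this
  · rw [← hG₁.closure]
    refine M.closure_subset_closure (insert_subset ?_ ?_)
    · exact he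
    · exact hKG

theorem covers_union {G₁ G₂ K : Set α} (h : IsDirectSum M E₁ E₂) (h₁ : G₁ ⊆ E₁)
    (h₂ : G₂ ⊆ E₂) (hc : Covers M K G₁) (hK : M.IsFlat (K ∪ G₂)) (hG : M.IsFlat (G₁ ∪ G₂)) :
    Covers M (K ∪ G₂) (G₁ ∪ G₂) := by
  obtain ⟨e, he, heK⟩ := hc.exists_mem
  refine ⟨hK, e, hc.isFlat_right.subset_ground he, ?_, subset_antisymm ?_ ?_⟩
  · rintro (h' | h')
    · exact heK h'
    · exact disjoint_left.1 h.disjoint (h₁ he) (h₂ h')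
  · refine union_subset ?_ ?_
    · rw [← hc.closure_insert he heK]
      exact M.closure_subset_closure (insert_subset_insert subset_union_left)
    · exact (subset_union_right.trans (subset_insert _ _)).trans (M.subset_closure _
        (insert_subset (hc.isFlat_right.subset_ground he) hK.subset_ground))
  · conv_rhs => rw [← hG.closure]
    exact M.closure_subset_closure (insert_subset (Or.inl he)
      (union_subset_union_left _ hc.subset))

/-- The sum over the complete flags of a family of flats that is a product over the summands of a
direct sum: every flag of the product is a shuffle of flags of the factors, and the sum over
the shuffles is computed by removing the largest member. -/
theorem flagSum_union_eq [Finite α] [M.Loopless] (h : IsDirectSum M E₁ E₂) {K : Type*} [Field K]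
    {w : Set α → K} (hE₁ : E₁.Nonempty) (hE₂ : E₂.Nonempty)
    (hL : ∀ F ∈ L, M.IsFlat F) (hL0 : ∅ ∈ L)
    (hmix : ∀ F ∈ L, ∀ G ∈ L, (F ∩ E₁) ∪ (G ∩ E₂) ∈ L) (hw0 : w ∅ = 0)
    (hwadd : ∀ G₁ G₂, G₁ ⊆ E₁ → G₂ ⊆ E₂ → w (G₁ ∪ G₂) = w G₁ + w G₂)
    (hw : ∀ G, G ⊆ M.E → G.Nonempty → G ≠ M.E → w G ≠ 0)
    {G₁ G₂ : Set α} (h₁ : G₁ ⊆ E₁) (h₂ : G₂ ⊆ E₂) (hG₁ : G₁ ∈ L) (hG₂ : G₂ ∈ L) :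
    (∑ H ∈ (toFinite (lowerIn M L (G₁ ∪ G₂))).toFinset, fullFlagSum M L w H =
      w (G₁ ∪ G₂) * (fullFlagSum M L w G₁ * fullFlagSum M L w G₂)) ∧
    (G₁ ∪ G₂ ≠ M.E → fullFlagSum M L w (G₁ ∪ G₂) =
      fullFlagSum M L w G₁ * fullFlagSum M L w G₂) := by
  classical
  have hdis : ∀ {x}, x ∈ E₁ → x ∉ E₂ := fun hx => disjoint_left.1 h.disjoint hx
  have hE₁E : E₁ ⊆ M.E := h.union_eq ▸ subset_union_left
  have hE₂E : E₂ ⊆ M.E := h.union_eq ▸ subset_union_right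
  have hunion : ∀ {A B : Set α}, A ⊆ E₁ → B ⊆ E₂ → A ∈ L → B ∈ L → A ∪ B ∈ L := by
    intro A B hA hB hAL hBL
    have := hmix A hAL B hBL
    rwa [inter_eq_self_of_subset_left hA, inter_eq_self_of_subset_left hB] at this
  have hint₁ : ∀ {A : Set α}, A ∈ L → A ∩ E₁ ∈ L := fun hA => by simpa using hmix _ hA ∅ hL0
  have hint₂ : ∀ {A : Set α}, A ∈ L → A ∩ E₂ ∈ L := fun hA => by simpa using hmix ∅ hL0 _ hA
  induction hn : (G₁ ∪ G₂).ncard using Nat.strong_induction_on generalizing G₁ G₂ with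
  | _ n ih =>
  have hGL := hunion h₁ h₂ hG₁ hG₂
  have hGE := (hL _ hGL).subset_ground
  have hrec : ∀ A B, A ⊆ E₁ → B ⊆ E₂ → A ∈ L → B ∈ L → A ∪ B ⊂ G₁ ∪ G₂ →
      fullFlagSum M L w (A ∪ B) = fullFlagSum M L w A * fullFlagSum M L w B := by
    intro A B hA hB hAL hBL hsub
    refine (ih _ ?_ hA hB hAL hBL rfl).2 fun hE => ?_
    · rw [← hn]; exact ncard_lt_ncard hsub (toFinite _)
    · exact hsub.not_subset (hE ▸ hGE)
  have hcov : ∀ {A B : Set α}, Covers M A B → A ⊂ B := fun hc =>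
    let ⟨e, he, he'⟩ := hc.exists_mem; ssubset_iff_exists.2 ⟨hc.subset, e, he, he'⟩
  set S₁ := (toFinite (lowerIn M L G₁)).toFinset with hS₁
  set S₂ := (toFinite (lowerIn M L G₂)).toFinset with hS₂
  have m₁ : ∀ {X}, X ∈ S₁ ↔ X ∈ L ∧ Covers M X G₁ := Finite.mem_toFinset _
  have m₂ : ∀ {X}, X ∈ S₂ ↔ X ∈ L ∧ Covers M X G₂ := Finite.mem_toFinset _
  -- a member covered by `G₁ ∪ G₂` is smaller than it in exactly one of the two summands
  have hset : (toFinite (lowerIn M L (G₁ ∪ G₂))).toFinset =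
      S₁.image (· ∪ G₂) ∪ S₂.image (G₁ ∪ ·) := by
    ext X
    simp only [Finite.mem_toFinset, Finset.mem_union, Finset.mem_image]
    constructor
    · rintro ⟨hXL, hc⟩
      obtain ⟨e, he, heX⟩ := hc.exists_mem
      have hXE : X ⊆ E₁ ∪ E₂ := h.union_eq ▸ (hL X hXL).subset_ground
      rcases he with he | he
      · left
        refine ⟨X ∩ E₁, m₁.2 ⟨hint₁ hXL, h.covers_inter h₁ h₂ (hL _ hG₁) hc he heX⟩, ?_⟩
        have := h.subset_of_notMem h₂ hc (h₁ he) he heX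
        ext x
        have a1 := @this x; have a2 := @hXE x; have a4 := @h₁ x
        have a3 : x ∈ X → x ∈ G₁ ∪ G₂ := fun hh => hc.subset hh
        have a5 := @h₂ x; have a6 := @hdis x
        simp only [mem_union, mem_inter_iff] at *
        tauto
      · right
        have hc' : Covers M X (G₂ ∪ G₁) := union_comm G₁ G₂ ▸ hc
        refine ⟨X ∩ E₂, m₂.2 ⟨hint₂ hXL, h.symm.covers_inter h₂ h₁ (hL _ hG₂) hc' he heX⟩, ?_⟩
        have := h.symm.subset_of_notMem h₁ hc' (h₂ he) he heX
        ext x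
        have a1 := @this x; have a2 := @hXE x; have a4 := @h₁ x
        have a3 : x ∈ X → x ∈ G₁ ∪ G₂ := fun hh => hc.subset hh
        have a5 := @h₂ x; have a6 := @hdis x
        simp only [mem_union, mem_inter_iff] at *
        tauto
    · rintro (⟨X, hX, rfl⟩ | ⟨X, hX, rfl⟩)
      · obtain ⟨hXL, hc⟩ := m₁.1 hX
        have hU := hunion (hc.subset.trans h₁) h₂ hXL hG₂
        exact ⟨hU, h.covers_union h₁ h₂ hc (hL _ hU) (hL _ hGL)⟩
      · obtain ⟨hXL, hc⟩ := m₂.1 hX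
        have hU := hunion h₁ (hc.subset.trans h₂) hG₁ hXL
        refine ⟨hU, ?_⟩
        rw [union_comm G₁ X, union_comm G₁ G₂]
        exact h.symm.covers_union h₂ h₁ hc (by rw [union_comm]; exact hL _ hU)
          (by rw [union_comm]; exact hL _ hGL)
  have hdj : Disjoint (S₁.image (· ∪ G₂)) (S₂.image (G₁ ∪ ·)) := by
    rw [Finset.disjoint_left]
    intro X hX hX'
    obtain ⟨Y, hY, rfl⟩ := Finset.mem_image.1 hX
    obtain ⟨Z, hZ, hYZ⟩ := Finset.mem_image.1 hX'
    obtain ⟨e, he, heY⟩ := (m₁.1 hY).2.exists_mem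
    have : e ∈ Y ∪ G₂ := hYZ ▸ Or.inl he
    exact this.elim heY fun h' => hdis (h₁ he) (h₂ h')
  have hinj₁ : InjOn (· ∪ G₂) (S₁ : Set (Set α)) := by
    intro X hX Y hY hXY
    have hX1 := (m₁.1 hX).2.subset.trans h₁
    have hY1 := (m₁.1 hY).2.subset.trans h₁
    have hXY' : X ∪ G₂ = Y ∪ G₂ := hXY
    ext x
    have a1 := @hX1 x; have a2 := @hY1 x; have a3 := @h₂ x; have a4 := @hdis x
    have a5 : x ∈ X ∪ G₂ ↔ x ∈ Y ∪ G₂ := by rw [hXY']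
    simp only [mem_union] at a5
    tauto
  have hinj₂ : InjOn (G₁ ∪ ·) (S₂ : Set (Set α)) := by
    intro X hX Y hY hXY
    have hX1 := (m₂.1 hX).2.subset.trans h₂
    have hY1 := (m₂.1 hY).2.subset.trans h₂
    have hXY' : G₁ ∪ X = G₁ ∪ Y := hXY
    ext x
    have a1 := @hX1 x; have a2 := @hY1 x; have a3 := @h₁ x; have a4 := @hdis x
    have a5 : x ∈ G₁ ∪ X ↔ x ∈ G₁ ∪ Y := by rw [hXY']
    simp only [mem_union] at a5
    tauto
  have hE : ∀ {G : Set α}, G ⊆ E₁ ∨ G ⊆ E₂ → G ≠ M.E := by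
    rintro G (hG | hG) rfl
    · obtain ⟨x, hx⟩ := hE₂
      exact hdis (hG (hE₂E hx)) hx
    · obtain ⟨x, hx⟩ := hE₁
      exact hdis hx (hG (hE₁E hx))
  have hmain : ∑ H ∈ (toFinite (lowerIn M L (G₁ ∪ G₂))).toFinset, fullFlagSum M L w H =
      w (G₁ ∪ G₂) * (fullFlagSum M L w G₁ * fullFlagSum M L w G₂) := by
    rw [hset, Finset.sum_union hdj, Finset.sum_image hinj₁, Finset.sum_image hinj₂,
      Finset.sum_congr rfl fun X hX => hrec X G₂ ((m₁.1 hX).2.subset.trans h₁) h₂ (m₁.1 hX).1 hG₂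
        (hcov (h.covers_union h₁ h₂ (m₁.1 hX).2
          (hL _ (hunion ((m₁.1 hX).2.subset.trans h₁) h₂ (m₁.1 hX).1 hG₂)) (hL _ hGL))),
      Finset.sum_congr rfl fun X hX => hrec G₁ X h₁ ((m₂.1 hX).2.subset.trans h₂) hG₁ (m₂.1 hX).1
        (by
          rw [union_comm G₁ X, union_comm G₁ G₂]
          exact hcov (h.symm.covers_union h₂ h₁ (m₂.1 hX).2
            (by
              rw [union_comm]
              exact hL _ (hunion h₁ ((m₂.1 hX).2.subset.trans h₂) hG₁ (m₂.1 hX).1))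
            (by rw [union_comm]; exact hL _ hGL))),
      ← Finset.sum_mul, ← Finset.mul_sum,
      sum_lowerIn_eq hL0 hG₁ hw0 (fun hne => hw _ (h₁.trans hE₁E) hne (hE (Or.inl h₁))),
      sum_lowerIn_eq hL0 hG₂ hw0 (fun hne => hw _ (h₂.trans hE₂E) hne (hE (Or.inr h₂))),
      hwadd _ _ h₁ h₂]
    ring
  refine ⟨hmain, fun hGne => ?_⟩
  rcases (G₁ ∪ G₂).eq_empty_or_nonempty with hemp | hne
  · obtain ⟨rfl, rfl⟩ := union_empty_iff.1 hemp
    rw [union_empty, fullFlagSum_empty, one_mul]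
  · rw [fullFlagSum_eq hL0 hGL hne, flagSum_eq_sum hL0 hGL hne, hmain,
      inv_mul_cancel_left₀ (hw _ hGE hne hGne)]

end IsDirectSum

/-! ### Nonvanishing of linear forms -/

section Parameters

variable [Fintype α]

/-- If `G` separates `e` from `f` and `F` does not, then `a_G` does not vanish on `a_F = 0`. -/
theorem restrictZero_aForm_ne_zero {E F G : Set α} {e f : α} (he : e ∈ E) (hf : f ∈ E)
    (heG : e ∈ G) (hfG : f ∉ G) (hF : e ∈ F ↔ f ∈ F) : restrictZero E F (aForm E G) ≠ 0 := by
  classical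
  -- evaluation at the vector that is `1` at `e`, `-1` at `f` and `0` elsewhere
  let x : E → ℤ := Pi.single ⟨e, he⟩ 1 - Pi.single ⟨f, hf⟩ 1
  have hx : ∀ S : Set α, MvPolynomial.eval x (linearForm E S) =
      (if e ∈ S then 1 else 0) - (if f ∈ S then 1 else 0) := by
    intro S
    simp only [linearForm, map_sum]
    have : ∀ a : E, MvPolynomial.eval x (if (a : α) ∈ S then MvPolynomial.X a else 0) =
        (if a = ⟨e, he⟩ then (if e ∈ S then 1 else 0) else 0) -
          (if a = ⟨f, hf⟩ then (if f ∈ S then 1 else 0) else 0) := by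
      intro a
      by_cases ha : (a : α) ∈ S
      · simp only [ha, if_true, MvPolynomial.eval_X, x, Pi.sub_apply, Pi.single_apply]
        congr 1
        · by_cases h : a = ⟨e, he⟩
          · subst h; simp [ha]
          · simp [h]
        · by_cases h : a = ⟨f, hf⟩
          · subst h; simp [ha]
          · simp [h]
      · simp only [ha, if_false, map_zero]
        by_cases h : a = ⟨e, he⟩
        · subst h
          have ha' : e ∉ S := ha
          by_cases h' : (⟨e, he⟩ : E) = ⟨f, hf⟩
          · have := congrArg Subtype.val h'
            simp only at this
            subst this; simp [ha']
          · simp [h', ha']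
        · by_cases h' : a = ⟨f, hf⟩
          · subst h'
            have ha' : f ∉ S := ha
            simp only [h, if_false, if_true, ha', sub_self]
          · simp [h, h']
    rw [Finset.sum_congr rfl fun a _ => this a, Finset.sum_sub_distrib]
    simp
  let ψ₀ : R₀ E →+* ℤ := liftR₀ (MvPolynomial.eval x) (by rw [hx]; simp [he, hf])
  let ψ₁ : R₀Mod E F →+* ℤ := liftR₀Mod ψ₀ (by
    rw [aForm, liftR₀_toR₀, hx]; simp [hF])
  intro h
  have h1 : ψ₁ (restrictZero E F (aForm E G)) = 1 := by
    rw [liftR₀Mod_restrictZero, aForm, liftR₀_toR₀, hx]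
    simp [heG, hfG]
  rw [h, map_zero] at h1
  exact zero_ne_one h1

theorem aForm_ne_zero {E G : Set α} (hG : G ⊆ E) (hne : G.Nonempty) (hE : G ≠ E) :
    aForm E G ≠ 0 := by
  obtain ⟨e, he⟩ := hne
  obtain ⟨f, hf, hfG⟩ := exists_of_ssubset (hG.ssubset_of_ne hE)
  intro h
  refine restrictZero_aForm_ne_zero (F := E) (hG he) hf he hfG (by simp [hG he, hf]) ?_
  rw [h, map_zero]

theorem aForm_union {E A B : Set α} (h : Disjoint A B) :
    aForm E (A ∪ B) = aForm E A + aForm E B := by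
  classical
  rw [aForm, aForm, aForm, ← map_add]
  congr 1
  simp only [linearForm, ← Finset.sum_add_distrib]
  refine Finset.sum_congr rfl fun e _ => ?_
  by_cases hA : (e : α) ∈ A
  · have := disjoint_left.1 h hA
    simp [hA, this]
  · by_cases hB : (e : α) ∈ B <;> simp [hA, hB]

theorem aForm_empty (E : Set α) : aForm E ∅ = 0 := by
  simp [aForm, linearForm]

end Parameters

/-! ### Amplitudes of decomposable matroids -/

namespace OrientedMatroid

variable {M : OrientedMatroid α} {P : α → SignType}

/-- If `M` is the direct sum of its restrictions to `E₁` and `E₂`, then the part of a covector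
on `E₁` is a covector: the elements of `E₂` are eliminated one after the other with covectors that
vanish on `E₁`. -/
theorem indicator_mem_covectors [Finite α] (h : IsDirectSum M.toMatroid E₁ E₂)
    {X : α → SignType} (hX : X ∈ M.covectors) : E₁.indicator X ∈ M.covectors := by
  induction hn : {g ∈ E₂ | X g ≠ 0}.ncard using Nat.strong_induction_on generalizing X with
  | _ n ih =>
  have hdis : ∀ {x}, x ∈ E₁ → x ∉ E₂ := fun hx => disjoint_left.1 h.disjoint hx
  by_cases hz : ∃ e ∈ E₂, X e ≠ 0
  · obtain ⟨e, he, hXe⟩ := hz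
    have heE : e ∈ M.toMatroid.E := h.union_eq ▸ Or.inr he
    obtain ⟨Y, hY, hY0⟩ := (M.isFlat_iff _).1
      (h.isFlat_union_inter ((M.isFlat_iff _).2 ⟨X, hX, rfl⟩))
    have hYz : ∀ g ∈ M.toMatroid.E, (Y g = 0 ↔ g ∈ E₁ ∨ (X g = 0 ∧ g ∈ E₂)) := by
      intro g hg
      have : g ∈ {e ∈ M.toMatroid.E | Y e = 0} ↔ Y g = 0 := by simp [hg]
      rw [← this, ← hY0]
      simp [hg]
    obtain ⟨Y', hY', hY'z, hY'e⟩ : ∃ Y' ∈ M.covectors, (∀ g, Y g = 0 → Y' g = 0) ∧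
        X e = -Y' e := by
      have hYe : Y e ≠ 0 := by
        rw [Ne, hYz e heE]
        rintro (h' | h')
        · exact hdis h' he
        · exact hXe h'.1
      by_cases hs : X e = -Y e
      · exact ⟨Y, hY, fun g hg => hg, hs⟩
      · refine ⟨-Y, M.neg_mem Y hY, fun g hg => by simp [hg], ?_⟩
        revert hs hYe hXe
        rw [Pi.neg_apply]
        generalize X e = x
        generalize Y e = y
        revert x y; decide
    obtain ⟨Z, hZ, hZe, hZf⟩ := M.elimination X hX Y' hY' e hXe hY'e
    have hY1 : ∀ g ∈ E₁, Y' g = 0 := fun g hg =>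
      hY'z g ((hYz g (h.union_eq ▸ Or.inl hg)).2 (Or.inl hg))
    have hZ1 : ∀ g ∈ E₁, Z g = X g := by
      intro g hg
      rw [hZf g (by rw [hY1 g hg]; simp)]
      by_cases hXg : X g = 0 <;> simp [comp, hXg, hY1 g hg]
    have hind : E₁.indicator X = E₁.indicator Z := by
      ext1 g
      by_cases hg : g ∈ E₁
      · rw [indicator_of_mem hg, indicator_of_mem hg, hZ1 g hg]
      · rw [indicator_of_notMem hg, indicator_of_notMem hg]
    rw [hind]
    refine ih _ ?_ hZ rfl
    rw [← hn]
    refine ncard_lt_ncard (ssubset_iff_exists.2 ⟨?_, e, ⟨he, hXe⟩, fun h' => h'.2 hZe⟩)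
      (toFinite _)
    rintro g ⟨hg, hZg⟩
    refine ⟨hg, fun hXg => hZg ?_⟩
    have := hY'z g ((hYz g (h.union_eq ▸ Or.inr hg)).2 (Or.inr ⟨hXg, hg⟩))
    rw [hZf g (by simp [hXg])]
    simp [comp, hXg, this]
  · push Not at hz
    convert hX using 1
    ext1 g
    by_cases hg : g ∈ E₁
    · rw [indicator_of_mem hg]
    · rw [indicator_of_notMem hg]
      by_cases hg2 : g ∈ E₂
      · rw [hz g hg2]
      · rw [M.apply_eq_zero X hX g fun h' => ?_]
        rw [← h.union_eq] at h'
        exact h'.elim hg hg2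

theorem IsFull.union_inter_mem_faces [Finite α] (hP : M.IsFull P)
    (h : IsDirectSum M.toMatroid E₁ E₂) {F G : Set α} (hF : F ∈ M.faces P) (hG : G ∈ M.faces P) :
    (F ∩ E₁) ∪ (G ∩ E₂) ∈ M.faces P := by
  have h1 := hP.mem_faces_iff.1 hF
  have h2 := hP.mem_faces_iff.1 hG
  refine hP.mem_faces_iff.2 ⟨union_subset (inter_subset_left.trans h1.1)
    (inter_subset_left.trans h2.1), ?_⟩
  have h3 := M.comp_mem _ (indicator_mem_covectors h h1.2) _ (indicator_mem_covectors h.symm h2.2)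
  convert h3 using 1
  ext1 e
  by_cases heE : e ∈ M.toMatroid.E
  · have hPe := hP.2 e heE
    rw [← h.union_eq] at heE
    rcases heE with he | he
    · have he2 : e ∉ E₂ := disjoint_left.1 h.disjoint he
      by_cases heF : e ∈ F
      · rw [indicator_of_notMem (by simp [he, heF])]
        simp [comp, he, heF, he2]
      · rw [indicator_of_mem (by simp [heF, he2])]
        simp [comp, he, heF, hPe]
    · have he1 : e ∉ E₁ := disjoint_right.1 h.disjoint he
      by_cases heG : e ∈ G
      · rw [indicator_of_notMem (by simp [he, heG])]
        simp [comp, he, heG, he1]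
      · rw [indicator_of_mem (by simp [heG, he1])]
        simp [comp, he, heG, he1]
  · rw [M.apply_eq_zero _ h3 e heE, indicator_apply_eq_zero]
    exact fun _ => M.apply_eq_zero P hP.1 e heE

theorem IsFull.amplitude_eq_zero [Fintype α] [M.toMatroid.Loopless] (hP : M.IsFull P)
    (hM : Decomposable M.toMatroid) : M.amplitude P = 0 := by
  obtain ⟨E₁, E₂, hE₁, hE₂, h⟩ := hM.exists_isDirectSum
  have hE := hP.ground_mem_faces
  have h1 := hP.union_inter_mem_faces h hE hP.empty_mem_faces
  have h2 := hP.union_inter_mem_faces h hP.empty_mem_faces hE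
  rw [empty_inter, union_empty, inter_eq_self_of_subset_right
    (h.union_eq ▸ subset_union_left : E₁ ⊆ M.toMatroid.E)] at h1
  rw [empty_inter, empty_union, inter_eq_self_of_subset_right
    (h.union_eq ▸ subset_union_right : E₂ ⊆ M.toMatroid.E)] at h2
  have hinj := IsFractionRing.injective (R₀ M.toMatroid.E) (Q₀ M.toMatroid.E)
  rw [hP.amplitude_eq, flagSum_eq_sum hP.empty_mem_faces hE (by
    rw [← h.union_eq]; exact hE₁.mono subset_union_left)]
  have hsum := (h.flagSum_union_eq (L := M.faces P)
    (w := fun S => algebraMap (R₀ M.toMatroid.E) (Q₀ M.toMatroid.E) (aForm M.toMatroid.E S))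
    hE₁ hE₂ (fun F hF => isFlat_of_mem_faces hF) hP.empty_mem_faces
    (fun F hF G hG => hP.union_inter_mem_faces h hF hG)
    (by rw [aForm_empty, map_zero])
    (fun G₁ G₂ hG₁ hG₂ => by rw [aForm_union (h.disjoint.mono hG₁ hG₂), map_add])
    (fun G hG hne hGE => by
      rw [Ne, map_eq_zero_iff _ hinj]; exact aForm_ne_zero hG hne hGE)
    subset_rfl subset_rfl h1 h2).1
  rw [h.union_eq] at hsum
  rw [hsum, show aForm M.toMatroid.E M.toMatroid.E = 0 from toR₀_linearForm _, map_zero, zero_mul]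

end OrientedMatroid

end

section

variable {α : Type u}

/-! ### Flags through a given flat -/

variable {M : Matroid α} {L L' : Set (Set α)} {A B F : Set α}

theorem IsDescFlag.subset_or_subset {t : List (Set α)} (h : IsDescFlag M A t) {G H : Set α}
    (hG : G ∈ t) (hH : H ∈ t) : G ⊆ H ∨ H ⊆ G := by
  induction t with
  | nil => simp at hG
  | cons K t ih =>
    have hs := h.subset_head
    rcases List.mem_cons.1 hG with rfl | hG'
    · exact Or.inr (hs H hH)
    · rcases List.mem_cons.1 hH with rfl | hH'
      · exact Or.inl (hs G hG)
      · exact ih h.2 hG' hH'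

theorem restrict_closure_eq_of_isFlat (hF : M.IsFlat F) (hA : A ⊆ F) :
    (M ↾ F).closure A = M.closure A := by
  rw [M.restrict_closure_eq hA hF.subset_ground, inter_eq_left]
  conv_rhs => rw [← hF.closure]
  exact M.closure_subset_closure hA

theorem loopless_restrict [M.Loopless] (hF : F ⊆ M.E) : (M ↾ F).Loopless := by
  rw [Matroid.loopless_iff, Matroid.loops, M.restrict_closure_eq (empty_subset F) hF,
    Matroid.closure_empty, Matroid.loops_eq_empty, empty_inter]

theorem covers_restrict_iff (hF : M.IsFlat F) (hA : A ⊆ F) (hB : B ⊆ F) :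
    Covers (M ↾ F) A B ↔ Covers M A B := by
  have hflat : (M ↾ F).IsFlat A ↔ M.IsFlat A := by
    rw [Matroid.isFlat_iff_closure_eq, Matroid.isFlat_iff_closure_eq,
      restrict_closure_eq_of_isFlat hF hA]
  constructor
  · rintro ⟨h1, e, he, heA, rfl⟩
    exact ⟨hflat.1 h1, e, hF.subset_ground he, heA,
      restrict_closure_eq_of_isFlat hF (insert_subset he hA)⟩
  · intro h
    obtain ⟨e, he, heA⟩ := h.exists_mem
    refine ⟨hflat.2 h.1, e, hB he, heA, ?_⟩
    rw [restrict_closure_eq_of_isFlat hF (insert_subset (hB he) hA), h.closure_insert he heA]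

theorem isDescFlag_restrict_iff (hF : M.IsFlat F) {t : List (Set α)} (ht : ∀ G ∈ t, G ⊆ F) :
    IsDescFlag (M ↾ F) ∅ t ↔ IsDescFlag M ∅ t := by
  induction t with
  | nil => rfl
  | cons H t ih =>
    have hh : t.headD ∅ ⊆ F := by
      cases t with
      | nil => exact empty_subset F
      | cons K t => exact ht K (by simp)
    rw [IsDescFlag, IsDescFlag, covers_restrict_iff hF hh (ht H (by simp)),
      ih fun G hG => ht G (List.mem_cons_of_mem _ hG)]

theorem flagsIn_restrict (hF : M.IsFlat F) (hL : ∀ G, G ∈ L' ↔ G ∈ L ∧ G ⊆ F) :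
    flagsIn (M ↾ F) L' F = flagsIn M L F := by
  ext t
  constructor
  · rintro ⟨h1, h2, h3⟩
    exact ⟨(isDescFlag_restrict_iff hF fun G hG => ((hL G).1 (h3 G hG)).2).1 h1, h2,
      fun G hG => ((hL G).1 (h3 G hG)).1⟩
  · rintro ⟨h1, h2, h3⟩
    have h4 : ∀ G ∈ t, G ⊆ F := fun G hG => h2 ▸ h1.subset_head G hG
    exact ⟨(isDescFlag_restrict_iff hF h4).2 h1, h2, fun G hG => (hL G).2 ⟨h3 G hG, h4 G hG⟩⟩

/-- A flag of `M` through `F` consists of a flag of `M|F` and a flag of `M/F`. -/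
theorem sum_flagsIn_filter_mem [Finite α] {K : Type*} [AddCommMonoid K]
    (hF : F ∈ L) (hFl : M.IsFlat F) (hne : F.Nonempty) (hFE : F ≠ M.E)
    (hL : ∀ G, Disjoint F G → (G ∈ L' ↔ F ∪ G ∈ L)) (f : List (Set α) → K)
    [DecidablePred fun t : List (Set α) => F ∈ t] :
    ∑ t ∈ (finite_flagsIn M L M.E).toFinset with F ∈ t, f t =
      ∑ q ∈ (finite_flagsIn M L F).toFinset,
        ∑ s ∈ (finite_flagsIn (M ／ F) L' (M.E \ F)).toFinset, f (s.map (F ∪ ·) ++ q) := by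
  have hFs : F ⊆ M.E := hFl.subset_ground
  have hrest : (M.E \ F).Nonempty := by
    obtain ⟨e, he, heF⟩ := exists_of_ssubset (hFs.ssubset_of_ne hFE)
    exact ⟨e, he, heF⟩
  have hdisj : ∀ {s}, IsDescFlag (M ／ F) ∅ s → ∀ G ∈ s, Disjoint F G := fun hs G hG =>
    (subset_sdiff.1 (hs.isFlat G hG).subset_ground).2.symm
  rw [← Finset.sum_product']
  symm
  refine Finset.sum_bij (fun x _ => x.2.map (F ∪ ·) ++ x.1) ?_ ?_ ?_ ?_
  · rintro ⟨q, s⟩ h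
    simp only [Finset.mem_product, Finset.mem_filter, Finite.mem_toFinset] at h ⊢
    obtain ⟨⟨q1, q2, q3⟩, s1, s2, s3⟩ := h
    refine ⟨⟨?_, ?_, ?_⟩, ?_⟩
    · have := (isDescFlag_contract_iff hFs (hdisj s1)).1 s1
      exact isDescFlag_append.2 ⟨by rwa [q2], q1⟩
    · cases s with
      | nil => rw [← s2] at hrest; simp at hrest
      | cons H s =>
        obtain rfl : H = M.E \ F := s2
        change F ∪ M.E \ F = M.E
        exact union_sdiff_cancel hFs
    · intro G hG
      rcases List.mem_append.1 hG with hG | hG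
      · obtain ⟨H, hH, rfl⟩ := List.mem_map.1 hG
        exact (hL H (hdisj s1 H hH)).1 (s3 H hH)
      · exact q3 G hG
    · cases q with
      | nil => rw [← q2] at hne; simp at hne
      | cons H q =>
        obtain rfl : H = F := q2
        simp
  · rintro ⟨q, s⟩ h ⟨q', s'⟩ h' heq
    simp only [Finset.mem_product, Finite.mem_toFinset] at h h'
    have hlen : q.length = q'.length := by
      have h1 := h.1.1.eRk_head
      have h2 := h'.1.1.eRk_head
      rw [h.1.2.1] at h1
      rw [h'.1.2.1, h1, Matroid.eRk_empty, zero_add, zero_add] at h2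
      exact_mod_cast h2
    obtain ⟨h1, h2⟩ := List.append_inj' heq hlen
    obtain rfl : q = q' := h2
    have key : ∀ r : List (Set α), IsDescFlag (M ／ F) ∅ r → (r.map (F ∪ ·)).map (· \ F) = r := by
      intro r hr
      rw [List.map_map]
      conv_rhs => rw [← List.map_id r]
      refine List.map_congr_left fun G hG => ?_
      change (F ∪ G) \ F = G
      rw [union_sdiff_left]
      exact (hdisj hr G hG).symm.sdiff_eq_left
    have h3 : s = s' := by
      have h4 : s.map (F ∪ ·) = s'.map (F ∪ ·) := h1
      rw [← key s h.2.1, h4, key s' h'.2.1]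
    rw [h3]
  · intro t ht
    simp only [Finset.mem_filter, Finite.mem_toFinset] at ht
    obtain ⟨⟨t1, t2, t3⟩, hFt⟩ := ht
    obtain ⟨p, q, rfl⟩ := List.append_of_mem hFt
    obtain ⟨p1, q1⟩ := isDescFlag_append.1 t1
    obtain ⟨s, hs, rfl⟩ :=
      OrientedMatroid.exists_map_union_of_isDescFlag (show IsDescFlag M F p from p1)
    refine ⟨⟨F :: q, s⟩, ?_, rfl⟩
    simp only [Finset.mem_product, Finite.mem_toFinset]
    refine ⟨⟨q1, rfl, fun G hG => t3 G (List.mem_append_right _ hG)⟩,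
      (isDescFlag_contract_iff hFs hs).2 p1, ?_, fun G hG => (hL G (hs G hG)).2
        (t3 _ (List.mem_append_left _ (List.mem_map_of_mem hG)))⟩
    cases s with
    | nil => exact absurd t2 hFE
    | cons H s =>
      have h1 : F ∪ H = M.E := t2
      change H = M.E \ F
      rw [← h1, union_sdiff_left]
      exact (hs H (by simp)).symm.sdiff_eq_left.symm
  · intro x _
    rfl

theorem tail_map_union_append {s q : List (Set α)} (hs : s ≠ []) (hq : q.head? = some F) :
    (s.map (F ∪ ·) ++ q).tail = s.tail.map (F ∪ ·) ++ F :: q.tail := by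
  cases s with
  | nil => exact absurd rfl hs
  | cons H s =>
    cases q with
    | nil => simp at hq
    | cons G q =>
      obtain rfl : G = F := by simpa using hq
      rfl

section Sums

variable [Finite α] {K : Type*} [Field K] {w w' : Set α → K}

theorem flagSum_congr (h : ∀ G, G ⊆ M.E → w G = w' G) {G : Set α} :
    flagSum M L w G = flagSum M L w' G := by
  refine Finset.sum_congr rfl fun t ht => ?_
  obtain ⟨h1, -, -⟩ := (Finite.mem_toFinset _).1 ht
  congr 1
  exact List.map_congr_left fun G hG => by
    rw [h G (h1.isFlat G (List.mem_of_mem_tail hG)).subset_ground]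

theorem flagSum_restrict (hF : M.IsFlat F) (hL : ∀ G, G ∈ L' ↔ G ∈ L ∧ G ⊆ F) :
    flagSum (M ↾ F) L' w F = flagSum M L w F := by
  refine Finset.sum_congr ?_ fun _ _ => rfl
  ext t
  rw [Finite.mem_toFinset, Finite.mem_toFinset, flagsIn_restrict hF hL]

theorem map_flagSum {K' : Type*} [Field K'] (φ : K →+* K') (G : Set α) :
    φ (flagSum M L w G) = flagSum M L (fun S => φ (w S)) G := by
  simp only [flagSum, map_sum, map_list_prod, List.map_map]
  refine Finset.sum_congr rfl fun t _ => congrArg List.prod (List.map_congr_left fun S _ => ?_)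
  exact map_inv₀ φ _

end Sums

/-! ### Faces of restrictions and contractions -/

namespace OrientedMatroid

variable {M : OrientedMatroid α} {P : α → SignType} {F : Set α}

theorem IsFull.restrict (hP : M.IsFull P) (hF : F ⊆ M.toMatroid.E) (b : List α) (hn : b.Nodup)
    (hb : (M.toMatroid ／ F).IsBase {e | e ∈ b}) :
    (M.restrict F hF b hn hb).IsFull (F.indicator P) := by
  refine ⟨⟨P, hP.1, rfl⟩, fun e he => ?_⟩
  have heF : e ∈ F := he
  rw [indicator_of_mem heF]
  exact hP.2 e (hF heF)

/-- The faces of `P|_F` are the faces of `P` in `F`: a covector of `M` that induces a face of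
`P|_F` is composed with the covector of the face `F` to make it conform to `P` outside `F`. -/
theorem IsFull.mem_faces_restrict_iff (hP : M.IsFull P) (hF : F ∈ M.faces P) (b : List α)
    (hn : b.Nodup) (hb : (M.toMatroid ／ F).IsBase {e | e ∈ b}) {G : Set α} :
    G ∈ (M.restrict F (M.faces_subset hF) b hn hb).faces (F.indicator P) ↔
      G ∈ M.faces P ∧ G ⊆ F := by
  have hFE := M.faces_subset hF
  rw [(hP.restrict hFE b hn hb).mem_faces_iff, hP.mem_faces_iff]
  constructor
  · rintro ⟨hG, Y, hY, hYG⟩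
    have hGF : G ⊆ F := hG
    refine ⟨⟨hGF.trans hFE, ?_⟩, hGF⟩
    have h3 := M.comp_mem _ (hP.mem_faces_iff.1 hF).2 _ hY
    convert h3 using 1
    ext1 e
    by_cases heE : e ∈ M.toMatroid.E
    · have hPe := hP.2 e heE
      by_cases heF : e ∈ F
      · have h4 := congrFun hYG e
        rw [indicator_of_mem heF] at h4
        simp only [comp, mem_compl_iff, heF, not_true_eq_false, not_false_eq_true,
          indicator_of_notMem, ← h4]
        by_cases heG : e ∈ G
        · simp [heG]
        · simp [heG, heF]
      · have heG : e ∉ G := fun h => heF (hGF h)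
        simp [comp, heF, heG, hPe]
    · rw [M.apply_eq_zero _ h3 e heE, indicator_apply_eq_zero]
      exact fun _ => M.apply_eq_zero P hP.1 e heE
  · rintro ⟨⟨-, h2⟩, hGF⟩
    exact ⟨hGF, _, h2, by rw [indicator_indicator, indicator_indicator, inter_comm]⟩

end OrientedMatroid

end

section

variable {α : Type u}

/-! ### Residues and regularity of rational functions -/

theorem prod_map_inv {R K : Type*} [CommRing R] [Field K] (φ : R →+* K)
    (x : Set α → R) (l : List (Set α)) :
    (l.map fun G => (φ (x G))⁻¹).prod = (φ (l.map x).prod)⁻¹ := by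
  induction l with
  | nil => simp
  | cons G l ih => simp [ih, mul_comm]

variable [Fintype α] {E F : Set α}

/-- The linear form `a_S` as a rational function. -/
abbrev formQ₀ (E S : Set α) : Q₀ E := algebraMap (R₀ E) (Q₀ E) (aForm E S)

/-- The restriction of the linear form `a_S` to the divisor `a_F = 0`. -/
abbrev formRes (E F S : Set α) : ResField E F :=
  algebraMap (R₀Mod E F) (ResField E F) (restrictZero E F (aForm E S))

theorem restrictZero_eq_zero_iff_dvd {x : R₀ E} : restrictZero E F x = 0 ↔ aForm E F ∣ x := by
  rw [restrictZero_eq_zero_iff, Ideal.mem_span_singleton]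

theorem algebraMap_Q₀_ne_zero {x : R₀ E} (h : x ≠ 0) : algebraMap (R₀ E) (Q₀ E) x ≠ 0 := by
  rwa [Ne, map_eq_zero_iff _ (IsFractionRing.injective (R₀ E) (Q₀ E))]

theorem algebraMap_resField_ne_zero {x : R₀Mod E F} (h : x ≠ 0) :
    algebraMap (R₀Mod E F) (ResField E F) x ≠ 0 := by
  rwa [Ne, map_eq_zero_iff _ (IsFractionRing.injective (R₀Mod E F) (ResField E F))]

theorem ne_zero_of_restrictZero_ne_zero {x : R₀ E} (h : restrictZero E F x ≠ 0) : x ≠ 0 := by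
  rintro rfl
  exact h (map_zero _)

theorem hasResidue_zero : HasResidue E F 0 0 :=
  ⟨0, 1, by rw [map_one]; exact one_ne_zero, by simp, by simp⟩

theorem HasResidue.add {q q' : Q₀ E} {ρ ρ' : ResField E F} (h : HasResidue E F q ρ)
    (h' : HasResidue E F q' ρ') : HasResidue E F (q + q') (ρ + ρ') := by
  obtain ⟨a, b, hb, hq, hρ⟩ := h
  obtain ⟨c, d, hd, hq', hρ'⟩ := h'
  refine ⟨a * d + b * c, b * d, by rw [map_mul]; exact mul_ne_zero hb hd, ?_, ?_⟩
  · rw [mul_add, hq, hq', div_add_div _ _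
      (algebraMap_Q₀_ne_zero (ne_zero_of_restrictZero_ne_zero hb))
      (algebraMap_Q₀_ne_zero (ne_zero_of_restrictZero_ne_zero hd))]
    simp only [map_add, map_mul]
  · rw [hρ, hρ', div_add_div _ _ (algebraMap_resField_ne_zero hb)
      (algebraMap_resField_ne_zero hd)]
    simp only [map_add, map_mul]

theorem HasResidue.neg {q : Q₀ E} {ρ : ResField E F} (h : HasResidue E F q ρ) :
    HasResidue E F (-q) (-ρ) := by
  obtain ⟨a, b, hb, hq, hρ⟩ := h
  exact ⟨-a, b, hb, by rw [mul_neg, hq, map_neg, neg_div], by rw [hρ, map_neg, map_neg, neg_div]⟩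

theorem HasResidue.sum {ι : Type*} {s : Finset ι} {q : ι → Q₀ E} {ρ : ι → ResField E F}
    (h : ∀ i ∈ s, HasResidue E F (q i) (ρ i)) :
    HasResidue E F (∑ i ∈ s, q i) (∑ i ∈ s, ρ i) := by
  classical
  induction s using Finset.induction_on with
  | empty => exact hasResidue_zero
  | insert i s hi ih =>
    rw [Finset.sum_insert hi, Finset.sum_insert hi]
    exact (h i (by simp)).add (ih fun j hj => h j (by simp [hj]))

theorem restrictZero_prod_ne_zero {l : List (Set α)}
    (hl : ∀ G ∈ l, restrictZero E F (aForm E G) ≠ 0) :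
    restrictZero E F (l.map (aForm E)).prod ≠ 0 := by
  rw [map_list_prod, List.map_map]
  refine List.prod_ne_zero fun h => ?_
  obtain ⟨G, hG, h0⟩ := List.mem_map.1 h
  exact hl G hG h0

theorem hasResidue_inv_mul_prod (hF : aForm E F ≠ 0) {l : List (Set α)}
    (hl : ∀ G ∈ l, restrictZero E F (aForm E G) ≠ 0) :
    HasResidue E F ((formQ₀ E F)⁻¹ * (l.map fun G => (formQ₀ E G)⁻¹).prod)
      (l.map fun G => (formRes E F G)⁻¹).prod := by
  refine ⟨1, (l.map (aForm E)).prod, restrictZero_prod_ne_zero hl, ?_, ?_⟩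
  · rw [mul_inv_cancel_left₀ (algebraMap_Q₀_ne_zero hF), prod_map_inv, map_one, one_div]
  · have := prod_map_inv ((algebraMap (R₀Mod E F) (ResField E F)).comp (restrictZero E F))
      (aForm E) l
    simp only [RingHom.comp_apply] at this
    rw [this, map_one, map_one, one_div]

theorem hasResidue_prod_zero {l : List (Set α)}
    (hl : ∀ G ∈ l, restrictZero E F (aForm E G) ≠ 0) :
    HasResidue E F (l.map fun G => (formQ₀ E G)⁻¹).prod 0 := by
  refine ⟨aForm E F, (l.map (aForm E)).prod, restrictZero_prod_ne_zero hl, ?_, ?_⟩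
  · rw [prod_map_inv, div_eq_mul_inv]
  · rw [restrictZero_aForm, map_zero, zero_div]

/-- Only the linear forms of `F` and of its complement vanish on `a_F = 0`. -/
theorem restrictZero_aForm_ne_zero_of_ne {G : Set α} (hG : G ⊆ E) (hne : G.Nonempty)
    (hGE : G ≠ E) (hF : F ⊆ E) (h1 : G ≠ F) (h2 : G ≠ E \ F) :
    restrictZero E F (aForm E G) ≠ 0 := by
  obtain ⟨e₀, he₀⟩ := hne
  obtain ⟨f₀, hf₀, hf₀G⟩ := exists_of_ssubset (hG.ssubset_of_ne hGE)
  by_contra h0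
  have key : ∀ e ∈ G, ∀ f ∈ E, f ∉ G → ¬ (e ∈ F ↔ f ∈ F) := fun e he f hf hfG hh =>
    restrictZero_aForm_ne_zero (hG he) hf he hfG hh h0
  by_cases he₀F : e₀ ∈ F
  · refine h1 (subset_antisymm (fun e he => ?_) fun f hf => ?_)
    · have k1 := key e₀ he₀ f₀ hf₀ hf₀G
      have k2 := key e he f₀ hf₀ hf₀G
      tauto
    · by_contra hfG
      exact key e₀ he₀ f (hF hf) hfG (by tauto)
  · refine h2 (subset_antisymm (fun e he => ⟨hG he, fun heF => ?_⟩) fun f hf => ?_)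
    · by_contra hfG
      exact key e₀ he₀ f hf.1 hfG (by have := hf.2; tauto)
    · have k1 := key e₀ he₀ f₀ hf₀ hf₀G
      exact key e he f₀ hf₀ hf₀G (by tauto)

theorem prime_aForm (hF : F ⊆ E) (hne : F.Nonempty) (hE : F ≠ E) : Prime (aForm E F) := by
  rw [← Ideal.span_singleton_prime (aForm_ne_zero hF hne hE), ← Ideal.Quotient.isDomain_iff_prime]
  exact inferInstanceAs (IsDomain (R₀Mod E F))

theorem regularAlong_sum {π : R₀ E} (hπ : Prime π) {ι : Type*} {s : Finset ι} {q : ι → Q₀ E}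
    (h : ∀ i ∈ s, RegularAlong π (q i)) : RegularAlong π (∑ i ∈ s, q i) := by
  classical
  induction s using Finset.induction_on with
  | empty => exact ⟨0, 1, fun h1 => hπ.not_isUnit (isUnit_of_dvd_one h1), by simp⟩
  | insert i s hi ih =>
    rw [Finset.sum_insert hi]
    obtain ⟨a, b, hb, hab⟩ := h i (by simp)
    obtain ⟨c, d, hd, hcd⟩ := ih fun j hj => h j (by simp [hj])
    have hb0 : b ≠ 0 := fun h0 => hb (h0 ▸ dvd_zero π)
    have hd0 : d ≠ 0 := fun h0 => hd (h0 ▸ dvd_zero π)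
    refine ⟨a * d + b * c, b * d, fun h' => (hπ.dvd_or_dvd h').elim hb hd, ?_⟩
    rw [hab, hcd, div_add_div _ _ (algebraMap_Q₀_ne_zero hb0) (algebraMap_Q₀_ne_zero hd0)]
    simp only [map_add, map_mul]

theorem RegularAlong.mul_left {π : R₀ E} {q : Q₀ E} (h : RegularAlong π q) (x : R₀ E) :
    RegularAlong π (algebraMap (R₀ E) (Q₀ E) x * q) := by
  obtain ⟨a, b, hb, rfl⟩ := h
  exact ⟨x * a, b, hb, by rw [map_mul, mul_div_assoc]⟩

theorem regularAlong_prod_inv {π : R₀ E} (hπ : Prime π) {l : List (Set α)}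
    (hl : ∀ G ∈ l, ¬ π ∣ aForm E G) :
    RegularAlong π (l.map fun G => (formQ₀ E G)⁻¹).prod := by
  refine ⟨1, (l.map (aForm E)).prod, fun h => ?_, by rw [prod_map_inv, map_one, one_div]⟩
  obtain ⟨x, hx, hd⟩ := (Prime.dvd_prod_iff hπ).1 h
  obtain ⟨G, hG, rfl⟩ := List.mem_map.1 hx
  exact hl G hG hd

/-- A function with a residue along `a_F = 0` has at most a simple pole there. -/
theorem HasResidue.regularAlong_mul {q : Q₀ E} {ρ : ResField E F} (h : HasResidue E F q ρ)
    {π : R₀ E} (hπ : Associated π (aForm E F)) :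
    RegularAlong π (algebraMap (R₀ E) (Q₀ E) π * q) := by
  obtain ⟨a, b, hb, hq, -⟩ := h
  obtain ⟨v, hv⟩ := hπ.symm
  refine ⟨v * a, b, fun hd => hb (restrictZero_eq_zero_iff_dvd.2 (hπ.symm.dvd.trans hd)), ?_⟩
  rw [← hv, map_mul, map_mul, mul_div_assoc, ← hq]
  ring

/-- A function whose residue along `a_F = 0` vanishes has no pole there. -/
theorem HasResidue.regularAlong (hF : aForm E F ≠ 0) {q : Q₀ E} (h : HasResidue E F q 0)
    {π : R₀ E} (hπ : Associated π (aForm E F)) : RegularAlong π q := by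
  obtain ⟨a, b, hb, hq, ha⟩ := h
  have ha' : restrictZero E F a = 0 := by
    by_contra h0
    exact div_ne_zero (algebraMap_resField_ne_zero h0) (algebraMap_resField_ne_zero hb) ha.symm
  obtain ⟨c, rfl⟩ := restrictZero_eq_zero_iff_dvd.1 ha'
  refine ⟨c, b, fun hd => hb (restrictZero_eq_zero_iff_dvd.2 (hπ.symm.dvd.trans hd)), ?_⟩
  rw [map_mul, mul_div_assoc] at hq
  exact mul_left_cancel₀ (algebraMap_Q₀_ne_zero hF) hq

theorem formRes_union_of_disjoint {D G : Set α} (h : F = D ∨ F = E \ D) (hG : Disjoint F G) :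
    formRes E D (F ∪ G) = formRes E D G := by
  have h0 : restrictZero E D (aForm E F) = 0 := by
    rcases h with rfl | rfl
    · exact restrictZero_aForm _ _
    · rw [aForm_sdiff, map_neg, restrictZero_aForm, neg_zero]
  rw [formRes, aForm_union hG, map_add, h0, zero_add]

theorem partHom_aForm {D S G : Set α} (hSE : S ⊆ E) (hS : S = D ∨ S = E \ D) (hG : G ⊆ S) :
    partHom hSE hS (aForm S G) = restrictZero E D (aForm E G) := by
  classical
  have h1 : MvPolynomial.rename (R := ℤ) (Set.inclusion hSE) (linearForm S G) =
      linearForm E G := by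
    simp only [linearForm, map_sum]
    refine Finset.sum_of_injOn (Set.inclusion hSE) (Set.inclusion_injective hSE).injOn
      (by intro e _; simp) ?_ ?_
    · intro e _ he
      have : (e : α) ∉ G := fun h => he ⟨⟨e, hG h⟩, by simp, rfl⟩
      simp [this]
    · intro e _
      by_cases h : (e : α) ∈ G <;> simp [h]
  rw [aForm, partHom, liftR₀_toR₀, aForm, ← h1]
  rfl

theorem partEmbedding_formQ₀ {D S G : Set α} (hSE : S ⊆ E) (hS : S = D ∨ S = E \ D)
    (hG : G ⊆ S) : partEmbedding hSE hS (formQ₀ S G) = formRes E D G := by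
  rw [partEmbedding, IsFractionRing.lift_algebraMap, RingHom.comp_apply, partHom_aForm hSE hS hG]

end

section

variable {α : Type u}

/-! ### Residues and poles of amplitudes -/

variable {M : Matroid α} {L L' : Set (Set α)} {D F G : Set α}

theorem IsDescFlag.nonempty_of_mem {A : Set α} {t : List (Set α)} (h : IsDescFlag M A t) :
    ∀ H ∈ t, H.Nonempty := by
  induction t with
  | nil => simp
  | cons K t ih =>
    intro H hH
    rcases List.mem_cons.1 hH with rfl | hH
    · exact h.1.nonempty
    · exact ih h.2 H hH

theorem IsDescFlag.subset_ne_head {A : Set α} {t : List (Set α)} (h : IsDescFlag M A t) :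
    ∀ H ∈ t.tail, H ⊆ t.headD A ∧ H ≠ t.headD A := by
  cases t with
  | nil => simp
  | cons K t =>
    intro H hH
    obtain ⟨e, he, heH⟩ := h.1.exists_mem
    refine ⟨h.subset_head H (List.mem_cons_of_mem _ hH), ?_⟩
    rintro rfl
    exact heH (h.2.subset_head _ hH he)

/-- The members of a flag below its largest member are proper and nonempty. -/
theorem of_mem_tail_flagsIn {t : List (Set α)} (ht : t ∈ flagsIn M L G) {H : Set α}
    (hH : H ∈ t.tail) : H.Nonempty ∧ H ⊆ G ∧ H ≠ G := by
  obtain ⟨h1, rfl, -⟩ := ht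
  exact ⟨h1.nonempty_of_mem H (List.mem_of_mem_tail hH), h1.subset_ne_head H hH⟩

section Residues

variable [Fintype α]

/-- The residue along `a_D = 0` of the part of the flag sum that comes from the flags
through `F`, where `F` is `D` or its complement, is the product of the flag sums of the restriction
to `F` and of the contraction of `F`. -/
theorem hasResidue_sum_filter_mem (hF : F ∈ L) (hFl : M.IsFlat F) (hne : F.Nonempty)
    (hFE : F ≠ M.E) (hL : ∀ G, Disjoint F G → (G ∈ L' ↔ F ∪ G ∈ L)) (hD : D ⊆ M.E)
    (h : F = D ∨ F = M.E \ D) [DecidablePred fun t : List (Set α) => F ∈ t] :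
    HasResidue M.E D (formQ₀ M.E F * (formQ₀ M.E D)⁻¹ *
      ∑ t ∈ (finite_flagsIn M L M.E).toFinset with F ∈ t,
        (t.tail.map fun G => (formQ₀ M.E G)⁻¹).prod)
      (flagSum M L (formRes M.E D) F * flagSum (M ／ F) L' (formRes M.E D) (M.E \ F)) := by
  have hFs : F ⊆ M.E := hFl.subset_ground
  have hDF : D = F ∨ D = M.E \ F := by
    rcases h with rfl | rfl
    · exact Or.inl rfl
    · exact Or.inr (sdiff_sdiff_cancel_left hD).symm
  have hrest : (M.E \ F).Nonempty := by
    obtain ⟨e, he, heF⟩ := exists_of_ssubset (hFs.ssubset_of_ne hFE)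
    exact ⟨e, he, heF⟩
  have hD0 : aForm M.E D ≠ 0 := by
    rcases hDF with rfl | rfl
    · exact aForm_ne_zero hFs hne hFE
    · exact aForm_ne_zero sdiff_subset hrest fun h' => by
        obtain ⟨e, he⟩ := hne
        exact (h'.ge (hFs he)).2 he
  have hcompl : ∀ H : Set α, H ≠ F → H ≠ M.E \ F → H ≠ D ∧ H ≠ M.E \ D := by
    intro H h1 h2
    rcases h with rfl | rfl
    · exact ⟨h1, h2⟩
    · rw [sdiff_sdiff_cancel_left hD] at h2
      exact ⟨h2, h1⟩
  rw [sum_flagsIn_filter_mem hF hFl hne hFE hL, flagSum, flagSum, Finset.sum_mul_sum,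
    Finset.mul_sum]
  refine HasResidue.sum fun q hq => ?_
  rw [Finset.mul_sum]
  refine HasResidue.sum fun s hs => ?_
  rw [Finite.mem_toFinset] at hq hs
  have hs0 : s ≠ [] := by
    rintro rfl
    rw [← hs.2.1] at hrest
    simp at hrest
  have hq0 : q.head? = some F := by
    obtain ⟨-, h2, -⟩ := hq
    cases q with
    | nil => rw [← h2] at hne; simp at hne
    | cons H q => exact congrArg some h2
  have hdisj : ∀ H ∈ s.tail, Disjoint F H := fun H hH =>
    (subset_sdiff.1 (of_mem_tail_flagsIn hs hH).2.1).2.symm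
  have hl : ∀ H ∈ s.tail.map (F ∪ ·) ++ q.tail, restrictZero M.E D (aForm M.E H) ≠ 0 := by
    intro H hH
    rcases List.mem_append.1 hH with hH | hH
    · obtain ⟨K, hK, rfl⟩ := List.mem_map.1 hH
      obtain ⟨⟨k, hk⟩, k2, k3⟩ := of_mem_tail_flagsIn hs hK
      obtain ⟨f, hf⟩ := hne
      have hkF : k ∉ F := (k2 hk).2
      have hc := hcompl (F ∪ K) (fun h' => hkF (h' ▸ Or.inr hk))
        (fun h' => (h' ▸ Or.inl hf : f ∈ M.E \ F).2 hf)
      refine restrictZero_aForm_ne_zero_of_ne (union_subset hFs (k2.trans sdiff_subset))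
        ⟨f, Or.inl hf⟩ (fun h' => k3 ?_) hD hc.1 hc.2
      rw [← h', union_sdiff_left]
      exact (hdisj K hK).symm.sdiff_eq_left.symm
    · obtain ⟨⟨k, hk⟩, k2, k3⟩ := of_mem_tail_flagsIn hq hH
      have hc := hcompl H k3 fun h' => (h' ▸ hk : k ∈ M.E \ F).2 (k2 hk)
      exact restrictZero_aForm_ne_zero_of_ne (k2.trans hFs) ⟨k, hk⟩
        (fun h' => hFE (subset_antisymm hFs (h' ▸ k2))) hD hc.1 hc.2
  have hF0 := algebraMap_Q₀_ne_zero (aForm_ne_zero hFs hne hFE)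
  convert hasResidue_inv_mul_prod hD0 hl using 1
  · rw [tail_map_union_append hs0 hq0, List.map_append, List.map_append, List.map_cons,
      List.prod_append, List.prod_append, List.prod_cons]
    field_simp
  · rw [List.map_append, List.prod_append, List.map_map, mul_comm]
    congr 2
    exact List.map_congr_left fun H hH => by
      rw [Function.comp_apply, formRes_union_of_disjoint h (hdisj H hH)]

namespace OrientedMatroid

variable {M : OrientedMatroid α} {P : α → SignType}

theorem IsFull.restrictAmplitude_eq [M.toMatroid.Loopless] (hP : M.IsFull P)
    (hF : F ∈ M.faces P) : M.restrictAmplitude P F (M.faces_subset hF) =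
      flagSum (M.toMatroid ↾ F) {G | G ∈ M.faces P ∧ G ⊆ F} (formQ₀ F) F := by
  have hl := loopless_restrict (M := M.toMatroid) (M.faces_subset hF)
  have : (M.restrictTo F (M.faces_subset hF)).toMatroid.Loopless := hl
  have hfull : (M.restrictTo F (M.faces_subset hF)).IsFull (F.indicator P) := hP.restrict _ _ _ _
  have hfaces : (M.restrictTo F (M.faces_subset hF)).faces (F.indicator P) =
      {G | G ∈ M.faces P ∧ G ⊆ F} := Set.ext fun G => hP.mem_faces_restrict_iff hF _ _ _
  rw [← hfaces]
  exact hfull.amplitude_eq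

theorem IsFull.contractAmplitude_eq [M.toMatroid.Loopless] (hP : M.IsFull P)
    (hF : F ∈ M.faces P) : M.contractAmplitude P F (M.faces_subset hF) =
      flagSum (M.toMatroid ／ F) ((M.contractBy F (M.faces_subset hF)).faces (Fᶜ.indicator P))
        (formQ₀ (M.toMatroid.E \ F)) (M.toMatroid.E \ F) := by
  have : (M.contractBy F (M.faces_subset hF)).toMatroid.Loopless :=
    loopless_contract (isFlat_of_mem_faces hF)
  have hfull : (M.contractBy F (M.faces_subset hF)).IsFull (Fᶜ.indicator P) :=
    hP.contract hF _ _ _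
  exact hfull.amplitude_eq

theorem IsFull.amplitudeProduct_eq [M.toMatroid.Loopless] (hP : M.IsFull P)
    (hF : F ∈ M.faces P) (h₁ : F = D ∨ F = M.toMatroid.E \ D)
    (h₂ : M.toMatroid.E \ F = D ∨ M.toMatroid.E \ F = M.toMatroid.E \ D) :
    M.amplitudeProduct P F D (M.faces_subset hF) h₁ h₂ =
      flagSum M.toMatroid (M.faces P) (formRes M.toMatroid.E D) F *
        flagSum (M.toMatroid ／ F) ((M.contractBy F (M.faces_subset hF)).faces (Fᶜ.indicator P))
          (formRes M.toMatroid.E D) (M.toMatroid.E \ F) := by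
  rw [amplitudeProduct, hP.restrictAmplitude_eq hF, hP.contractAmplitude_eq hF, map_flagSum,
    map_flagSum]
  congr 1
  · refine (flagSum_congr (M := M.toMatroid ↾ F) (w' := formRes M.toMatroid.E D) fun G hG =>
      partEmbedding_formQ₀ _ _ hG).trans ?_
    exact flagSum_restrict (isFlat_of_mem_faces hF) fun G => Iff.rfl
  · exact flagSum_congr (M := M.toMatroid ／ F) fun G hG => partEmbedding_formQ₀ _ _ hG

/-- The terms of the amplitude are sorted into those of the flags through `F`, those of the flags
through `E ∖ F`, whose residue `ρ` is left open here, and those of the other flags, which are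
regular along `a_F = 0`. -/
theorem IsFull.hasResidue_amplitude_add [M.toMatroid.Loopless] (hP : M.IsFull P)
    (hF : F ∈ M.faces P) (hne : F ≠ ∅) (hFE : F ≠ M.toMatroid.E) {ρ : ResField M.toMatroid.E F}
    (hρ : ∀ _ : DecidablePred fun t : List (Set α) => M.toMatroid.E \ F ∈ t,
      HasResidue M.toMatroid.E F (∑ t ∈ (finite_flagsIn M.toMatroid (M.faces P)
        M.toMatroid.E).toFinset with M.toMatroid.E \ F ∈ t,
          (t.tail.map fun G => (formQ₀ M.toMatroid.E G)⁻¹).prod) ρ) :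
    HasResidue M.toMatroid.E F (M.amplitude P)
      (M.amplitudeProduct P F F (M.faces_subset hF) (Or.inl rfl) (Or.inr rfl) + ρ) := by
  classical
  have hFs := M.faces_subset hF
  have hne' := nonempty_iff_ne_empty.2 hne
  have h1 := hasResidue_sum_filter_mem (D := F)
    (L' := (M.contractBy F hFs).faces (Fᶜ.indicator P)) hF (isFlat_of_mem_faces hF) hne' hFE
    (fun G hG => hP.mem_faces_contract_iff hF _ _ _ hG) hFs (Or.inl rfl)
  rw [mul_inv_cancel₀ (algebraMap_Q₀_ne_zero (aForm_ne_zero hFs hne' hFE)), one_mul] at h1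
  rw [hP.amplitudeProduct_eq hF, hP.amplitude_eq, flagSum,
    ← Finset.sum_filter_add_sum_filter_not _ fun t : List (Set α) => F ∈ t]
  refine h1.add ?_
  rw [← Finset.sum_filter_add_sum_filter_not _ fun t : List (Set α) => M.toMatroid.E \ F ∈ t,
    Finset.filter_filter, Finset.filter_filter, ← add_zero ρ]
  refine HasResidue.add ?_ ?_
  · -- two complementary proper subsets are not comparable, so no flag contains both
    rw [Finset.filter_congr (q := fun t => M.toMatroid.E \ F ∈ t) fun t ht =>
      and_iff_right_of_imp ?_]
    · exact hρ _
    intro h3 h2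
    rw [Finite.mem_toFinset] at ht
    obtain ⟨e, he⟩ := hne'
    obtain ⟨f, hf, hfF⟩ := exists_of_ssubset (hFs.ssubset_of_ne hFE)
    rcases ht.1.subset_or_subset h2 h3 with h4 | h4
    · exact (h4 he).2 he
    · exact hfF (h4 ⟨hf, hfF⟩)
  · rw [← Finset.sum_const_zero]
    refine HasResidue.sum fun t ht => ?_
    simp only [Finset.mem_filter, Finite.mem_toFinset] at ht
    obtain ⟨h2, h3, h4⟩ := ht
    refine hasResidue_prod_zero fun H hH => ?_
    obtain ⟨k1, k2, k3⟩ := of_mem_tail_flagsIn h2 hH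
    have hHt := List.mem_of_mem_tail hH
    exact restrictZero_aForm_ne_zero_of_ne k2 k1 k3 hFs (fun h' => h3 (h' ▸ hHt))
      (fun h' => h4 (h' ▸ hHt))

/-- Residues of an amplitude along `a_F = 0`, if only one face of `P` lies on this
divisor. -/
theorem IsFull.hasResidue_amplitude_of_notMem [M.toMatroid.Loopless] (hP : M.IsFull P)
    (hF : F ∈ M.faces P) (hne : F ≠ ∅) (hFE : F ≠ M.toMatroid.E)
    (hc : M.toMatroid.E \ F ∉ M.faces P) :
    HasResidue M.toMatroid.E F (M.amplitude P)
      (M.amplitudeProduct P F F (M.faces_subset hF) (Or.inl rfl) (Or.inr rfl)) := by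
  have h := hP.hasResidue_amplitude_add hF hne hFE (ρ := 0) fun _ => by
    rw [Finset.filter_false_of_mem, Finset.sum_empty]
    · exact hasResidue_zero
    · intro t ht ht'
      exact hc (((Finite.mem_toFinset _).1 ht).2.2 _ ht')
  rwa [add_zero] at h

/-- Residues of an amplitude along `a_F = 0`, if both `F` and its complement are
faces of `P`; the sign of the second term comes from `a_{E ∖ F} = -a_F`. -/
theorem IsFull.hasResidue_amplitude_of_mem [M.toMatroid.Loopless] (hP : M.IsFull P)
    (hF : F ∈ M.faces P) (hne : F ≠ ∅) (hFE : F ≠ M.toMatroid.E)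
    (hc : M.toMatroid.E \ F ∈ M.faces P) :
    HasResidue M.toMatroid.E F (M.amplitude P)
      (M.amplitudeProduct P F F (M.faces_subset hF) (Or.inl rfl) (Or.inr rfl) -
        M.amplitudeProduct P (M.toMatroid.E \ F) F sdiff_subset (Or.inr rfl)
          (Or.inl (sdiff_sdiff_cancel_left (M.faces_subset hF)))) := by
  have hFs := M.faces_subset hF
  have hne' := nonempty_iff_ne_empty.2 hne
  rw [sub_eq_add_neg]
  refine hP.hasResidue_amplitude_add hF hne hFE fun _ => ?_
  obtain ⟨f, hf, hfF⟩ := exists_of_ssubset (hFs.ssubset_of_ne hFE)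
  have h1 := hasResidue_sum_filter_mem (D := F)
    (L' := (M.contractBy (M.toMatroid.E \ F) sdiff_subset).faces
      ((M.toMatroid.E \ F)ᶜ.indicator P)) hc (isFlat_of_mem_faces hc) ⟨f, hf, hfF⟩
    (fun h' => by
      obtain ⟨e, he⟩ := hne'
      exact (h'.ge (hFs he)).2 he)
    (fun G hG => hP.mem_faces_contract_iff hc _ _ _ hG) hFs (Or.inr rfl)
  have h2 : formQ₀ M.toMatroid.E (M.toMatroid.E \ F) * (formQ₀ M.toMatroid.E F)⁻¹ = -1 := by
    rw [formQ₀, aForm_sdiff, map_neg, neg_mul,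
      mul_inv_cancel₀ (algebraMap_Q₀_ne_zero (aForm_ne_zero hFs hne' hFE))]
  rw [h2, neg_one_mul] at h1
  have h3 := h1.neg
  rw [neg_neg] at h3
  rw [hP.amplitudeProduct_eq hc]
  exact h3

/-- The amplitude is regular along all divisors other than those of the proper faces. -/
theorem IsFull.regularAlong_amplitude [M.toMatroid.Loopless] (hP : M.IsFull P)
    {π : R₀ M.toMatroid.E} (hπ : Prime π)
    (h : ∀ F ∈ M.faces P, F.Nonempty → F ≠ M.toMatroid.E → ¬ Associated π (aForm M.toMatroid.E F)) :
    RegularAlong π (M.amplitude P) := by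
  rw [hP.amplitude_eq]
  refine regularAlong_sum hπ fun t ht => regularAlong_prod_inv hπ fun G hG hd => ?_
  have ht' := (Finite.mem_toFinset _).1 ht
  obtain ⟨h1, h2, h3⟩ := of_mem_tail_flagsIn ht' hG
  exact h G (ht'.2.2 G (List.mem_of_mem_tail hG)) h1 h3
    (hπ.associated_of_dvd (prime_aForm h2 h1 h3) hd)

theorem IsFull.amplitudeProduct_eq_zero [M.toMatroid.Loopless] (hP : M.IsFull P)
    (hF : F ∈ M.faces P) (h₁ : F = D ∨ F = M.toMatroid.E \ D)
    (h₂ : M.toMatroid.E \ F = D ∨ M.toMatroid.E \ F = M.toMatroid.E \ D)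
    (hdec : ¬ Connected (M.toMatroid ↾ F)) :
    M.amplitudeProduct P F D (M.faces_subset hF) h₁ h₂ = 0 := by
  have : (M.restrictTo F (M.faces_subset hF)).toMatroid.Loopless :=
    loopless_restrict (M := M.toMatroid) (M.faces_subset hF)
  have hfull : (M.restrictTo F (M.faces_subset hF)).IsFull (F.indicator P) := hP.restrict _ _ _ _
  have h0 : M.restrictAmplitude P F (M.faces_subset hF) = 0 :=
    hfull.amplitude_eq_zero (not_not.1 hdec)
  rw [amplitudeProduct, h0, map_zero, zero_mul]

/-- Poles lie along divisors of connected faces: if `M|F` is decomposable, and `M|(E ∖ F)` too in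
case `E ∖ F` is a face, then the residue along `a_F = 0` vanishes, so there is no pole. -/
theorem IsFull.exists_connected_of_not_regularAlong [M.toMatroid.Loopless] (hP : M.IsFull P)
    {π : R₀ M.toMatroid.E} (hπ : Prime π) (h : ¬ RegularAlong π (M.amplitude P)) :
    ∃ F ∈ M.faces P, F ≠ ∅ ∧ F ≠ M.toMatroid.E ∧ Connected (M.toMatroid ↾ F) ∧
      Associated π (aForm M.toMatroid.E F) := by
  have h1 : ∃ F ∈ M.faces P, F ≠ ∅ ∧ F ≠ M.toMatroid.E ∧
      Associated π (aForm M.toMatroid.E F) := by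
    by_contra! hcon
    exact h (hP.regularAlong_amplitude hπ hcon)
  obtain ⟨F, hF, hne, hFE, hassoc⟩ := h1
  have hFs := M.faces_subset hF
  have hF0 := aForm_ne_zero hFs (nonempty_iff_ne_empty.2 hne) hFE
  by_cases hconn : Connected (M.toMatroid ↾ F)
  · exact ⟨F, hF, hne, hFE, hconn, hassoc⟩
  by_cases hc : M.toMatroid.E \ F ∈ M.faces P
  · by_cases hconn' : Connected (M.toMatroid ↾ (M.toMatroid.E \ F))
    · refine ⟨_, hc, fun h' => hFE (subset_antisymm hFs (sdiff_eq_empty.1 h')), fun h' => hne ?_,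
        hconn', ?_⟩
      · rw [← sdiff_sdiff_cancel_left hFs, h', Set.sdiff_self]
      · rw [aForm_sdiff]
        exact hassoc.neg_right
    · have h2 := hP.hasResidue_amplitude_of_mem hF hne hFE hc
      rw [hP.amplitudeProduct_eq_zero hF _ _ hconn, hP.amplitudeProduct_eq_zero hc _ _ hconn',
        sub_zero] at h2
      exact absurd (h2.regularAlong hF0 hassoc) h
  · have h2 := hP.hasResidue_amplitude_of_notMem hF hne hFE hc
    rw [hP.amplitudeProduct_eq_zero hF _ _ hconn] at h2
    exact absurd (h2.regularAlong hF0 hassoc) h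

/-- All poles of an amplitude are simple. -/
theorem IsFull.regularAlong_mul_amplitude [M.toMatroid.Loopless] (hP : M.IsFull P)
    {π : R₀ M.toMatroid.E} (hπ : Prime π) :
    RegularAlong π (algebraMap (R₀ M.toMatroid.E) (Q₀ M.toMatroid.E) π * M.amplitude P) := by
  by_cases h : ∃ F ∈ M.faces P, F ≠ ∅ ∧ F ≠ M.toMatroid.E ∧
      Associated π (aForm M.toMatroid.E F)
  · obtain ⟨F, hF, hne, hFE, hassoc⟩ := h
    by_cases hc : M.toMatroid.E \ F ∈ M.faces P
    · exact (hP.hasResidue_amplitude_of_mem hF hne hFE hc).regularAlong_mul hassoc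
    · exact (hP.hasResidue_amplitude_of_notMem hF hne hFE hc).regularAlong_mul hassoc
  · push Not at h
    exact (hP.regularAlong_amplitude hπ h).mul_left π

end OrientedMatroid

end Residues

end

end MatroidAmplitude

end

theorem mainTheorem9 {α : Type*} [Fintype α] (M : MatroidAmplitude.OrientedMatroid α)
    [M.toMatroid.Loopless] :
    -- amplitudes of a decomposable matroid vanish
    (MatroidAmplitude.Decomposable M.toMatroid → ∀ P, M.IsTope P → M.amplitude P = 0) ∧
    (MatroidAmplitude.Connected M.toMatroid → ∀ P, M.IsTope P →
      -- all poles are simple, and lie along `a_F = 0` for proper connected `F ∈ L(P)`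
      (∀ π : MatroidAmplitude.R₀ M.toMatroid.E, Prime π →
        MatroidAmplitude.RegularAlong π
          (algebraMap _ (MatroidAmplitude.Q₀ M.toMatroid.E) π * M.amplitude P) ∧
        (¬ MatroidAmplitude.RegularAlong π (M.amplitude P) →
          ∃ F ∈ M.faces P, F ≠ ∅ ∧ F ≠ M.toMatroid.E ∧
            MatroidAmplitude.Connected (M.toMatroid.restrict F) ∧
            Associated π (MatroidAmplitude.aForm M.toMatroid.E F))) ∧
      -- residues along `a_F = 0` for proper `F ∈ L(P)`
      ∀ (F : Set α) (hF : F ∈ M.faces P), F ≠ ∅ → F ≠ M.toMatroid.E →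
        (M.toMatroid.E \ F ∉ M.faces P →
          MatroidAmplitude.HasResidue M.toMatroid.E F (M.amplitude P)
            (M.amplitudeProduct P F F (M.faces_subset hF) (Or.inl rfl) (Or.inr rfl))) ∧
        (M.toMatroid.E \ F ∈ M.faces P →
          MatroidAmplitude.HasResidue M.toMatroid.E F (M.amplitude P)
            (M.amplitudeProduct P F F (M.faces_subset hF) (Or.inl rfl) (Or.inr rfl) -
              M.amplitudeProduct P (M.toMatroid.E \ F) F Set.sdiff_subset (Or.inr rfl)
                (Or.inl (Set.sdiff_sdiff_cancel_left (M.faces_subset hF)))))) := by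
  refine ⟨fun hM P hP => hP.isFull.amplitude_eq_zero hM, fun _ P hP => ⟨fun π hπ =>
    ⟨hP.isFull.regularAlong_mul_amplitude hπ,
      hP.isFull.exists_connected_of_not_regularAlong hπ⟩, fun F hF hne hFE =>
    ⟨hP.isFull.hasResidue_amplitude_of_notMem hF hne hFE,
      hP.isFull.hasResidue_amplitude_of_mem hF hne hFE⟩⟩⟩
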